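/- Let $n\ge 5$ be an integer and let $C^\infty_{c,\mathrm{rad}}(\mathbb{R}^n)$ be the set of smooth, compactly supported, radial, complex-valued functions on $\mathbb{R}^n$. For $u\in C^\infty_c(\mathbb{R}^n)$ and real $\sigma, \tau\ge 0$ put $$\mathcal{F}u(\xi)=\frac{1}{(2\pi)^{n/2}}\int_{\mathbb{R}^n}u(x)e^{-i\xi\cdot x}\,dx,\qquad \|u\|_{\dot H^\sigma}=\big\||\cdot|^{\sigma}\mathcal{F}u\big\|_{L^2(\mathbb{R}^n)},\qquad \|u\|_{\dot H^{\sigma}\cap\dot H^{\tau}}=\big(\|u\|_{\dot H^{\sigma}}^2+\|u\|_{\dot H^{\tau}}^2\big)^{1/2}.$$ Let $F\in C^\infty(\mathbb{R})$ be an even (real- or complex-valued) function such that for every $\ell\in\mathbb{N}_0$ the derivative $F^{(\ell)}$ is bounded on $\mathbb{R}$. Let $$\frac n2-1<s\le \frac n2-1+\frac1{2(n-2)},\qquad k\in\mathbb{N},\quad k>n.$$ Then there is a constant $C>0$, depending only on $n,F,s,k$, such that for all $u_1,u_2,u_3,v\in C^\infty_{c,\mathrm{rad}}(\mathbb{R}^n)$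 with $v$ real-valued, the function $u_1u_2u_3F(|\cdot|v)$ belongs to $C^\infty_{c,\mathrm{rad}}(\mathbb{R}^n)$ and $$\big\|u_1u_2u_3\,F(|\cdot|v)\big\|_{\dot H^{s-1}\cap\dot H^{k}}\le C\,\prod_{i=1}^{3}\|u_i\|_{\dot H^{s}\cap\dot H^{k}}\ \sum_{j=0}^{k}\|v\|_{\dot H^{s}\cap\dot H^{k}}^{2j}.$$ -/

import Mathlib

open MeasureTheory
open scoped ENNReal ContDiff

namespace RadialSchauder

/-- Membership in `C^∞_{c,rad}(ℝⁿ)`, for functions with values in a real normed space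
(below: `ℝ` or `ℂ`). -/
structure IsRadialTest {n : ℕ} {V : Type*} [NormedAddCommGroup V] [NormedSpace ℝ V]
    (u : EuclideanSpace ℝ (Fin n) → V) : Prop where
  smooth : ContDiff ℝ ∞ u
  compactSupport : HasCompactSupport u
  radial : ∀ x y : EuclideanSpace ℝ (Fin n), ‖x‖ = ‖y‖ → u x = u y

/-- The Fourier transform `ξ ↦ (2π)^{-n/2} ∫ u(x) e^{-i ξ·x} dx`. -/
noncomputable def fourier {n : ℕ} (u : EuclideanSpace ℝ (Fin n) → ℂ)
    (ξ : EuclideanSpace ℝ (Fin n)) : ℂ :=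
  (((2 * Real.pi) ^ (-(n : ℝ) / 2) : ℝ) : ℂ) *
    ∫ x : EuclideanSpace ℝ (Fin n), u x * Complex.exp (-(Complex.I * ((inner ℝ ξ x : ℝ) : ℂ)))

/-- The homogeneous Sobolev norm `‖ |·|^s 𝓕u ‖_{L²(ℝⁿ)}`, as an extended nonnegative real, so that
an upper bound for it by a finite quantity includes its finiteness. -/
noncomputable def hNorm {n : ℕ} (s : ℝ) (u : EuclideanSpace ℝ (Fin n) → ℂ) : ℝ≥0∞ :=
  eLpNorm (fun ξ : EuclideanSpace ℝ (Fin n) => ((‖ξ‖ ^ s : ℝ) : ℂ) * fourier u ξ) 2 volume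

/-- The norm on the intersection of the homogeneous Sobolev spaces of orders `s₁` and `s₂` that is
induced by the sum of the two inner products. -/
noncomputable def hInterNorm {n : ℕ} (s₁ s₂ : ℝ) (u : EuclideanSpace ℝ (Fin n) → ℂ) : ℝ≥0∞ :=
  (hNorm s₁ u ^ 2 + hNorm s₂ u ^ 2) ^ (1 / 2 : ℝ)

end RadialSchauder

/-! Put `m = n / 2 - 2` (integer division), `δ = 1 + s - n/2` and `X = max 1 |x|`. Then `m ≤ s - 1 ≤
k`, so by Plancherel and interpolation it suffices to bound the derivatives of orders `m` and `k` of
the product in L². The bounds on `s` give `0 < δ ≤ 1/6` and `(n - 2) δ ≤ 1/2`.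

Two facts about a radial `u` feed the argument. By the fractional Hardy inequality (`exists_hardy`),
`D^a u` divided by `X ^ max (s - a) 0` is in L². Combined with a Strauss-type argument on annuli
(`exists_enorm_sq_le_lintegral_annulus`) and Sobolev embedding for `|x| ≤ 1`, this gives the
pointwise decay `|D^a u| ≲ X ^ (1 - n/2 + max (s - a - 1) 0)` for `a ≤ k/2`
(`exists_norm_iteratedFDeriv_le`).

The factor `F(|x| v)` equals `F(√w)` with `w = |x|² v²`, as `F` is even. The gradient of `F ∘ √w` is
`Q(√w) ∇(w/2)` with `Q(y) = F'(y)/y`, and `Q` is again even and smooth with bounded derivatives.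
Induction on the order bounds all derivatives through those of `w` (`exists_comp_sqrt_bound`). The
function `w` may grow like `X^(2δ)`, but each term of the chain rule contains a derivative of `w`,
and the loss `X^(2δ)` is absorbed into the decay gained per derivative.

At order `m` every factor decays by `X⁻¹` per derivative; `u 0` is put in weighted L² and all else
is estimated pointwise. At order `k` a derivative is bounded by a term decaying by `X^(-1/2)` per
derivative plus a remainder, the sum of the derivatives of orders `m + 2` to `k`, which is in L²
because `m + 2 ≥ s`. In a product of total order at most `k` one of two factors has order at most
`k/2` and is bounded pointwise, so remainders never multiply each other (`DerivBound.mul`). The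
remainder-free term is a power of `X` that is square integrable since `k > n`. -/

namespace RadialSchauder

open scoped SchwartzMap FourierTransform LineDeriv

/-! ### Plancherel, interpolation between orders, and Sobolev embedding -/

section Fourier

variable {V : Type*} [NormedAddCommGroup V] [InnerProductSpace ℝ V] [FiniteDimensional ℝ V]
  [MeasurableSpace V] [BorelSpace V]

/-- The square of the homogeneous Sobolev norm of order `t`, up to a normalisation. -/
noncomputable def energy (t : ℝ) (g : 𝓢(V, ℂ)) : ℝ≥0∞ :=
  ∫⁻ ξ, ENNReal.ofReal (‖ξ‖ ^ (2 * t)) * ‖𝓕 g ξ‖ₑ ^ 2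

theorem lintegral_enorm_sq_eq_ofReal (f : 𝓢(V, ℂ)) :
    ∫⁻ x, ‖f x‖ₑ ^ 2 = ENNReal.ofReal (∫ x, ‖f x‖ ^ 2) := by
  rw [ofReal_integral_eq_lintegral_ofReal]
  · refine lintegral_congr fun x => ?_
    rw [ENNReal.ofReal_pow (norm_nonneg _), ofReal_norm]
  · exact (f.memLp 2).integrable_norm_pow (by norm_num)
  · exact ae_of_all _ fun x => by positivity

theorem lintegral_enorm_sq_fourier (f : 𝓢(V, ℂ)) :
    ∫⁻ ξ, ‖𝓕 f ξ‖ₑ ^ 2 = ∫⁻ x, ‖f x‖ₑ ^ 2 := by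
  rw [lintegral_enorm_sq_eq_ofReal, lintegral_enorm_sq_eq_ofReal,
    SchwartzMap.integral_norm_sq_fourier]

theorem energy_zero (g : 𝓢(V, ℂ)) : energy 0 g = ∫⁻ x, ‖g x‖ₑ ^ 2 := by
  simp [energy, lintegral_enorm_sq_fourier]

theorem rpow_le_rpow_add_rpow {x a b c : ℝ} (hx : 0 ≤ x) (ha : 0 ≤ a) (hab : a ≤ b)
    (hbc : b ≤ c) : x ^ b ≤ x ^ a + x ^ c := by
  rcases le_total x 1 with h | h
  · exact (Real.rpow_le_rpow_of_exponent_ge' hx h ha hab).trans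
      (le_add_of_nonneg_right (Real.rpow_nonneg hx _))
  · exact (Real.rpow_le_rpow_of_exponent_le h hbc).trans
      (le_add_of_nonneg_left (Real.rpow_nonneg hx _))

theorem measurable_enorm_fourier (g : 𝓢(V, ℂ)) : Measurable fun ξ => ‖𝓕 g ξ‖ₑ :=
  (𝓕 g).continuous.measurable.enorm

/-- The multiplier of an intermediate order is pointwise at most the sum of the multipliers of the
outer orders. This crude interpolation is the only one needed, as the norms involved always contain
both ends. -/
theorem energy_le_add (g : 𝓢(V, ℂ)) {a b c : ℝ} (ha : 0 ≤ a) (hab : a ≤ b) (hbc : b ≤ c) :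
    energy b g ≤ energy a g + energy c g := by
  unfold energy
  rw [← lintegral_add_left]
  · refine lintegral_mono fun ξ => ?_
    rw [← add_mul, ← ENNReal.ofReal_add (by positivity) (by positivity)]
    gcongr
    exact rpow_le_rpow_add_rpow (norm_nonneg _) (by linarith) (by linarith) (by linarith)
  · have := measurable_enorm_fourier g
    fun_prop

theorem energy_natCast_lt_top (N : ℕ) (g : 𝓢(V, ℂ)) : energy N g < ⊤ := by
  obtain ⟨C, hC⟩ := (𝓕 g).decay 0 0
  have hC' : ∀ ξ, ‖𝓕 g ξ‖ ≤ C := fun ξ => by simpa using hC.2 ξ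
  have hi := (𝓕 g).integrable_pow_mul volume (2 * N)
  have hi2 : Integrable fun ξ => C * (‖ξ‖ ^ (2 * N) * ‖𝓕 g ξ‖) := hi.const_mul C
  refine lt_of_le_of_lt ?_ hi2.lintegral_lt_top
  refine lintegral_mono fun ξ => ?_
  rw [← ofReal_norm, ← ENNReal.ofReal_pow (norm_nonneg _), ← ENNReal.ofReal_mul (by positivity)]
  refine ENNReal.ofReal_le_ofReal ?_
  have h1 : ‖ξ‖ ^ (2 * (N : ℝ)) = ‖ξ‖ ^ (2 * N) := by
    rw [← Real.rpow_natCast]; push_cast; rfl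
  rw [h1, sq]
  have := hC' ξ
  have h0 : 0 ≤ ‖ξ‖ ^ (2 * N) * ‖𝓕 g ξ‖ := by positivity
  nlinarith [mul_le_mul_of_nonneg_left this h0]

theorem energy_lt_top {t : ℝ} (ht : 0 ≤ t) (g : 𝓢(V, ℂ)) : energy t g < ⊤ := by
  obtain ⟨N, hN⟩ := exists_nat_ge t
  refine (energy_le_add g le_rfl ht hN).trans_lt (ENNReal.add_lt_top.2 ⟨?_, ?_⟩)
  · simpa using energy_natCast_lt_top 0 g
  · exact energy_natCast_lt_top N g

theorem lintegral_mul_sq_le {α : Type*} [MeasurableSpace α] (μ : Measure α) {f g : α → ℝ≥0∞}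
    (hf : AEMeasurable f μ) (hg : AEMeasurable g μ) :
    (∫⁻ a, f a * g a ∂μ) ^ 2 ≤ (∫⁻ a, f a ^ 2 ∂μ) * ∫⁻ a, g a ^ 2 ∂μ := by
  have h := ENNReal.lintegral_mul_le_Lp_mul_Lq μ Real.HolderConjugate.two_two hf hg
  calc (∫⁻ a, f a * g a ∂μ) ^ 2
      ≤ ((∫⁻ a, f a ^ (2 : ℝ) ∂μ) ^ (1 / (2 : ℝ)) * (∫⁻ a, g a ^ (2 : ℝ) ∂μ) ^ (1 / (2 : ℝ))) ^ 2 :=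
        pow_le_pow_left' h 2
    _ = _ := by
        rw [mul_pow, ← ENNReal.rpow_natCast, ← ENNReal.rpow_natCast, ← ENNReal.rpow_mul,
          ← ENNReal.rpow_mul]
        norm_num

theorem ae_ne_zero_of_nontrivial [Nontrivial V] : ∀ᵐ ξ : V, ξ ≠ 0 := by
  have : (volume : Measure V) {0} = 0 := measure_singleton 0
  exact compl_mem_ae_iff.2 this

/-- Weighted Cauchy–Schwarz inequality. -/
theorem lintegral_sq_le_of_weight {α : Type*} [MeasurableSpace α] (μ : Measure α) {f : α → ℝ≥0∞}
    {w : α → ℝ} (hf : AEMeasurable f μ) (hw : Measurable w) (hpos : ∀ᵐ a ∂μ, 0 < w a) :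
    (∫⁻ a, f a ∂μ) ^ 2 ≤
      (∫⁻ a, ENNReal.ofReal (w a)⁻¹ ∂μ) * ∫⁻ a, ENNReal.ofReal (w a) * f a ^ 2 ∂μ := by
  have h := lintegral_mul_sq_le μ (f := fun a => ENNReal.ofReal (√(w a))⁻¹)
    (g := fun a => ENNReal.ofReal (√(w a)) * f a) (by fun_prop) (by fun_prop)
  refine le_trans (le_of_eq ?_) (h.trans (le_of_eq ?_))
  · congr 1
    refine lintegral_congr_ae ?_
    filter_upwards [hpos] with a ha
    rw [← mul_assoc, ← ENNReal.ofReal_mul (by positivity), inv_mul_cancel₀ (by positivity)]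
    simp
  · congr 1
    · refine lintegral_congr_ae ?_
      filter_upwards [hpos] with a ha
      rw [← ENNReal.ofReal_pow (by positivity), inv_pow, Real.sq_sqrt ha.le]
    · refine lintegral_congr_ae ?_
      filter_upwards [hpos] with a ha
      rw [mul_pow, ← ENNReal.ofReal_pow (by positivity), Real.sq_sqrt ha.le]

theorem enorm_fourierInv_le (h : 𝓢(V, ℂ)) (x : V) : ‖𝓕⁻ h x‖ₑ ≤ ∫⁻ ξ, ‖h ξ‖ₑ := by
  rw [SchwartzMap.fourierInv_coe, Real.fourierInv_eq']
  refine (enorm_integral_le_lintegral_enorm _).trans (lintegral_mono fun ξ => ?_)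
  rw [enorm_smul]
  have : ‖Complex.exp (((2 * Real.pi * inner ℝ ξ x : ℝ) : ℂ) * Complex.I)‖ₑ = 1 := by
    rw [← ofReal_norm, Complex.norm_exp_ofReal_mul_I]; simp
  rw [this, one_mul]

theorem enorm_le_lintegral_fourier (g : 𝓢(V, ℂ)) (x : V) : ‖g x‖ₑ ≤ ∫⁻ ξ, ‖𝓕 g ξ‖ₑ := by
  simpa using enorm_fourierInv_le (𝓕 g) x

theorem lintegral_comp_smul_of_pos (f : V → ℝ≥0∞) {R : ℝ} (hR : 0 < R) :
    ∫⁻ x, f (R • x) = ENNReal.ofReal (R ^ (-(Module.finrank ℝ V : ℝ))) * ∫⁻ x, f x := by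
  have he : MeasurableEmbedding fun x : V => R • x :=
    (Homeomorph.smulOfNeZero R hR.ne').measurableEmbedding
  rw [← he.lintegral_map, Measure.map_addHaar_smul volume hR.ne', lintegral_smul_measure,
    smul_eq_mul, abs_of_pos (by positivity), Real.rpow_neg hR.le, Real.rpow_natCast]

theorem lintegral_ball_rpow_lt_top [Nontrivial V] {α : ℝ} (hα : 2 * α < Module.finrank ℝ V) :
    ∫⁻ ξ in Metric.ball (0 : V) 1, ENNReal.ofReal (‖ξ‖ ^ (2 * α))⁻¹ < ⊤ := by
  have h : IntegrableOn (fun ξ : V => (‖ξ‖ ^ (2 * α))⁻¹) (Metric.ball 0 1) := by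
    refine integrableOn_ball_of_norm_le_rpow (C := 1) Module.finrank_pos hα
      (ae_of_all _ fun x => ?_) (Measurable.aestronglyMeasurable (by fun_prop))
    rw [Real.norm_of_nonneg (by positivity), one_mul, Real.rpow_neg (norm_nonneg _)]
  exact h.lintegral_lt_top

theorem lintegral_ball_rpow_eq {α R : ℝ} (hR : 0 < R) :
    ∫⁻ ξ in Metric.ball (0 : V) R, ENNReal.ofReal (‖ξ‖ ^ (2 * α))⁻¹ =
      ENNReal.ofReal (R ^ ((Module.finrank ℝ V : ℝ) - 2 * α)) *
        ∫⁻ ξ in Metric.ball (0 : V) 1, ENNReal.ofReal (‖ξ‖ ^ (2 * α))⁻¹ := by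
  rw [← lintegral_indicator measurableSet_ball, ← lintegral_indicator measurableSet_ball]
  have h := lintegral_comp_smul_of_pos (V := V)
    ((Metric.ball (0 : V) R).indicator fun ξ => ENNReal.ofReal (‖ξ‖ ^ (2 * α))⁻¹) hR
  have h2 : ∀ x : V, (Metric.ball (0 : V) R).indicator
      (fun ξ => ENNReal.ofReal (‖ξ‖ ^ (2 * α))⁻¹) (R • x) =
      ENNReal.ofReal (R ^ (2 * α))⁻¹ * (Metric.ball (0 : V) 1).indicator
      (fun ξ => ENNReal.ofReal (‖ξ‖ ^ (2 * α))⁻¹) x := by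
    intro x
    have hiff : R • x ∈ Metric.ball (0 : V) R ↔ x ∈ Metric.ball (0 : V) 1 := by
      simp only [mem_ball_zero_iff, norm_smul, Real.norm_of_nonneg hR.le]
      constructor <;> intro h <;> nlinarith
    by_cases hx : x ∈ Metric.ball (0 : V) 1
    · rw [Set.indicator_of_mem hx, Set.indicator_of_mem (hiff.2 hx),
        ← ENNReal.ofReal_mul (by positivity), norm_smul, Real.norm_of_nonneg hR.le,
        Real.mul_rpow hR.le (norm_nonneg _), mul_inv]
    · rw [Set.indicator_of_notMem hx, Set.indicator_of_notMem (fun h => hx (hiff.1 h)), mul_zero]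
  simp_rw [h2] at h
  rw [lintegral_const_mul' _ _ ENNReal.ofReal_ne_top] at h
  have h3 : ENNReal.ofReal (R ^ ((Module.finrank ℝ V : ℝ) - 2 * α)) =
      ENNReal.ofReal (R ^ (Module.finrank ℝ V : ℝ)) * ENNReal.ofReal (R ^ (2 * α))⁻¹ := by
    rw [← ENNReal.ofReal_mul (by positivity), Real.rpow_sub hR, div_eq_mul_inv]
  rw [h3, mul_assoc, h, ← mul_assoc, ← ENNReal.ofReal_mul (by positivity), ← Real.rpow_add hR]
  simp

/-- Cauchy–Schwarz on low frequencies; useful when `2 * α` is less than the dimension, so that the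
first factor is finite. It supplies the sup bound for the low-frequency part in Hardy's inequality.
-/
theorem lintegral_ball_sq_le [Nontrivial V] {α R : ℝ} (hR : 0 < R) {f : V → ℝ≥0∞}
    (hf : Measurable f) :
    (∫⁻ ξ in Metric.ball (0 : V) R, f ξ) ^ 2 ≤
      (∫⁻ ξ in Metric.ball (0 : V) 1, ENNReal.ofReal (‖ξ‖ ^ (2 * α))⁻¹) *
        (ENNReal.ofReal (R ^ ((Module.finrank ℝ V : ℝ) - 2 * α)) *
        ∫⁻ ξ in Metric.ball (0 : V) R, ENNReal.ofReal (‖ξ‖ ^ (2 * α)) * f ξ ^ 2) := by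
  refine (lintegral_sq_le_of_weight (volume.restrict (Metric.ball (0 : V) R)) hf.aemeasurable
    (w := fun ξ => ‖ξ‖ ^ (2 * α)) (by fun_prop) ?_).trans (le_of_eq ?_)
  · refine ae_restrict_of_ae ?_
    filter_upwards [ae_ne_zero_of_nontrivial (V := V)] with ξ hξ
    have := norm_pos_iff.2 hξ
    positivity
  · rw [lintegral_ball_rpow_eq hR]
    ring

/-- Sobolev embedding into bounded functions. -/
theorem exists_enorm_sq_le_energy [Nontrivial V] {a b : ℝ} (ha : 2 * a < Module.finrank ℝ V)
    (hb : Module.finrank ℝ V < 2 * b) :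
    ∃ C : ℝ≥0∞, C ≠ ⊤ ∧ ∀ (g : 𝓢(V, ℂ)) (x : V),
      ‖g x‖ₑ ^ 2 ≤ C * (energy a g + energy b g) := by
  -- The inverse weight is integrable: near the origin because of the power `2a` below the
  -- dimension, at infinity because of the power `2b` above it.
  refine ⟨∫⁻ ξ : V, ENNReal.ofReal (‖ξ‖ ^ (2 * a) + ‖ξ‖ ^ (2 * b))⁻¹, ?_, fun g x => ?_⟩
  · rw [← lintegral_add_compl _ (measurableSet_ball (x := (0 : V)) (ε := 1))]
    refine (ENNReal.add_lt_top.2 ⟨?_, ?_⟩).ne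
    · refine lt_of_le_of_lt ?_ (lintegral_ball_rpow_lt_top (V := V) ha)
      refine setLIntegral_mono_ae (by fun_prop) ?_
      filter_upwards [ae_ne_zero_of_nontrivial (V := V)] with ξ hξ _
      have := norm_pos_iff.2 hξ
      gcongr
      exact le_add_of_nonneg_right (by positivity)
    · have hfin := finite_integral_one_add_norm (E := V) (μ := volume) hb
      have hfin2 : ∫⁻ x : V, ENNReal.ofReal (2 ^ (2 * b)) *
          ENNReal.ofReal ((1 + ‖x‖) ^ (-(2 * b))) < ⊤ := by
        rw [lintegral_const_mul' _ _ ENNReal.ofReal_ne_top]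
        exact ENNReal.mul_lt_top ENNReal.ofReal_lt_top hfin
      refine lt_of_le_of_lt ?_ hfin2
      refine (setLIntegral_mono' measurableSet_ball.compl fun ξ hξ => ?_).trans
        (setLIntegral_le_lintegral _ _)
      have h1 : 1 ≤ ‖ξ‖ := by simpa using hξ
      rw [← ENNReal.ofReal_mul (by positivity)]
      refine ENNReal.ofReal_le_ofReal ?_
      rw [Real.rpow_neg (by positivity), ← div_eq_mul_inv, ← one_div,
        div_le_div_iff₀ (by positivity) (by positivity), one_mul]
      calc (1 + ‖ξ‖) ^ (2 * b) ≤ (2 * ‖ξ‖) ^ (2 * b) := by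
            have : (0 : ℝ) ≤ 2 * b := le_trans (Nat.cast_nonneg _) hb.le
            gcongr; linarith
        _ = 2 ^ (2 * b) * ‖ξ‖ ^ (2 * b) := Real.mul_rpow (by norm_num) (by positivity)
        _ ≤ _ := by gcongr; exact le_add_of_nonneg_left (by positivity)
  · have hm := measurable_enorm_fourier g
    calc ‖g x‖ₑ ^ 2 ≤ (∫⁻ ξ, ‖𝓕 g ξ‖ₑ) ^ 2 := pow_le_pow_left' (enorm_le_lintegral_fourier g x) 2
      _ ≤ _ := lintegral_sq_le_of_weight volume hm.aemeasurable
          (w := fun ξ => ‖ξ‖ ^ (2 * a) + ‖ξ‖ ^ (2 * b)) (by fun_prop) (by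
            filter_upwards [ae_ne_zero_of_nontrivial (V := V)] with ξ hξ
            have := norm_pos_iff.2 hξ
            positivity)
      _ = _ := by
          congr 1
          unfold energy
          rw [← lintegral_add_left (by fun_prop)]
          refine lintegral_congr fun ξ => ?_
          rw [← add_mul, ENNReal.ofReal_add (by positivity) (by positivity)]

end Fourier

/-! ### Fractional Hardy inequality by frequency splitting at scale `1 / r` -/

section Hardy

variable {V : Type*} [NormedAddCommGroup V] [InnerProductSpace ℝ V] [FiniteDimensional ℝ V]
  [MeasurableSpace V] [BorelSpace V]

theorem ennreal_add_sq_le (a b : ℝ≥0∞) : (a + b) ^ 2 ≤ 2 * a ^ 2 + 2 * b ^ 2 := by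
  have h := ENNReal.rpow_add_le_mul_rpow_add_rpow a b (p := 2) (by norm_num)
  rw [← mul_add]
  norm_num at h
  exact_mod_cast h

/-- Splitting of a function at frequency `1 / r`. -/
theorem exists_low_high (g : 𝓢(V, ℂ)) {r : ℝ} (hr : 0 < r) :
    ∃ l h : 𝓢(V, ℂ), g = l + h ∧
      (∀ x, ‖l x‖ₑ ≤ ∫⁻ ξ in Metric.ball (0 : V) (2 / r), ‖𝓕 g ξ‖ₑ) ∧
      ∫⁻ x, ‖h x‖ₑ ^ 2 ≤ ∫⁻ ξ in (Metric.ball (0 : V) (1 / r))ᶜ, ‖𝓕 g ξ‖ₑ ^ 2 := by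
  -- The cutoff is 1 for `|ξ| ≤ 1 / r` and vanishes for `|ξ| ≥ 2 / r`; the low part is the inverse
  -- transform of `χ · 𝓕 g`.
  let χ : ContDiffBump (0 : V) := ⟨1 / r, 2 / r, by positivity, by gcongr; norm_num⟩
  have hc : HasCompactSupport fun ξ => (χ ξ : ℂ) * 𝓕 g ξ := by
    refine HasCompactSupport.mul_right ?_
    exact χ.hasCompactSupport.comp_left Complex.ofReal_zero
  have hs : ContDiff ℝ ∞ fun ξ => (χ ξ : ℂ) * 𝓕 g ξ :=
    (Complex.ofRealCLM.contDiff.comp χ.contDiff).mul ((𝓕 g).smooth _)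
  let p : 𝓢(V, ℂ) := hc.toSchwartzMap hs
  have hp : ∀ ξ, p ξ = (χ ξ : ℂ) * 𝓕 g ξ := fun ξ => rfl
  refine ⟨𝓕⁻ p, g - 𝓕⁻ p, by abel, fun x => ?_, ?_⟩
  · refine (enorm_fourierInv_le p x).trans ?_
    rw [← lintegral_indicator measurableSet_ball]
    refine lintegral_mono fun ξ => ?_
    rw [hp]
    by_cases hξ : ξ ∈ Metric.ball (0 : V) (2 / r)
    · rw [Set.indicator_of_mem hξ, enorm_mul]
      have : ‖(χ ξ : ℂ)‖ₑ ≤ 1 := by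
        rw [← ofReal_norm, Complex.norm_of_nonneg χ.nonneg]
        exact ENNReal.ofReal_le_one.2 χ.le_one
      exact mul_le_of_le_one_left' this
    · have h0 : χ ξ = 0 := χ.zero_of_le_dist (by simpa using hξ)
      simp [h0]
  · rw [← lintegral_enorm_sq_fourier, ← lintegral_indicator measurableSet_ball.compl]
    refine lintegral_mono fun ξ => ?_
    have hF : 𝓕 (g - 𝓕⁻ p) ξ = (1 - (χ ξ : ℂ)) * 𝓕 g ξ := by
      have : 𝓕 (g - 𝓕⁻ p) = 𝓕 g - p := by
        rw [sub_eq_add_neg, FourierTransform.fourier_add, FourierTransform.fourier_neg,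
          FourierTransform.fourier_fourierInv_eq, sub_eq_add_neg]
      rw [this, sub_apply, hp]
      ring
    rw [hF]
    by_cases hξ : ξ ∈ (Metric.ball (0 : V) (1 / r))ᶜ
    · rw [Set.indicator_of_mem hξ, enorm_mul]
      have : ‖(1 - (χ ξ : ℂ))‖ₑ ≤ 1 := by
        rw [← ofReal_norm, ← Complex.ofReal_one, ← Complex.ofReal_sub,
          Complex.norm_of_nonneg (sub_nonneg.2 χ.le_one)]
        exact ENNReal.ofReal_le_one.2 (by linarith [χ.nonneg (x := ξ)])
      exact pow_le_pow_left' (mul_le_of_le_one_left' this) 2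
    · have h1 : χ ξ = 1 := by
        refine χ.one_of_mem_closedBall ?_
        rw [Set.notMem_compl_iff] at hξ
        exact Metric.ball_subset_closedBall hξ
      simp [h1]

theorem lintegral_ball_enorm_sq_le (g : 𝓢(V, ℂ)) {r : ℝ} (hr : 0 < r) :
    ∫⁻ x in Metric.ball (0 : V) (2 * r), ‖g x‖ₑ ^ 2 ≤
      2 * ((∫⁻ ξ in Metric.ball (0 : V) (2 / r), ‖𝓕 g ξ‖ₑ) ^ 2 *
        volume (Metric.ball (0 : V) (2 * r))) +
      2 * ∫⁻ ξ in (Metric.ball (0 : V) (1 / r))ᶜ, ‖𝓕 g ξ‖ₑ ^ 2 := by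
  obtain ⟨l, h, rfl, hl, hh⟩ := exists_low_high g hr
  set L := ∫⁻ ξ in Metric.ball (0 : V) (2 / r), ‖𝓕 (l + h) ξ‖ₑ
  have hm : Measurable fun x => ‖h x‖ₑ := h.continuous.measurable.enorm
  calc ∫⁻ x in Metric.ball (0 : V) (2 * r), ‖(l + h) x‖ₑ ^ 2
      ≤ ∫⁻ x in Metric.ball (0 : V) (2 * r), (2 * L ^ 2 + 2 * ‖h x‖ₑ ^ 2) := by
        refine lintegral_mono fun x => ?_
        refine le_trans (pow_le_pow_left' (enorm_add_le _ _) 2) ((ennreal_add_sq_le _ _).trans ?_)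
        gcongr
        exact hl x
    _ = 2 * (L ^ 2 * volume (Metric.ball (0 : V) (2 * r))) +
        2 * ∫⁻ x in Metric.ball (0 : V) (2 * r), ‖h x‖ₑ ^ 2 := by
        rw [lintegral_add_left (by fun_prop), lintegral_const_mul _ (hm.pow_const 2),
          setLIntegral_const, mul_assoc]
    _ ≤ _ := by
        exact add_le_add le_rfl
          (mul_le_mul_right ((setLIntegral_le_lintegral _ _).trans hh) 2)

theorem lintegral_Ioi_rpow {c t : ℝ} (hc : 0 < c) (ht : 0 < t) :
    ∫⁻ r in Set.Ioi c, ENNReal.ofReal (r ^ (-(2 * t) - 1)) =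
      ENNReal.ofReal (c ^ (-(2 * t)) / (2 * t)) := by
  rw [← ofReal_integral_eq_lintegral_ofReal, integral_Ioi_rpow_of_lt (by linarith) hc]
  · congr 1
    have : -(2 * t) - 1 + 1 = -(2 * t) := by ring
    rw [this, div_neg, neg_div, neg_neg]
  · exact integrableOn_Ioi_rpow_of_lt (by linarith) hc
  · filter_upwards [self_mem_ae_restrict measurableSet_Ioi] with r hr
    have : 0 < r := hc.trans hr
    positivity

theorem lintegral_Ioo_rpow {c β : ℝ} (hc : 0 < c) (hβ : 0 < β) :
    ∫⁻ r in Set.Ioo 0 c, ENNReal.ofReal (r ^ (β - 1)) = ENNReal.ofReal (c ^ β / β) := by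
  rw [← ofReal_integral_eq_lintegral_ofReal]
  · rw [← integral_Ioc_eq_integral_Ioo, ← intervalIntegral.integral_of_le hc.le,
      integral_rpow (Or.inl (by linarith))]
    simp [Real.zero_rpow hβ.ne']
  · exact (intervalIntegral.integrableOn_Ioo_rpow_iff hc).2 (by linarith)
  · filter_upwards [self_mem_ae_restrict measurableSet_Ioo] with r hr
    have : 0 < r := hr.1
    positivity

/-- Tonelli's theorem. In each application the admissible scales `r` for fixed `x` form an explicit
interval, so an average over scales becomes a power weight in `|x|` or `|ξ|`. -/
theorem lintegral_mul_setLIntegral_swap {S : Set (ℝ × V)} (hS : MeasurableSet S)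
    {ρ : ℝ → ℝ≥0∞} (hρ : Measurable ρ) {φ : V → ℝ≥0∞} (hφ : Measurable φ) :
    ∫⁻ r in Set.Ioi (0 : ℝ), ρ r * ∫⁻ x in Prod.mk r ⁻¹' S, φ x =
      ∫⁻ x, φ x * ∫⁻ r in Set.Ioi (0 : ℝ) ∩ (fun r => (r, x)) ⁻¹' S, ρ r := by
  have h1 : ∀ r, ρ r * ∫⁻ x in Prod.mk r ⁻¹' S, φ x =
      ∫⁻ x, S.indicator (fun p => ρ p.1 * φ p.2) (r, x) := by
    intro r
    rw [← lintegral_const_mul _ hφ, ← lintegral_indicator (measurable_prodMk_left hS)]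
    rfl
  have h2 : ∀ x, φ x * ∫⁻ r in Set.Ioi (0 : ℝ) ∩ (fun r => (r, x)) ⁻¹' S, ρ r =
      ∫⁻ r in Set.Ioi (0 : ℝ), S.indicator (fun p => ρ p.1 * φ p.2) (r, x) := by
    intro x
    rw [Set.inter_comm, ← Measure.restrict_restrict (measurable_prodMk_right hS),
      ← lintegral_const_mul _ hρ, ← lintegral_indicator (measurable_prodMk_right hS)]
    refine lintegral_congr fun r => ?_
    simp only [Set.indicator, mul_comm]
    rfl
  simp_rw [h1, h2]
  refine lintegral_lintegral_swap (Measurable.aemeasurable ?_)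
  exact Measurable.indicator (by fun_prop) hS

theorem lintegral_rpow_mul_ball_eq [Nontrivial V] {t : ℝ} (ht : 0 < t) {φ : V → ℝ≥0∞}
    (hφ : Measurable φ) :
    ∫⁻ r in Set.Ioi (0 : ℝ), ENNReal.ofReal (r ^ (-(2 * t) - 1)) *
        ∫⁻ x in Metric.ball (0 : V) (2 * r), φ x =
      ∫⁻ x, φ x * ENNReal.ofReal ((‖x‖ / 2) ^ (-(2 * t)) / (2 * t)) := by
  have hS : MeasurableSet {p : ℝ × V | ‖p.2‖ < 2 * p.1} :=
    measurableSet_lt (by fun_prop) (by fun_prop)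
  have h := lintegral_mul_setLIntegral_swap hS
    (ρ := fun r => ENNReal.ofReal (r ^ (-(2 * t) - 1))) (by fun_prop) hφ
  have hb : ∀ r : ℝ, Metric.ball (0 : V) (2 * r) = Prod.mk r ⁻¹' {p : ℝ × V | ‖p.2‖ < 2 * p.1} :=
    fun r => by ext x; simp
  simp only [hb]
  rw [h]
  refine lintegral_congr_ae ?_
  filter_upwards [ae_ne_zero_of_nontrivial (V := V)] with x hx
  have hx' := norm_pos_iff.2 hx
  rw [← lintegral_Ioi_rpow (c := ‖x‖ / 2) (by positivity) ht]
  congr 3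
  ext r
  simp only [Set.mem_inter_iff, Set.mem_Ioi, Set.mem_preimage, Set.mem_ofPred_eq]
  constructor
  · rintro ⟨-, h⟩; linarith
  · intro h; constructor <;> linarith

theorem lintegral_rpow_mul_compl_ball_eq [Nontrivial V] {t : ℝ} (ht : 0 < t) {φ : V → ℝ≥0∞}
    (hφ : Measurable φ) :
    ∫⁻ r in Set.Ioi (0 : ℝ), ENNReal.ofReal (r ^ (-(2 * t) - 1)) *
        ∫⁻ ξ in (Metric.ball (0 : V) (1 / r))ᶜ, φ ξ =
      ∫⁻ ξ, φ ξ * ENNReal.ofReal (‖ξ‖ ^ (2 * t) / (2 * t)) := by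
  have hS : MeasurableSet {p : ℝ × V | 1 / p.1 ≤ ‖p.2‖} :=
    measurableSet_le (by fun_prop) (by fun_prop)
  have h := lintegral_mul_setLIntegral_swap hS
    (ρ := fun r => ENNReal.ofReal (r ^ (-(2 * t) - 1))) (by fun_prop) hφ
  have hb : ∀ r : ℝ, (Metric.ball (0 : V) (1 / r))ᶜ =
      Prod.mk r ⁻¹' {p : ℝ × V | 1 / p.1 ≤ ‖p.2‖} :=
    fun r => by ext x; simp
  simp only [hb]
  rw [h]
  refine lintegral_congr_ae ?_
  filter_upwards [ae_ne_zero_of_nontrivial (V := V)] with x hx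
  have hx' := norm_pos_iff.2 hx
  have h1 : Set.Ioi (0 : ℝ) ∩ (fun r => (r, x)) ⁻¹' {p : ℝ × V | 1 / p.1 ≤ ‖p.2‖} = Set.Ici (1 / ‖x‖) := by
    ext r
    simp only [Set.mem_inter_iff, Set.mem_Ioi, Set.mem_preimage, Set.mem_ofPred_eq, Set.mem_Ici]
    constructor
    · rintro ⟨h0, h⟩; exact (one_div_le h0 hx').1 h
    · intro h
      have h0 : 0 < r := lt_of_lt_of_le (by positivity) h
      exact ⟨h0, (one_div_le h0 hx').2 h⟩
  rw [h1, setLIntegral_congr Ioi_ae_eq_Ici.symm, lintegral_Ioi_rpow (by positivity) ht, one_div,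
    Real.inv_rpow hx'.le, Real.rpow_neg hx'.le, inv_inv]

theorem lintegral_rpow_mul_ball_inv_eq [Nontrivial V] {β : ℝ} (hβ : 0 < β) {φ : V → ℝ≥0∞}
    (hφ : Measurable φ) :
    ∫⁻ r in Set.Ioi (0 : ℝ), ENNReal.ofReal (r ^ (β - 1)) *
        ∫⁻ ξ in Metric.ball (0 : V) (2 / r), φ ξ =
      ∫⁻ ξ, φ ξ * ENNReal.ofReal ((2 / ‖ξ‖) ^ β / β) := by
  have hS : MeasurableSet {p : ℝ × V | ‖p.2‖ < 2 / p.1} :=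
    measurableSet_lt (by fun_prop) (by fun_prop)
  have h := lintegral_mul_setLIntegral_swap hS
    (ρ := fun r => ENNReal.ofReal (r ^ (β - 1))) (by fun_prop) hφ
  have hb : ∀ r : ℝ, Metric.ball (0 : V) (2 / r) = Prod.mk r ⁻¹' {p : ℝ × V | ‖p.2‖ < 2 / p.1} :=
    fun r => by ext x; simp
  simp only [hb]
  rw [h]
  refine lintegral_congr_ae ?_
  filter_upwards [ae_ne_zero_of_nontrivial (V := V)] with x hx
  have hx' := norm_pos_iff.2 hx
  have h1 : Set.Ioi (0 : ℝ) ∩ (fun r => (r, x)) ⁻¹' {p : ℝ × V | ‖p.2‖ < 2 / p.1} =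
      Set.Ioo 0 (2 / ‖x‖) := by
    ext r
    simp only [Set.mem_inter_iff, Set.mem_Ioi, Set.mem_preimage, Set.mem_ofPred_eq, Set.mem_Ioo]
    refine and_congr_right fun h0 => ?_
    rw [lt_div_iff₀ h0, lt_div_iff₀ hx', mul_comm]
  rw [h1, lintegral_Ioo_rpow (by positivity) hβ]

/-- Hardy's inequality of fractional order. -/
theorem exists_hardy [Nontrivial V] {t : ℝ} (ht : 0 < t) (ht' : 2 * t < Module.finrank ℝ V) :
    ∃ C : ℝ≥0∞, C ≠ ⊤ ∧ ∀ g : 𝓢(V, ℂ),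
      ∫⁻ x, ENNReal.ofReal (‖x‖ ^ (-(2 * t))) * ‖g x‖ₑ ^ 2 ≤ C * energy t g := by
  -- An auxiliary exponent `t < b < d / 2`: the upper bound makes `|ξ| ^ (-2b)` locally integrable,
  -- the lower bound makes `r ^ (β - 1)` with `β = 2b - 2t` integrable at `r = 0`.
  obtain ⟨b, hb, hb'⟩ : ∃ b : ℝ, 2 * t < 2 * b ∧ 2 * b < Module.finrank ℝ V :=
    ⟨(t + (Module.finrank ℝ V : ℝ) / 2) / 2, by linarith, by linarith⟩
  set d : ℝ := (Module.finrank ℝ V : ℝ) with hd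
  set A := ∫⁻ ξ in Metric.ball (0 : V) 1, ENNReal.ofReal (‖ξ‖ ^ (2 * b))⁻¹ with hA
  have hAt : A ≠ ⊤ := (lintegral_ball_rpow_lt_top (V := V) hb').ne
  set B := volume (Metric.ball (0 : V) 1) with hB
  have hBt : B ≠ ⊤ := measure_ball_lt_top.ne
  set β := 2 * b - 2 * t with hβ
  have hβ0 : 0 < β := by linarith
  set c₁ : ℝ≥0∞ := 2 * (A * B * ENNReal.ofReal (2 ^ (2 * d - 2 * b))) with hc₁
  have hc₁t : c₁ ≠ ⊤ := by
    simp only [hc₁]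
    exact ENNReal.mul_ne_top (by norm_num)
      (ENNReal.mul_ne_top (ENNReal.mul_ne_top hAt hBt) ENNReal.ofReal_ne_top)
  refine ⟨ENNReal.ofReal (2 * t) * (c₁ * ENNReal.ofReal (2 ^ β / β) +
    2 * ENNReal.ofReal (1 / (2 * t))), ?_, fun g => ?_⟩
  · exact ENNReal.mul_ne_top ENNReal.ofReal_ne_top (ENNReal.add_ne_top.2
      ⟨ENNReal.mul_ne_top hc₁t ENNReal.ofReal_ne_top,
        ENNReal.mul_ne_top (by norm_num) ENNReal.ofReal_ne_top⟩)
  have hg : Measurable fun x => ‖g x‖ₑ := g.continuous.measurable.enorm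
  have hfg := measurable_enorm_fourier g
  -- At a fixed scale, Cauchy–Schwarz on the low frequencies contributes `(2 / r) ^ (d - 2b)` and
  -- the volume of the ball `(2r) ^ d`; together with `r ^ (-2t - 1)` this leaves `r ^ (β - 1)`.
  -- Integrating over `r` afterwards turns the left side into the Hardy weight and both right-hand
  -- terms into `energy t g`.
  have key : ∀ r ∈ Set.Ioi (0 : ℝ), ENNReal.ofReal (r ^ (-(2 * t) - 1)) *
      ∫⁻ x in Metric.ball (0 : V) (2 * r), ‖g x‖ₑ ^ 2 ≤
      c₁ * (ENNReal.ofReal (r ^ (β - 1)) * ∫⁻ ξ in Metric.ball (0 : V) (2 / r),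
        ENNReal.ofReal (‖ξ‖ ^ (2 * b)) * ‖𝓕 g ξ‖ₑ ^ 2) +
      2 * (ENNReal.ofReal (r ^ (-(2 * t) - 1)) *
        ∫⁻ ξ in (Metric.ball (0 : V) (1 / r))ᶜ, ‖𝓕 g ξ‖ₑ ^ 2) := by
    intro r hr
    have hr : 0 < r := hr
    have h2r : 0 < 2 / r := by positivity
    refine (mul_le_mul_right (lintegral_ball_enorm_sq_le g hr) _).trans ?_
    rw [mul_add]
    refine add_le_add ?_ (le_of_eq (by ring))
    have h1 := lintegral_ball_sq_le (V := V) (α := b) h2r hfg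
    set J := ∫⁻ ξ in Metric.ball (0 : V) (2 / r), ENNReal.ofReal (‖ξ‖ ^ (2 * b)) * ‖𝓕 g ξ‖ₑ ^ 2
    rw [Measure.addHaar_ball _ _ (by positivity)]
    calc ENNReal.ofReal (r ^ (-(2 * t) - 1)) *
          (2 * ((∫⁻ ξ in Metric.ball (0 : V) (2 / r), ‖𝓕 g ξ‖ₑ) ^ 2 *
          (ENNReal.ofReal ((2 * r) ^ Module.finrank ℝ V) * B)))
        ≤ ENNReal.ofReal (r ^ (-(2 * t) - 1)) *
          (2 * ((A * (ENNReal.ofReal ((2 / r) ^ (d - 2 * b)) * J)) *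
          (ENNReal.ofReal ((2 * r) ^ Module.finrank ℝ V) * B))) := by gcongr
      _ = 2 * (A * B * (ENNReal.ofReal (r ^ (-(2 * t) - 1)) *
            ENNReal.ofReal ((2 / r) ^ (d - 2 * b)) *
            ENNReal.ofReal ((2 * r) ^ Module.finrank ℝ V))) * J := by ring
      _ = 2 * (A * B * (ENNReal.ofReal (2 ^ (2 * d - 2 * b)) *
            ENNReal.ofReal (r ^ (β - 1)))) * J := by
          rw [← ENNReal.ofReal_mul (by positivity), ← ENNReal.ofReal_mul (by positivity),
            ← ENNReal.ofReal_mul (by positivity)]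
          congr 4
          rw [← Real.rpow_natCast, ← hd, Real.mul_rpow (by norm_num) hr.le,
            Real.div_rpow (by norm_num) hr.le, div_eq_mul_inv, ← Real.rpow_neg hr.le]
          have e1 : (2 : ℝ) ^ (2 * d - 2 * b) = 2 ^ (d - 2 * b) * 2 ^ d := by
            rw [← Real.rpow_add (by norm_num)]; ring_nf
          have e2 : r ^ (β - 1) = r ^ (-(2 * t) - 1) * r ^ (-(d - 2 * b)) * r ^ d := by
            rw [← Real.rpow_add hr, ← Real.rpow_add hr]; congr 1; rw [hβ]; ring
          rw [e1, e2]
          ring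
      _ = _ := by rw [hc₁]; ring
  clear_value c₁
  have hI := setLIntegral_mono_ae' (μ := volume) measurableSet_Ioi (ae_of_all _ key)
  rw [lintegral_rpow_mul_ball_eq ht (by fun_prop)] at hI
  have hR : ∫⁻ r in Set.Ioi (0 : ℝ),
      (c₁ * (ENNReal.ofReal (r ^ (β - 1)) * ∫⁻ ξ in Metric.ball (0 : V) (2 / r),
        ENNReal.ofReal (‖ξ‖ ^ (2 * b)) * ‖𝓕 g ξ‖ₑ ^ 2) +
      2 * (ENNReal.ofReal (r ^ (-(2 * t) - 1)) *
        ∫⁻ ξ in (Metric.ball (0 : V) (1 / r))ᶜ, ‖𝓕 g ξ‖ₑ ^ 2)) ≤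
      (c₁ * ENNReal.ofReal (2 ^ β / β) + 2 * ENNReal.ofReal (1 / (2 * t))) * energy t g := by
    have hmeas : Measurable fun r : ℝ => 2 * (ENNReal.ofReal (r ^ (-(2 * t) - 1)) *
        ∫⁻ ξ in (Metric.ball (0 : V) (1 / r))ᶜ, ‖𝓕 g ξ‖ₑ ^ 2) := by
      refine Measurable.const_mul (Measurable.mul (by fun_prop) ?_) _
      have hS : MeasurableSet {p : ℝ × V | 1 / p.1 ≤ ‖p.2‖} :=
        measurableSet_le (by fun_prop) (by fun_prop)
      have : Measurable fun r : ℝ => ∫⁻ ξ, {p : ℝ × V | 1 / p.1 ≤ ‖p.2‖}.indicator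
          (fun p => ‖𝓕 g p.2‖ₑ ^ 2) (r, ξ) := by
        refine Measurable.lintegral_prod_right' ?_
        exact Measurable.indicator ((hfg.pow_const 2).comp measurable_snd) hS
      convert this using 2 with r
      rw [← lintegral_indicator measurableSet_ball.compl]
      refine lintegral_congr fun ξ => ?_
      simp only [Set.indicator, Set.mem_compl_iff, mem_ball_zero_iff, not_lt, Set.mem_ofPred_eq]
    rw [lintegral_add_right _ hmeas, lintegral_const_mul' _ _ hc₁t,
      lintegral_const_mul' _ _ (by norm_num), lintegral_rpow_mul_compl_ball_eq ht (by fun_prop),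
      lintegral_rpow_mul_ball_inv_eq hβ0 (by fun_prop), add_mul, mul_assoc c₁, mul_assoc 2]
    refine add_le_add (mul_le_mul_right ?_ c₁) (mul_le_mul_right ?_ 2)
    · unfold energy
      rw [← lintegral_const_mul _ (by fun_prop)]
      refine lintegral_mono_ae ?_
      filter_upwards [ae_ne_zero_of_nontrivial (V := V)] with ξ hξ
      have hx := norm_pos_iff.2 hξ
      refine le_of_eq ?_
      have : ENNReal.ofReal (‖ξ‖ ^ (2 * b)) * ENNReal.ofReal ((2 / ‖ξ‖) ^ β / β) =
          ENNReal.ofReal (2 ^ β / β) * ENNReal.ofReal (‖ξ‖ ^ (2 * t)) := by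
        rw [← ENNReal.ofReal_mul (by positivity), ← ENNReal.ofReal_mul (by positivity)]
        congr 1
        rw [Real.div_rpow (by norm_num) hx.le]
        have : ‖ξ‖ ^ (2 * b) = ‖ξ‖ ^ (2 * t) * ‖ξ‖ ^ β := by
          rw [← Real.rpow_add hx]; congr 1; rw [hβ]; ring
        rw [this]
        field_simp
      calc _ = ‖𝓕 g ξ‖ₑ ^ 2 *
            (ENNReal.ofReal (‖ξ‖ ^ (2 * b)) * ENNReal.ofReal ((2 / ‖ξ‖) ^ β / β)) := by ring
        _ = _ := by rw [this]; ring
    · unfold energy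
      rw [← lintegral_const_mul _ (by fun_prop)]
      refine lintegral_mono fun ξ => le_of_eq ?_
      rw [div_eq_mul_one_div, ENNReal.ofReal_mul (by positivity)]
      ring
  refine le_trans ?_ ((mul_le_mul_right (hI.trans hR) (ENNReal.ofReal (2 * t))).trans
    (le_of_eq (by ring)))
  rw [← lintegral_const_mul _ (by fun_prop)]
  refine lintegral_mono fun x => ?_
  rw [mul_left_comm, mul_comm (‖g x‖ₑ ^ 2), ← ENNReal.ofReal_mul (by positivity)]
  gcongr
  rw [mul_div_cancel₀ _ (by positivity), Real.div_rpow (norm_nonneg _) (by norm_num)]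
  refine le_div_self (by positivity) (by positivity) ?_
  exact Real.rpow_le_one_of_one_le_of_nonpos (by norm_num) (by linarith)

end Hardy

/-! ### Sobolev norms versus iterated derivatives -/

section Derivatives

theorem fourier_eq_mul_fourier {n : ℕ} (u : EuclideanSpace ℝ (Fin n) → ℂ)
    (ξ : EuclideanSpace ℝ (Fin n)) :
    fourier u ξ = (((2 * Real.pi) ^ (-(n : ℝ) / 2) : ℝ) : ℂ) * 𝓕 u ((2 * Real.pi)⁻¹ • ξ) := by
  rw [fourier, Real.fourier_eq']
  congr 2
  ext x
  rw [smul_eq_mul, mul_comm]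
  congr 2
  have : -2 * Real.pi * inner ℝ x ((2 * Real.pi)⁻¹ • ξ) = -inner ℝ ξ x := by
    rw [inner_smul_right, real_inner_comm]
    field_simp
  rw [this]
  push_cast
  ring

theorem eLpNorm_two_sq {α F : Type*} [MeasurableSpace α] [NormedAddCommGroup F] (μ : Measure α)
    (f : α → F) : eLpNorm f 2 μ ^ 2 = ∫⁻ x, ‖f x‖ₑ ^ 2 ∂μ := by
  have h := eLpNorm_nnreal_pow_eq_lintegral (f := f) (μ := μ) (p := 2) (by norm_num)
  norm_num at h
  exact_mod_cast h

/-- The substitution `ξ = 2π η` passes from the unitary transform in angular frequency to the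
transform with kernel `exp(-2πi x·η)`. The Jacobian `(2π)^n` cancels the squared prefactor, and only
the dilation of `|ξ| ^ (2t)` survives. -/
theorem hNorm_sq {n : ℕ} (t : ℝ) (g : 𝓢(EuclideanSpace ℝ (Fin n), ℂ)) :
    hNorm t g ^ 2 = ENNReal.ofReal ((2 * Real.pi) ^ (2 * t)) * energy t g := by
  have hpi : 0 < 2 * Real.pi := Real.two_pi_pos
  rw [hNorm, eLpNorm_two_sq]
  have h := lintegral_comp_smul_of_pos (V := EuclideanSpace ℝ (Fin n))
    (fun η => ENNReal.ofReal ((2 * Real.pi * ‖η‖) ^ (2 * t)) *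
      (ENNReal.ofReal ((2 * Real.pi) ^ (-(n : ℝ))) * ‖𝓕 g η‖ₑ ^ 2)) (inv_pos.2 hpi)
  have hm := measurable_enorm_fourier g
  calc _ = ∫⁻ ξ : EuclideanSpace ℝ (Fin n),
        ENNReal.ofReal ((2 * Real.pi * ‖(2 * Real.pi)⁻¹ • ξ‖) ^ (2 * t)) *
        (ENNReal.ofReal ((2 * Real.pi) ^ (-(n : ℝ))) * ‖𝓕 g ((2 * Real.pi)⁻¹ • ξ)‖ₑ ^ 2) := by
        refine lintegral_congr fun ξ => ?_
        rw [fourier_eq_mul_fourier, enorm_mul, enorm_mul, mul_pow, mul_pow]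
        congr 1
        · rw [← ofReal_norm, Complex.norm_of_nonneg (by positivity), norm_smul,
            Real.norm_of_nonneg (by positivity), mul_inv_cancel_left₀ hpi.ne',
            ← ENNReal.ofReal_pow (by positivity), ← Real.rpow_natCast, ← Real.rpow_mul (by positivity)]
          congr 2
          push_cast
          ring
        · congr 1
          rw [← ofReal_norm, Complex.norm_of_nonneg (by positivity),
            ← ENNReal.ofReal_pow (by positivity), ← Real.rpow_natCast, ← Real.rpow_mul (by positivity)]
          congr 2
          push_cast
          ring
    _ = _ := h
    _ = _ := by
        rw [energy, ← lintegral_const_mul _ (by fun_prop), ← lintegral_const_mul _ (by fun_prop)]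
        refine lintegral_congr fun ξ => ?_
        rw [Real.mul_rpow hpi.le (norm_nonneg _), ENNReal.ofReal_mul (by positivity),
          finrank_euclideanSpace_fin, Real.inv_rpow hpi.le, ← Real.rpow_neg hpi.le, neg_neg]
        have : ENNReal.ofReal ((2 * Real.pi) ^ (n : ℝ)) *
            ENNReal.ofReal ((2 * Real.pi) ^ (-(n : ℝ))) = 1 := by
          rw [← ENNReal.ofReal_mul (by positivity), ← Real.rpow_add hpi]
          simp
        calc _ = (ENNReal.ofReal ((2 * Real.pi) ^ (n : ℝ)) *
            ENNReal.ofReal ((2 * Real.pi) ^ (-(n : ℝ)))) *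
            (ENNReal.ofReal ((2 * Real.pi) ^ (2 * t)) * (ENNReal.ofReal (‖ξ‖ ^ (2 * t)) *
              ‖𝓕 g ξ‖ₑ ^ 2)) := by ring
          _ = _ := by rw [this, one_mul]

theorem norm_fourier_iteratedLineDerivOp {V : Type*} [NormedAddCommGroup V]
    [InnerProductSpace ℝ V] [FiniteDimensional ℝ V] [MeasurableSpace V] [BorelSpace V] {a : ℕ}
    (m : Fin a → V) (g : 𝓢(V, ℂ)) (ξ : V) :
    ‖𝓕 (∂^{m} g) ξ‖ = (∏ i, (2 * Real.pi * |inner ℝ ξ (m i)|)) * ‖𝓕 g ξ‖ := by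
  induction a with
  | zero => simp
  | succ a ih =>
    rw [LineDeriv.iteratedLineDerivOp_succ_left, SchwartzMap.fourier_lineDerivOp_eq,
      smul_apply, SchwartzMap.smulLeftCLM_apply_apply (by fun_prop), norm_smul,
      norm_smul, ih, Fin.prod_univ_succ]
    simp only [Fin.tail, norm_mul, Complex.norm_I, Real.norm_eq_abs, Complex.norm_real,
      Complex.norm_ofNat, abs_of_pos Real.pi_pos]
    ring

theorem energy_iteratedLineDerivOp_le {V : Type*} [NormedAddCommGroup V]
    [InnerProductSpace ℝ V] [FiniteDimensional ℝ V] [MeasurableSpace V] [BorelSpace V] {a : ℕ}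
    (m : Fin a → V) (hm : ∀ i, ‖m i‖ ≤ 1) {t : ℝ} (ht : 0 ≤ t) (g : 𝓢(V, ℂ)) :
    energy t (∂^{m} g) ≤ ENNReal.ofReal ((2 * Real.pi) ^ (2 * a)) * energy (t + a) g := by
  have hmeas := measurable_enorm_fourier g
  unfold energy
  rw [← lintegral_const_mul _ (by fun_prop)]
  refine lintegral_mono fun ξ => ?_
  have h1 : ‖𝓕 (∂^{m} g) ξ‖ ≤ (2 * Real.pi) ^ a * ‖ξ‖ ^ a * ‖𝓕 g ξ‖ := by
    rw [norm_fourier_iteratedLineDerivOp]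
    gcongr
    rw [← mul_pow]
    calc ∏ i, (2 * Real.pi * |inner ℝ ξ (m i)|) ≤ ∏ _i : Fin a, (2 * Real.pi * ‖ξ‖) := by
          refine Finset.prod_le_prod (fun i _ => by positivity) fun i _ => ?_
          gcongr
          calc |inner ℝ ξ (m i)| ≤ ‖ξ‖ * ‖m i‖ := abs_real_inner_le_norm _ _
            _ ≤ ‖ξ‖ * 1 := by gcongr; exact hm i
            _ = ‖ξ‖ := mul_one _
      _ = _ := by simp
  rw [← ofReal_norm, ← ofReal_norm, ← ENNReal.ofReal_pow (by positivity),
    ← ENNReal.ofReal_pow (by positivity), ← ENNReal.ofReal_mul (by positivity),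
    ← ENNReal.ofReal_mul (by positivity), ← ENNReal.ofReal_mul (by positivity)]
  refine ENNReal.ofReal_le_ofReal ?_
  have h2 : ‖ξ‖ ^ (2 * (t + a)) = ‖ξ‖ ^ (2 * t) * (‖ξ‖ ^ a) ^ 2 := by
    rw [mul_add, Real.rpow_add_of_nonneg (norm_nonneg _) (by positivity) (by positivity),
      ← pow_mul, ← Real.rpow_natCast]
    push_cast
    ring_nf
  calc ‖ξ‖ ^ (2 * t) * ‖𝓕 (∂^{m} g) ξ‖ ^ 2
      ≤ ‖ξ‖ ^ (2 * t) * ((2 * Real.pi) ^ a * ‖ξ‖ ^ a * ‖𝓕 g ξ‖) ^ 2 := by gcongr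
    _ = _ := by rw [h2]; ring

/-- The `a`-tuple of standard basis vectors with indices `I`. -/
noncomputable def basisTuple {n a : ℕ} (I : Fin a → Fin n) : Fin a → EuclideanSpace ℝ (Fin n) :=
  fun j => EuclideanSpace.single (I j) 1

theorem norm_basisTuple {n a : ℕ} (I : Fin a → Fin n) (j : Fin a) : ‖basisTuple I j‖ = 1 := by
  simp [basisTuple]

/-- Expanding each argument in the standard basis and using that coordinates are at most the norm.
This reduces full derivative tensors to scalar partial derivatives, to which the Fourier estimates
apply. -/
theorem norm_le_sum_basisTuple {n a : ℕ} {F : Type*} [NormedAddCommGroup F] [NormedSpace ℝ F]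
    (T : EuclideanSpace ℝ (Fin n) [×a]→L[ℝ] F) :
    ‖T‖ ≤ ∑ I : Fin a → Fin n, ‖T (basisTuple I)‖ := by
  refine ContinuousMultilinearMap.opNorm_le_bound (by positivity) fun v => ?_
  have hv : v = fun j => ∑ i, v j i • EuclideanSpace.single i (1 : ℝ) := by
    ext j k
    simp [Finset.sum_apply, Pi.single_apply]
  conv_lhs => rw [hv]
  rw [ContinuousMultilinearMap.map_sum, Finset.sum_mul]
  refine (norm_sum_le _ _).trans (Finset.sum_le_sum fun I _ => ?_)
  rw [ContinuousMultilinearMap.map_smul_univ, norm_smul, mul_comm]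
  refine mul_le_mul_of_nonneg_left ?_ (norm_nonneg _)
  rw [norm_prod]
  exact Finset.prod_le_prod (fun _ _ => norm_nonneg _) fun j _ => PiLp.norm_apply_le (v j) (I j)

theorem enorm_sq_iteratedFDeriv_le {n a : ℕ} (g : 𝓢(EuclideanSpace ℝ (Fin n), ℂ))
    (x : EuclideanSpace ℝ (Fin n)) :
    ‖iteratedFDeriv ℝ a g x‖ₑ ^ 2 ≤
      (n ^ a : ℕ) * ∑ I : Fin a → Fin n, ‖(∂^{basisTuple I} g) x‖ₑ ^ 2 := by
  have h : ‖iteratedFDeriv ℝ a g x‖ ^ 2 ≤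
      (n ^ a : ℕ) * ∑ I : Fin a → Fin n, ‖(∂^{basisTuple I} g) x‖ ^ 2 := by
    simp_rw [SchwartzMap.iteratedLineDerivOp_eq_iteratedFDeriv]
    refine (pow_le_pow_left₀ (norm_nonneg _) (norm_le_sum_basisTuple _) 2).trans ?_
    refine sq_sum_le_card_mul_sum_sq.trans (le_of_eq ?_)
    simp
  simp_rw [← ofReal_norm, ← ENNReal.ofReal_pow (norm_nonneg _)]
  rw [← ENNReal.ofReal_sum_of_nonneg fun _ _ => by positivity, ← ENNReal.ofReal_natCast,
    ← ENNReal.ofReal_mul (by positivity)]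
  exact ENNReal.ofReal_le_ofReal h

theorem exists_lintegral_iteratedFDeriv_le (n a : ℕ) :
    ∃ C : ℝ≥0∞, C ≠ ⊤ ∧ ∀ g : 𝓢(EuclideanSpace ℝ (Fin n), ℂ),
      ∫⁻ x, ‖iteratedFDeriv ℝ a g x‖ₑ ^ 2 ≤ C * energy a g := by
  refine ⟨(n ^ a : ℕ) * ∑ _I : Fin a → Fin n, ENNReal.ofReal ((2 * Real.pi) ^ (2 * a)),
    ENNReal.mul_ne_top (ENNReal.natCast_ne_top _)
      (ENNReal.sum_ne_top.2 fun _ _ => ENNReal.ofReal_ne_top), fun g => ?_⟩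
  refine (lintegral_mono fun x => enorm_sq_iteratedFDeriv_le g x).trans ?_
  have hm : ∀ I : Fin a → Fin n, Measurable fun x => ‖(∂^{basisTuple I} g) x‖ₑ ^ 2 := fun I =>
    ((∂^{basisTuple I} g).continuous.measurable.enorm).pow_const 2
  rw [lintegral_const_mul _ (Finset.measurable_fun_sum _ fun I _ => hm I),
    lintegral_finsetSum _ fun I _ => hm I, mul_assoc, Finset.sum_mul]
  gcongr with I
  rw [← energy_zero]
  simpa using energy_iteratedLineDerivOp_le (basisTuple I) (fun j => (norm_basisTuple I j).le)
    le_rfl g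

theorem exists_hardy_iteratedFDeriv {n : ℕ} [NeZero n] (a : ℕ) {t : ℝ} (ht : 0 < t)
    (ht' : 2 * t < n) :
    ∃ C : ℝ≥0∞, C ≠ ⊤ ∧ ∀ g : 𝓢(EuclideanSpace ℝ (Fin n), ℂ),
      ∫⁻ x, ENNReal.ofReal (‖x‖ ^ (-(2 * t))) * ‖iteratedFDeriv ℝ a g x‖ₑ ^ 2 ≤
        C * energy (t + a) g := by
  obtain ⟨C, hC, h⟩ := exists_hardy (V := EuclideanSpace ℝ (Fin n)) ht (by simpa using ht')
  refine ⟨(n ^ a : ℕ) * ∑ _I : Fin a → Fin n, C * ENNReal.ofReal ((2 * Real.pi) ^ (2 * a)),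
    ENNReal.mul_ne_top (ENNReal.natCast_ne_top _)
      (ENNReal.sum_ne_top.2 fun _ _ => ENNReal.mul_ne_top hC ENNReal.ofReal_ne_top), fun g => ?_⟩
  refine (lintegral_mono fun x => mul_le_mul_right (enorm_sq_iteratedFDeriv_le g x) _).trans ?_
  have hm : ∀ I : Fin a → Fin n, Measurable fun x => ENNReal.ofReal (‖x‖ ^ (-(2 * t))) *
      ‖(∂^{basisTuple I} g) x‖ₑ ^ 2 := fun I =>
    Measurable.mul (by fun_prop) (((∂^{basisTuple I} g).continuous.measurable.enorm).pow_const 2)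
  simp_rw [mul_left_comm, Finset.mul_sum]
  rw [lintegral_finsetSum _ fun I _ => (hm I).const_mul _, Finset.sum_mul]
  gcongr with I
  rw [lintegral_const_mul _ (hm I), mul_assoc]
  gcongr
  refine (h _).trans ?_
  rw [mul_assoc]
  gcongr
  exact energy_iteratedLineDerivOp_le (basisTuple I) (fun j => (norm_basisTuple I j).le) ht.le g

theorem exists_enorm_sq_iteratedFDeriv_le_energy {n : ℕ} [NeZero n] (a : ℕ) {t₀ t₁ : ℝ}
    (h0 : 0 ≤ t₀) (ht₀ : 2 * t₀ < n) (ht₁ : n < 2 * t₁) :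
    ∃ C : ℝ≥0∞, C ≠ ⊤ ∧ ∀ (g : 𝓢(EuclideanSpace ℝ (Fin n), ℂ)) (x : EuclideanSpace ℝ (Fin n)),
      ‖iteratedFDeriv ℝ a g x‖ₑ ^ 2 ≤ C * (energy (t₀ + a) g + energy (t₁ + a) g) := by
  obtain ⟨C, hC, h⟩ := exists_enorm_sq_le_energy (V := EuclideanSpace ℝ (Fin n))
    (a := t₀) (b := t₁) (by simpa using ht₀) (by simpa using ht₁)
  refine ⟨(n ^ a : ℕ) * ∑ _I : Fin a → Fin n, C * ENNReal.ofReal ((2 * Real.pi) ^ (2 * a)),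
    ENNReal.mul_ne_top (ENNReal.natCast_ne_top _)
      (ENNReal.sum_ne_top.2 fun _ _ => ENNReal.mul_ne_top hC ENNReal.ofReal_ne_top),
    fun g x => ?_⟩
  refine (enorm_sq_iteratedFDeriv_le g x).trans ?_
  rw [mul_assoc, Finset.sum_mul]
  gcongr with I
  refine (h _ x).trans ?_
  have hn : (0 : ℝ) ≤ n := Nat.cast_nonneg n
  rw [mul_assoc]
  refine mul_le_mul_right ?_ C
  rw [mul_add]
  refine add_le_add ?_ ?_ <;> exact energy_iteratedLineDerivOp_le (basisTuple I)
    (fun j => (norm_basisTuple I j).le) (by linarith) g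

/-- Pure derivatives suffice: at each frequency the largest coordinate satisfies `|ξ|² ≤ n |ξ_i|²`,
so `∂_i^a` alone controls the multiplier `|ξ| ^ a` there. Summing over `i` removes the dependence of
`i` on `ξ`. -/
theorem exists_energy_le_lintegral_iteratedFDeriv (n : ℕ) [NeZero n] (a : ℕ) :
    ∃ C : ℝ≥0∞, C ≠ ⊤ ∧ ∀ g : 𝓢(EuclideanSpace ℝ (Fin n), ℂ),
      energy a g ≤ C * ∫⁻ x, ‖iteratedFDeriv ℝ a g x‖ₑ ^ 2 := by
  refine ⟨∑ _i : Fin n, ENNReal.ofReal (n ^ a), ENNReal.sum_ne_top.2 fun _ _ =>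
    ENNReal.ofReal_ne_top, fun g => ?_⟩
  let e : Fin n → Fin a → EuclideanSpace ℝ (Fin n) := fun i => basisTuple fun _ => i
  have key : ∀ ξ : EuclideanSpace ℝ (Fin n), ENNReal.ofReal (‖ξ‖ ^ (2 * (a : ℝ))) * ‖𝓕 g ξ‖ₑ ^ 2 ≤
      ∑ i, ENNReal.ofReal (n ^ a) * ‖𝓕 (∂^{e i} g) ξ‖ₑ ^ 2 := by
    intro ξ
    obtain ⟨i, -, hi⟩ := Finset.exists_max_image Finset.univ (fun i => ‖ξ i‖ ^ 2)
      Finset.univ_nonempty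
    refine le_trans ?_ (Finset.single_le_sum (f := fun i =>
      ENNReal.ofReal (n ^ a) * ‖𝓕 (∂^{e i} g) ξ‖ₑ ^ 2) (fun _ _ => zero_le) (Finset.mem_univ i))
    have h1 : ‖ξ‖ ^ 2 ≤ n * ‖ξ i‖ ^ 2 := by
      rw [EuclideanSpace.norm_sq_eq]
      refine (Finset.sum_le_sum hi).trans (le_of_eq ?_)
      simp
    have h2 : ‖ξ i‖ ^ a * ‖𝓕 g ξ‖ ≤ ‖𝓕 (∂^{e i} g) ξ‖ := by
      rw [norm_fourier_iteratedLineDerivOp]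
      gcongr
      have : ∀ j, inner ℝ ξ (e i j) = ξ i := fun j => by
        simp [e, basisTuple, EuclideanSpace.inner_single_right]
      simp only [this, Finset.prod_const, Finset.card_univ, Fintype.card_fin]
      gcongr
      rw [Real.norm_eq_abs]
      refine le_mul_of_one_le_left (abs_nonneg _) ?_
      linarith [Real.pi_gt_three]
    simp only [← ofReal_norm]
    rw [← ENNReal.ofReal_pow (by positivity),
      ← ENNReal.ofReal_pow (by positivity), ← ENNReal.ofReal_mul (by positivity),
      ← ENNReal.ofReal_mul (by positivity)]
    refine ENNReal.ofReal_le_ofReal ?_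
    have h3 : ‖ξ‖ ^ (2 * (a : ℝ)) = (‖ξ‖ ^ 2) ^ a := by
      rw [← pow_mul, ← Real.rpow_natCast]; push_cast; rfl
    calc ‖ξ‖ ^ (2 * (a : ℝ)) * ‖𝓕 g ξ‖ ^ 2 ≤ (n * ‖ξ i‖ ^ 2) ^ a * ‖𝓕 g ξ‖ ^ 2 := by
          rw [h3]; gcongr
      _ = n ^ a * (‖ξ i‖ ^ a * ‖𝓕 g ξ‖) ^ 2 := by ring
      _ ≤ _ := by gcongr
  have hm : ∀ i, Measurable fun ξ => ‖𝓕 (∂^{e i} g) ξ‖ₑ := fun i => measurable_enorm_fourier _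
  refine (lintegral_mono key).trans ?_
  rw [lintegral_finsetSum _ fun i _ => ((hm i).pow_const 2).const_mul _, Finset.sum_mul]
  gcongr with i
  rw [lintegral_const_mul _ ((hm i).pow_const 2), lintegral_enorm_sq_fourier]
  gcongr with x
  rw [SchwartzMap.iteratedLineDerivOp_eq_iteratedFDeriv, ← ofReal_norm, ← ofReal_norm]
  refine ENNReal.ofReal_le_ofReal ?_
  refine (ContinuousMultilinearMap.le_opNorm _ _).trans (le_of_eq ?_)
  simp [e, norm_basisTuple]

end Derivatives

/-! ### Radial functions: polar coordinates and pointwise control by annuli -/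

section Radial

theorem lintegral_fun_norm {V : Type*} [NormedAddCommGroup V] [NormedSpace ℝ V]
    [FiniteDimensional ℝ V] [Nontrivial V] [MeasurableSpace V] [BorelSpace V] (μ : Measure V)
    [μ.IsAddHaarMeasure] {f : ℝ → ℝ≥0∞} (hf : Measurable f) :
    ∫⁻ x, f ‖x‖ ∂μ = μ.toSphere Set.univ *
      ∫⁻ y in Set.Ioi (0 : ℝ), ENNReal.ofReal (y ^ (Module.finrank ℝ V - 1)) * f y := by
  calc ∫⁻ x, f ‖x‖ ∂μ = ∫⁻ x : ({(0)}ᶜ : Set V), f ‖x.1‖ ∂(μ.comap (↑)) := by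
        rw [lintegral_subtype_comap (measurableSet_singleton _).compl fun x => f ‖x‖,
          restrict_compl_singleton]
    _ = ∫⁻ x, f x.2 ∂μ.toSphere.prod (.volumeIoiPow (Module.finrank ℝ V - 1)) := by
        simpa using μ.measurePreserving_homeomorphUnitSphereProd.lintegral_comp_emb
          (Homeomorph.measurableEmbedding _) (fun p => f p.2)
    _ = μ.toSphere Set.univ *
        ∫⁻ y : Set.Ioi (0 : ℝ), f y ∂.volumeIoiPow (Module.finrank ℝ V - 1) := by
        rw [lintegral_prod _ (by fun_prop)]
        simp only [lintegral_const]
        rw [mul_comm]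
    _ = _ := by
        rw [Measure.volumeIoiPow, lintegral_withDensity_eq_lintegral_mul _ (by fun_prop)
          (by fun_prop)]
        simp only [Pi.mul_apply]
        rw [lintegral_subtype_comap measurableSet_Ioi
          fun y : ℝ => ENNReal.ofReal (y ^ (Module.finrank ℝ V - 1)) * f y]

/-- The tensor `D^a u` is not radial, but its norm is: a reflection sends `x` to `y`, leaves `u`
unchanged and is an isometry. -/
theorem norm_iteratedFDeriv_eq_of_radial {V F : Type*} [NormedAddCommGroup V]
    [InnerProductSpace ℝ V] [NormedAddCommGroup F] [NormedSpace ℝ F] {u : V → F}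
    (hu : ∀ x y, ‖x‖ = ‖y‖ → u x = u y) (a : ℕ) {x y : V} (hxy : ‖x‖ = ‖y‖) :
    ‖iteratedFDeriv ℝ a u x‖ = ‖iteratedFDeriv ℝ a u y‖ := by
  set g := (ℝ ∙ (x - y))ᗮ.reflection
  have hg : g x = y := Submodule.reflection_sub hxy
  have hug : u ∘ g = u := funext fun z => hu _ _ (g.norm_map z)
  rw [← hg, ← g.norm_iteratedFDeriv_comp_right, hug]

theorem enorm_le_add_lintegral {F : Type*} [NormedAddCommGroup F] [NormedSpace ℝ F]
    [CompleteSpace F] {G G' : ℝ → F}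
    (hG : ∀ t, HasDerivAt G (G' t) t) (hG' : Continuous G') {a b ρ : ℝ}
    (hρ : ρ ∈ Set.Ioo a b) : ‖G a‖ₑ ≤ ‖G ρ‖ₑ + ∫⁻ t in Set.Ioo a b, ‖G' t‖ₑ := by
  have h := intervalIntegral.integral_eq_sub_of_hasDerivAt (a := a) (b := ρ) (fun t _ => hG t)
    (hG'.intervalIntegrable _ _)
  have h2 : G a = G ρ - ∫ t in a..ρ, G' t := by rw [h]; abel
  rw [h2]
  refine enorm_sub_le.trans ?_
  gcongr
  rw [intervalIntegral.integral_of_le hρ.1.le]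
  refine (enorm_integral_le_lintegral_enorm _).trans ?_
  exact lintegral_mono_set fun t ht => ⟨ht.1, ht.2.trans_lt hρ.2⟩

/-- The fundamental theorem of calculus compares `G r` with `G t` for every `t` in `(r, 2r)`;
averaging over `t` and Cauchy–Schwarz for the integral of `G'` give the two terms. -/
theorem mul_enorm_sq_le_lintegral {F : Type*} [NormedAddCommGroup F] [NormedSpace ℝ F]
    [CompleteSpace F] {G G' : ℝ → F} (hG : ∀ t, HasDerivAt G (G' t) t) (hG' : Continuous G')
    (r : ℝ) :
    ENNReal.ofReal r * ‖G r‖ₑ ^ 2 ≤ 2 * (∫⁻ t in Set.Ioo r (2 * r), ‖G t‖ₑ ^ 2) +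
      2 * ENNReal.ofReal r ^ 2 * ∫⁻ t in Set.Ioo r (2 * r), ‖G' t‖ₑ ^ 2 := by
  have hGc : Continuous G := continuous_iff_continuousAt.2 fun t => (hG t).continuousAt
  have hvol : volume (Set.Ioo r (2 * r)) = ENNReal.ofReal r := by
    rw [Real.volume_Ioo]; congr 1; ring
  set J := ∫⁻ t in Set.Ioo r (2 * r), ‖G' t‖ₑ with hJ
  have hJ2 : J ^ 2 ≤ ENNReal.ofReal r * ∫⁻ t in Set.Ioo r (2 * r), ‖G' t‖ₑ ^ 2 := by
    have := lintegral_mul_sq_le (volume.restrict (Set.Ioo r (2 * r))) (f := fun _ => 1)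
      (g := fun t => ‖G' t‖ₑ) (by fun_prop) (by fun_prop)
    simpa [hvol] using this
  calc ENNReal.ofReal r * ‖G r‖ₑ ^ 2 = ∫⁻ _ in Set.Ioo r (2 * r), ‖G r‖ₑ ^ 2 := by
        rw [setLIntegral_const, hvol, mul_comm]
    _ ≤ ∫⁻ t in Set.Ioo r (2 * r), (2 * ‖G t‖ₑ ^ 2 + 2 * J ^ 2) := by
        refine setLIntegral_mono' measurableSet_Ioo fun t ht => ?_
        exact (pow_le_pow_left' (enorm_le_add_lintegral hG hG' ht) 2).trans (ennreal_add_sq_le _ _)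
    _ = 2 * (∫⁻ t in Set.Ioo r (2 * r), ‖G t‖ₑ ^ 2) + 2 * J ^ 2 * ENNReal.ofReal r := by
        rw [lintegral_add_right _ measurable_const, setLIntegral_const, hvol,
          lintegral_const_mul _ (hGc.enorm.measurable.pow_const 2)]
    _ ≤ 2 * (∫⁻ t in Set.Ioo r (2 * r), ‖G t‖ₑ ^ 2) +
        2 * (ENNReal.ofReal r * ∫⁻ t in Set.Ioo r (2 * r), ‖G' t‖ₑ ^ 2) * ENNReal.ofReal r := by
        gcongr
    _ = _ := by ring

/-- The open annulus of radii `r` and `2r`. -/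
def annulus (V : Type*) [NormedAddCommGroup V] (r : ℝ) : Set V := {y | ‖y‖ ∈ Set.Ioo r (2 * r)}

theorem measurableSet_annulus {V : Type*} [NormedAddCommGroup V] [MeasurableSpace V]
    [OpensMeasurableSpace V] (r : ℝ) : MeasurableSet (annulus V r) :=
  measurable_norm measurableSet_Ioo

theorem rpow_mul_lintegral_Ioo_le {V : Type*} [NormedAddCommGroup V] [NormedSpace ℝ V]
    [FiniteDimensional ℝ V] [Nontrivial V] [MeasurableSpace V] [BorelSpace V] (μ : Measure V)
    [μ.IsAddHaarMeasure] {f : ℝ → ℝ≥0∞} (hf : Measurable f) {r : ℝ} (hr : 0 < r) :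
    μ.toSphere Set.univ * (ENNReal.ofReal (r ^ ((Module.finrank ℝ V : ℝ) - 1)) *
      ∫⁻ t in Set.Ioo r (2 * r), f t) ≤ ∫⁻ y in annulus V r, f ‖y‖ ∂μ := by
  rw [← lintegral_indicator (measurableSet_annulus r)]
  have h : ∀ y : V, (annulus V r).indicator (fun y => f ‖y‖) y =
      (fun t => (Set.Ioo r (2 * r)).indicator f t) ‖y‖ := fun y => rfl
  simp_rw [h]
  rw [lintegral_fun_norm μ (hf.indicator measurableSet_Ioo),
    ← lintegral_const_mul _ hf, ← lintegral_indicator measurableSet_Ioo]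
  refine mul_le_mul_right ?_ _
  refine le_trans ?_ (le_of_eq (setLIntegral_eq_of_support_subset
    (s := Set.Ioi (0 : ℝ)) ?_).symm)
  · refine lintegral_mono fun t => ?_
    by_cases ht : t ∈ Set.Ioo r (2 * r)
    · rw [Set.indicator_of_mem ht, Set.indicator_of_mem ht]
      gcongr
      have h1 : (Module.finrank ℝ V : ℝ) - 1 = (Module.finrank ℝ V - 1 : ℕ) := by
        rw [Nat.cast_sub Module.finrank_pos]; simp
      rw [h1, Real.rpow_natCast]
      exact pow_le_pow_left₀ hr.le ht.1.le _
    · simp [Set.indicator_of_notMem ht]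
  · intro t ht
    have : t ∈ Set.Ioo r (2 * r) := by
      by_contra h
      rw [Function.mem_support, Set.indicator_of_notMem h, mul_zero] at ht
      exact ht rfl
    exact hr.trans this.1

/-- Strauss's argument: the one-dimensional estimate along the ray through `x`, applied to the
tensor-valued `D^a u`, whose radial derivative is bounded by `D^(a+1) u`. Because the norms of the
derivatives are radial, integrals along the ray are integrals over the annulus up to the factor `r ^
(n - 1)`, which is the source of the decay. -/
theorem exists_enorm_sq_le_lintegral_annulus (n : ℕ) [NeZero n] :
    ∃ C : ℝ≥0∞, C ≠ ⊤ ∧ ∀ u : EuclideanSpace ℝ (Fin n) → ℂ, ContDiff ℝ ∞ u →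
      (∀ x y, ‖x‖ = ‖y‖ → u x = u y) → ∀ (a : ℕ) (x : EuclideanSpace ℝ (Fin n)), x ≠ 0 →
      ‖iteratedFDeriv ℝ a u x‖ₑ ^ 2 ≤ C *
        (ENNReal.ofReal (‖x‖ ^ (-(n : ℝ))) *
          (∫⁻ y in annulus (EuclideanSpace ℝ (Fin n)) ‖x‖, ‖iteratedFDeriv ℝ a u y‖ₑ ^ 2) +
        ENNReal.ofReal (‖x‖ ^ (2 - (n : ℝ))) *
          ∫⁻ y in annulus (EuclideanSpace ℝ (Fin n)) ‖x‖, ‖iteratedFDeriv ℝ (a + 1) u y‖ₑ ^ 2) := by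
  set E := EuclideanSpace ℝ (Fin n)
  set σ := (volume : Measure E).toSphere Set.univ
  have hσ0 : σ ≠ 0 := by
    simp only [σ, Measure.toSphere_apply_univ]
    refine mul_ne_zero ?_ (Metric.measure_ball_pos _ _ one_pos).ne'
    rw [finrank_euclideanSpace_fin]
    exact_mod_cast NeZero.ne n
  have hσt : σ ≠ ⊤ := measure_ne_top _ _
  refine ⟨2 * σ⁻¹, ENNReal.mul_ne_top (by norm_num) (ENNReal.inv_ne_top.2 hσ0),
    fun u hu hrad a x hx => ?_⟩
  have hr := norm_pos_iff.2 hx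
  set r := ‖x‖ with hrdef
  set e : E := r⁻¹ • x with he
  have hen : ‖e‖ = 1 := by
    rw [he, norm_smul, norm_inv, norm_norm, inv_mul_cancel₀ hr.ne']
  have hcont : ∀ b, Continuous (iteratedFDeriv ℝ b u) := fun b =>
    (hu.of_le (mod_cast le_top)).continuous_iteratedFDeriv'
  have hdiff : Differentiable ℝ (iteratedFDeriv ℝ a u) :=
    hu.differentiable_iteratedFDeriv (by exact_mod_cast WithTop.coe_lt_top _)
  have hG : ∀ t : ℝ, HasDerivAt (fun t : ℝ => iteratedFDeriv ℝ a u (t • e))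
      (fderiv ℝ (iteratedFDeriv ℝ a u) (t • e) e) t := by
    intro t
    have h1 : HasDerivAt (fun t : ℝ => t • e) e t := by
      simpa using (hasDerivAt_id t).smul_const e
    exact (hdiff (t • e)).hasFDerivAt.comp_hasDerivAt t h1
  have hcfd : Continuous (fderiv ℝ (iteratedFDeriv ℝ a u)) := by
    have : ContDiff ℝ 1 (iteratedFDeriv ℝ a u) :=
      hu.iteratedFDeriv_right (m := 1) (by exact_mod_cast le_top)
    exact this.continuous_fderiv one_ne_zero
  have hG' : Continuous fun t : ℝ => fderiv ℝ (iteratedFDeriv ℝ a u) (t • e) e := by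
    have : Continuous fun t : ℝ => fderiv ℝ (iteratedFDeriv ℝ a u) (t • e) :=
      hcfd.comp (by fun_prop)
    exact this.clm_apply continuous_const
  have h := mul_enorm_sq_le_lintegral hG hG' r
  have hre : r • e = x := by rw [he, smul_inv_smul₀ hr.ne']
  simp only [hre] at h
  have hpolar : ∀ b, σ * (ENNReal.ofReal (r ^ ((n : ℝ) - 1)) *
      ∫⁻ t in Set.Ioo r (2 * r), ‖iteratedFDeriv ℝ b u (t • e)‖ₑ ^ 2) ≤
      ∫⁻ y in annulus E r, ‖iteratedFDeriv ℝ b u y‖ₑ ^ 2 := by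
    intro b
    have hm : Measurable fun t : ℝ => ‖iteratedFDeriv ℝ b u (t • e)‖ₑ ^ 2 := by
      have : Continuous fun t : ℝ => iteratedFDeriv ℝ b u (t • e) := (hcont b).comp (by fun_prop)
      exact (this.enorm.measurable).pow_const 2
    have h3 := rpow_mul_lintegral_Ioo_le (V := E) volume hm hr
    rw [finrank_euclideanSpace_fin] at h3
    refine h3.trans (le_of_eq ?_)
    refine lintegral_congr fun y => ?_
    rw [← ofReal_norm, ← ofReal_norm, norm_iteratedFDeriv_eq_of_radial hrad b]
    rw [norm_smul, hen, mul_one, norm_norm]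
  have hle : ∫⁻ t in Set.Ioo r (2 * r), ‖fderiv ℝ (iteratedFDeriv ℝ a u) (t • e) e‖ₑ ^ 2 ≤
      ∫⁻ t in Set.Ioo r (2 * r), ‖iteratedFDeriv ℝ (a + 1) u (t • e)‖ₑ ^ 2 := by
    refine lintegral_mono fun t => pow_le_pow_left' ?_ 2
    rw [← ofReal_norm, ← ofReal_norm]
    refine ENNReal.ofReal_le_ofReal ?_
    refine (ContinuousLinearMap.le_opNorm _ _).trans ?_
    rw [hen, mul_one, norm_fderiv_iteratedFDeriv]
  set A := ∫⁻ t in Set.Ioo r (2 * r), ‖iteratedFDeriv ℝ a u (t • e)‖ₑ ^ 2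
  set B := ∫⁻ t in Set.Ioo r (2 * r), ‖iteratedFDeriv ℝ (a + 1) u (t • e)‖ₑ ^ 2
  have e1 : ENNReal.ofReal (r ^ (-(n : ℝ))) * ENNReal.ofReal (r ^ ((n : ℝ) - 1)) =
      ENNReal.ofReal r⁻¹ := by
    rw [← ENNReal.ofReal_mul (by positivity), ← Real.rpow_add hr, ← Real.rpow_neg_one]
    congr 2; ring
  have e2 : ENNReal.ofReal (r ^ (2 - (n : ℝ))) * ENNReal.ofReal (r ^ ((n : ℝ) - 1)) =
      ENNReal.ofReal r := by
    rw [← ENNReal.ofReal_mul (by positivity), ← Real.rpow_add hr]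
    congr 1
    ring_nf
    exact Real.rpow_one r
  have e3 : ENNReal.ofReal r⁻¹ * ENNReal.ofReal r = 1 := by
    rw [← ENNReal.ofReal_mul (by positivity), inv_mul_cancel₀ hr.ne']; simp
  have e4 : σ⁻¹ * σ = 1 := ENNReal.inv_mul_cancel hσ0 hσt
  calc ‖iteratedFDeriv ℝ a u x‖ₑ ^ 2
      = ENNReal.ofReal r⁻¹ * (ENNReal.ofReal r * ‖iteratedFDeriv ℝ a u x‖ₑ ^ 2) := by
        rw [← mul_assoc, e3, one_mul]
    _ ≤ ENNReal.ofReal r⁻¹ * (2 * A + 2 * ENNReal.ofReal r ^ 2 * B) := by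
        gcongr
        exact h.trans (add_le_add le_rfl (mul_le_mul_right hle _))
    _ = 2 * (ENNReal.ofReal r⁻¹ * A +
        ENNReal.ofReal r⁻¹ * ENNReal.ofReal r * ENNReal.ofReal r * B) := by ring
    _ = 2 * (ENNReal.ofReal r⁻¹ * A + ENNReal.ofReal r * B) := by rw [e3, one_mul]
    _ = 2 * (σ⁻¹ * σ) * (ENNReal.ofReal (r ^ (-(n : ℝ))) * ENNReal.ofReal (r ^ ((n : ℝ) - 1)) * A +
        ENNReal.ofReal (r ^ (2 - (n : ℝ))) * ENNReal.ofReal (r ^ ((n : ℝ) - 1)) * B) := by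
        rw [e1, e2, e4, mul_one]
    _ = 2 * σ⁻¹ * (ENNReal.ofReal (r ^ (-(n : ℝ))) *
          (σ * (ENNReal.ofReal (r ^ ((n : ℝ) - 1)) * A)) +
        ENNReal.ofReal (r ^ (2 - (n : ℝ))) * (σ * (ENNReal.ofReal (r ^ ((n : ℝ) - 1)) * B))) := by
        ring
    _ ≤ _ := by
        gcongr
        · exact hpolar a
        · exact hpolar (a + 1)

end Radial

/-! ### Decay and weighted integrability of derivatives of radial functions -/

section Decay

theorem le_ofReal_sqrt_mul {a b C : ℝ≥0∞} (hC : C ≠ ⊤) (h : a ^ 2 ≤ C * b ^ 2) :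
    a ≤ ENNReal.ofReal (√C.toReal) * b := by
  refine (ENNReal.pow_le_pow_left_iff two_ne_zero).1 ?_
  rwa [mul_pow, ← ENNReal.ofReal_pow (Real.sqrt_nonneg _), Real.sq_sqrt ENNReal.toReal_nonneg,
    ENNReal.ofReal_toReal hC]

/-- The Schwartz function given by a test function. -/
noncomputable def IsRadialTest.toSchwartz {n : ℕ} {u : EuclideanSpace ℝ (Fin n) → ℂ}
    (hu : IsRadialTest u) : 𝓢(EuclideanSpace ℝ (Fin n), ℂ) :=
  hu.compactSupport.toSchwartzMap hu.smooth

theorem IsRadialTest.coe_toSchwartz {n : ℕ} {u : EuclideanSpace ℝ (Fin n) → ℂ}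
    (hu : IsRadialTest u) : (hu.toSchwartz : EuclideanSpace ℝ (Fin n) → ℂ) = u := rfl

theorem hInterNorm_sq {n : ℕ} (a b : ℝ) (u : EuclideanSpace ℝ (Fin n) → ℂ) :
    hInterNorm a b u ^ 2 = hNorm a u ^ 2 + hNorm b u ^ 2 := by
  rw [hInterNorm, ← ENNReal.rpow_natCast, ← ENNReal.rpow_mul]
  norm_num

theorem hNorm_sq_lt_top {n : ℕ} {t : ℝ} (ht : 0 ≤ t) (g : 𝓢(EuclideanSpace ℝ (Fin n), ℂ)) :
    hNorm t g ^ 2 < ⊤ := by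
  rw [hNorm_sq]
  exact ENNReal.mul_lt_top ENNReal.ofReal_lt_top (energy_lt_top ht g)

theorem hInterNorm_ne_top {n : ℕ} {a b : ℝ} (ha : 0 ≤ a) (hb : 0 ≤ b)
    (g : 𝓢(EuclideanSpace ℝ (Fin n), ℂ)) : hInterNorm a b g ≠ ⊤ := by
  have h : hInterNorm a b g ^ 2 < ⊤ := by
    rw [hInterNorm_sq]
    exact ENNReal.add_lt_top.2 ⟨hNorm_sq_lt_top ha g, hNorm_sq_lt_top hb g⟩
  intro h'
  rw [h'] at h
  simp at h

theorem energy_le_hNorm_sq {n : ℕ} {t : ℝ} (ht : 0 ≤ t) (g : 𝓢(EuclideanSpace ℝ (Fin n), ℂ)) :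
    energy t g ≤ hNorm t g ^ 2 := by
  rw [hNorm_sq]
  refine le_mul_of_one_le_left' ?_
  rw [ENNReal.one_le_ofReal]
  exact Real.one_le_rpow (by linarith [Real.pi_gt_three]) (by linarith)

theorem energy_add_le_hInterNorm_sq {n : ℕ} {a b : ℝ} (ha : 0 ≤ a) (hb : 0 ≤ b)
    (g : 𝓢(EuclideanSpace ℝ (Fin n), ℂ)) :
    energy a g + energy b g ≤ hInterNorm a b g ^ 2 := by
  rw [hInterNorm_sq]
  exact add_le_add (energy_le_hNorm_sq ha g) (energy_le_hNorm_sq hb g)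

/-- The weight `max 1 |x|`. -/
noncomputable def weight {n : ℕ} (x : EuclideanSpace ℝ (Fin n)) : ℝ := max 1 ‖x‖

theorem one_le_weight {n : ℕ} (x : EuclideanSpace ℝ (Fin n)) : 1 ≤ weight x := le_max_left _ _

theorem weight_pos {n : ℕ} (x : EuclideanSpace ℝ (Fin n)) : 0 < weight x :=
  one_pos.trans_le (one_le_weight x)

theorem continuous_weight_rpow {n : ℕ} (p : ℝ) :
    Continuous fun x : EuclideanSpace ℝ (Fin n) => weight x ^ p := by
  refine Continuous.rpow_const ?_ fun x => Or.inl (weight_pos x).ne'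
  unfold weight
  fun_prop

theorem eLpNorm_weight_rpow_lt_top {n : ℕ} {p : ℝ} (hp : (n : ℝ) < 2 * p) :
    eLpNorm (fun x : EuclideanSpace ℝ (Fin n) => weight x ^ (-p)) 2 volume < ⊤ := by
  have hp0 : 0 < p := by
    have : (0 : ℝ) ≤ n := Nat.cast_nonneg n
    linarith
  have h : eLpNorm (fun x : EuclideanSpace ℝ (Fin n) => weight x ^ (-p)) 2 volume ^ 2 < ⊤ := by
    rw [eLpNorm_two_sq]
    have hfin := finite_integral_one_add_norm (E := EuclideanSpace ℝ (Fin n)) (μ := volume)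
      (r := 2 * p) (by simpa using hp)
    have hfin2 : ∫⁻ x : EuclideanSpace ℝ (Fin n), ENNReal.ofReal (2 ^ (2 * p)) *
        ENNReal.ofReal ((1 + ‖x‖) ^ (-(2 * p))) < ⊤ := by
      rw [lintegral_const_mul' _ _ ENNReal.ofReal_ne_top]
      exact ENNReal.mul_lt_top ENNReal.ofReal_lt_top hfin
    refine lt_of_le_of_lt (lintegral_mono fun x => ?_) hfin2
    have hw := weight_pos x
    rw [← ENNReal.ofReal_mul (by positivity), ← ofReal_norm, Real.norm_of_nonneg (by positivity),
      ← ENNReal.ofReal_pow (by positivity), ← Real.rpow_natCast, ← Real.rpow_mul hw.le]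
    refine ENNReal.ofReal_le_ofReal ?_
    have e : -p * ((2 : ℕ) : ℝ) = -(2 * p) := by push_cast; ring
    rw [e, Real.rpow_neg hw.le, Real.rpow_neg (by positivity), ← div_eq_mul_inv, ← one_div,
      div_le_div_iff₀ (by positivity) (by positivity), one_mul,
      ← Real.mul_rpow (by norm_num) hw.le]
    refine Real.rpow_le_rpow (by positivity) ?_ (by positivity)
    have : ‖x‖ ≤ weight x := le_max_right _ _
    linarith [one_le_weight x]
  by_contra h'
  rw [not_lt, top_le_iff] at h'
  rw [h'] at h
  simp at h

variable {n : ℕ} [NeZero n]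

/-- For `a < s`, Hardy's inequality of order `s - a`, whose weight is comparable to a power of `r`
on the annulus; for `a ≥ s`, Plancherel and interpolation between `s` and `k`, with no power of `r`.
-/
theorem exists_lintegral_annulus_le {s : ℝ} {k a : ℕ} (hs : 2 * s < n) (hs0 : 0 ≤ s)
    (ha : a ≤ k) :
    ∃ C : ℝ≥0∞, C ≠ ⊤ ∧ ∀ (g : 𝓢(EuclideanSpace ℝ (Fin n), ℂ)) (r : ℝ), 0 < r →
      ∫⁻ y in annulus (EuclideanSpace ℝ (Fin n)) r, ‖iteratedFDeriv ℝ a g y‖ₑ ^ 2 ≤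
        C * (ENNReal.ofReal (r ^ (2 * max (s - a) 0)) * (energy s g + energy k g)) := by
  rcases lt_or_ge (a : ℝ) s with has | has
  · obtain ⟨C, hC, h⟩ := exists_hardy_iteratedFDeriv (n := n) a (t := s - a) (by linarith)
      (by have : (0 : ℝ) ≤ a := Nat.cast_nonneg a
          linarith)
    refine ⟨ENNReal.ofReal (2 ^ (2 * (s - a))) * C, ENNReal.mul_ne_top ENNReal.ofReal_ne_top hC,
      fun g r hr => ?_⟩
    have hm : Measurable fun y => ‖iteratedFDeriv ℝ a g y‖ₑ :=
      ((g.smooth a).continuous_iteratedFDeriv').enorm.measurable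
    rw [max_eq_left (by linarith)]
    calc ∫⁻ y in annulus (EuclideanSpace ℝ (Fin n)) r, ‖iteratedFDeriv ℝ a g y‖ₑ ^ 2
        ≤ ∫⁻ y in annulus (EuclideanSpace ℝ (Fin n)) r, ENNReal.ofReal ((2 * r) ^ (2 * (s - a))) *
          (ENNReal.ofReal (‖y‖ ^ (-(2 * (s - a)))) * ‖iteratedFDeriv ℝ a g y‖ₑ ^ 2) := by
          refine setLIntegral_mono' (measurableSet_annulus r) fun y hy => ?_
          rw [← mul_assoc, ← ENNReal.ofReal_mul (by positivity)]
          refine le_mul_of_one_le_left' ?_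
          have hy0 : 0 < ‖y‖ := hr.trans hy.1
          rw [ENNReal.one_le_ofReal, Real.rpow_neg hy0.le, ← div_eq_mul_inv,
            one_le_div (by positivity)]
          exact Real.rpow_le_rpow hy0.le hy.2.le (by linarith)
      _ ≤ ENNReal.ofReal ((2 * r) ^ (2 * (s - a))) * (C * energy s g) := by
          rw [lintegral_const_mul _ (by fun_prop)]
          gcongr
          refine (setLIntegral_le_lintegral _ _).trans ((h g).trans ?_)
          simp
      _ ≤ ENNReal.ofReal ((2 * r) ^ (2 * (s - a))) * (C * (energy s g + energy k g)) := by
          gcongr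
          exact le_self_add
      _ = _ := by
          rw [Real.mul_rpow (by norm_num) hr.le, ENNReal.ofReal_mul (by positivity)]
          ring
  · obtain ⟨C, hC, h⟩ := exists_lintegral_iteratedFDeriv_le n a
    refine ⟨C, hC, fun g r hr => ?_⟩
    rw [max_eq_right (by linarith)]
    refine (setLIntegral_le_lintegral _ _).trans ((h g).trans ?_)
    gcongr
    simpa using energy_le_add g hs0 has (by exact_mod_cast ha)

theorem exists_enorm_sq_le_of_one_le {s : ℝ} {k a : ℕ} (hs : 2 * s < n) (hs0 : 0 ≤ s)
    (ha : a + 1 ≤ k) :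
    ∃ C : ℝ≥0∞, C ≠ ⊤ ∧ ∀ (g : 𝓢(EuclideanSpace ℝ (Fin n), ℂ)),
      (∀ x y, ‖x‖ = ‖y‖ → g x = g y) → ∀ x : EuclideanSpace ℝ (Fin n), 1 ≤ ‖x‖ →
      ‖iteratedFDeriv ℝ a g x‖ₑ ^ 2 ≤
        C * (ENNReal.ofReal (‖x‖ ^ (2 - (n : ℝ) + 2 * max (s - a - 1) 0)) *
          (energy s g + energy k g)) := by
  obtain ⟨C₀, hC₀, h₀⟩ := exists_enorm_sq_le_lintegral_annulus n
  obtain ⟨C₁, hC₁, h₁⟩ := exists_lintegral_annulus_le (n := n) (k := k) (a := a) hs hs0 (by omega)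
  obtain ⟨C₂, hC₂, h₂⟩ := exists_lintegral_annulus_le (n := n) (k := k) (a := a + 1) hs hs0 ha
  refine ⟨C₀ * (C₁ + C₂), ENNReal.mul_ne_top hC₀ (ENNReal.add_ne_top.2 ⟨hC₁, hC₂⟩),
    fun g hg x hx => ?_⟩
  have hx0 : 0 < ‖x‖ := by linarith
  refine (h₀ g (g.smooth _) hg a x (norm_pos_iff.1 hx0)).trans ?_
  rw [mul_assoc, add_mul]
  refine mul_le_mul_right (add_le_add ?_ ?_) C₀
  · refine (mul_le_mul_right (h₁ g _ hx0) _).trans ?_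
    rw [mul_left_comm, ← mul_assoc (ENNReal.ofReal _), ← ENNReal.ofReal_mul (by positivity),
      ← Real.rpow_add hx0]
    gcongr 2
    -- The term from order `a` is no larger than the one from order `a + 1`: since `|x| ≥ 1`, it
    -- suffices that `max (s - a) 0` exceeds `max (s - a - 1) 0` by at most 1.
    refine ENNReal.ofReal_le_ofReal (Real.rpow_le_rpow_of_exponent_le hx ?_)
    have : max (s - a) 0 ≤ max (s - a - 1) 0 + 1 := by
      refine max_le ?_ ?_
      · linarith [le_max_left (s - a - 1) 0]
      · linarith [le_max_right (s - a - 1) 0]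
    linarith
  · refine (mul_le_mul_right (h₂ g _ hx0) _).trans ?_
    rw [mul_left_comm, ← mul_assoc (ENNReal.ofReal _), ← ENNReal.ofReal_mul (by positivity),
      ← Real.rpow_add hx0]
    push_cast
    rw [sub_add_eq_sub_sub]

/-- Sobolev embedding for `D^a g` between the orders `max (s - a) 0 < n / 2` and `k - a > n / 2`;
after adding `a` both lie in `[s, k]`. It covers the unit ball, where the annulus bound degenerates.
-/
theorem exists_enorm_sq_le {s : ℝ} {k a : ℕ} (hs : 2 * s < n) (hs0 : 0 ≤ s)
    (ha : n + 2 * a < 2 * k) :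
    ∃ C : ℝ≥0∞, C ≠ ⊤ ∧ ∀ (g : 𝓢(EuclideanSpace ℝ (Fin n), ℂ)) (x : EuclideanSpace ℝ (Fin n)),
      ‖iteratedFDeriv ℝ a g x‖ₑ ^ 2 ≤ C * (energy s g + energy k g) := by
  have ha' : (n : ℝ) + 2 * a < 2 * k := by exact_mod_cast ha
  have ha0 : (0 : ℝ) ≤ a := Nat.cast_nonneg a
  have hn0 : (0 : ℝ) < n := Nat.cast_pos.2 (NeZero.pos n)
  obtain ⟨C, hC, h⟩ := exists_enorm_sq_iteratedFDeriv_le_energy (n := n) a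
    (t₀ := max (s - a) 0) (t₁ := k - a) (le_max_right _ _)
    (by rcases max_cases (s - a) 0 with ⟨h, -⟩ | ⟨h, -⟩ <;> rw [h] <;> linarith)
    (by linarith)
  refine ⟨C * 2, ENNReal.mul_ne_top hC (by norm_num), fun g x => (h g x).trans ?_⟩
  rw [mul_assoc, two_mul]
  gcongr
  · refine energy_le_add g hs0 ?_ ?_
    · linarith [le_max_left (s - a) 0]
    · rcases max_cases (s - a) 0 with ⟨h, -⟩ | ⟨h, -⟩ <;> rw [h] <;> linarith
  · rw [sub_add_cancel]
    exact le_add_self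

/-- Pointwise decay of the derivatives of radial functions. -/
theorem exists_norm_iteratedFDeriv_le {s : ℝ} {k a : ℕ} (hs : 2 * s < n) (hs0 : 0 ≤ s)
    (ha : n + 2 * a < 2 * k) (hak : a + 1 ≤ k) :
    ∃ c : ℝ, 0 ≤ c ∧ ∀ u : EuclideanSpace ℝ (Fin n) → ℂ, IsRadialTest u → ∀ x,
      ‖iteratedFDeriv ℝ a u x‖ ≤
        c * ((hInterNorm s k u).toReal * weight x ^ (1 - (n : ℝ) / 2 + max (s - a - 1) 0)) := by
  obtain ⟨C₁, hC₁, h₁⟩ := exists_enorm_sq_le_of_one_le (n := n) hs hs0 hak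
  obtain ⟨C₂, hC₂, h₂⟩ := exists_enorm_sq_le (n := n) hs hs0 ha
  have hC : C₁ + C₂ ≠ ⊤ := ENNReal.add_ne_top.2 ⟨hC₁, hC₂⟩
  refine ⟨√(C₁ + C₂).toReal, Real.sqrt_nonneg _, fun u hu x => ?_⟩
  set p := 1 - (n : ℝ) / 2 + max (s - a - 1) 0 with hp
  have hw := weight_pos x
  set g := hu.toSchwartz with hgdef
  have hg : (g : EuclideanSpace ℝ (Fin n) → ℂ) = u := hu.coe_toSchwartz
  have hk0 : (0 : ℝ) ≤ k := Nat.cast_nonneg k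
  have hN := energy_add_le_hInterNorm_sq (b := (k : ℝ)) hs0 hk0 g
  have hNt := hInterNorm_ne_top (b := (k : ℝ)) hs0 hk0 g
  rw [hg] at hN hNt
  have key : ‖iteratedFDeriv ℝ a u x‖ₑ ^ 2 ≤ (C₁ + C₂) *
      (ENNReal.ofReal ((hInterNorm s k u).toReal * weight x ^ p)) ^ 2 := by
    have e1 : (ENNReal.ofReal ((hInterNorm s k u).toReal * weight x ^ p)) ^ 2 =
        ENNReal.ofReal (weight x ^ (2 * p)) * hInterNorm s k u ^ 2 := by
      rw [ENNReal.ofReal_mul ENNReal.toReal_nonneg, ENNReal.ofReal_toReal hNt, mul_pow,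
        ← ENNReal.ofReal_pow (by positivity), ← Real.rpow_natCast, ← Real.rpow_mul hw.le, mul_comm]
      congr 3
      push_cast
      ring
    rw [e1]
    rcases le_total 1 ‖x‖ with hx | hx
    · have hwx : weight x = ‖x‖ := max_eq_right hx
      have := h₁ g (fun x y h => by rw [hg]; exact hu.radial x y h) x hx
      rw [hg] at this
      refine this.trans ?_
      rw [hwx]
      have e2 : 2 - (n : ℝ) + 2 * max (s - a - 1) 0 = 2 * p := by rw [hp]; ring
      rw [e2]
      gcongr
      exact le_self_add
    · have hwx : weight x = 1 := max_eq_left hx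
      have := h₂ g x
      rw [hg] at this
      refine this.trans ?_
      rw [hwx, Real.one_rpow, ENNReal.ofReal_one, one_mul]
      gcongr
      exact le_add_self
  have h := le_ofReal_sqrt_mul hC key
  rw [← ofReal_norm, ← ENNReal.ofReal_mul (Real.sqrt_nonneg _)] at h
  exact (ENNReal.ofReal_le_ofReal_iff (by positivity)).1 h

/-- Weighted square integrability of the derivatives of test functions. -/
theorem exists_eLpNorm_weight_iteratedFDeriv_le {s : ℝ} {k a : ℕ} (hs : 2 * s < n)
    (hs0 : 0 ≤ s) (hak : a ≤ k) :
    ∃ c : ℝ, 0 ≤ c ∧ ∀ u : EuclideanSpace ℝ (Fin n) → ℂ, IsRadialTest u →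
      eLpNorm (fun x => weight x ^ (-max (s - a) 0) * ‖iteratedFDeriv ℝ a u x‖) 2 volume ≤
        ENNReal.ofReal c * hInterNorm s k u := by
  suffices h : ∃ C : ℝ≥0∞, C ≠ ⊤ ∧ ∀ g : 𝓢(EuclideanSpace ℝ (Fin n), ℂ),
      ∫⁻ x, ‖weight x ^ (-max (s - a) 0) * ‖iteratedFDeriv ℝ a g x‖‖ₑ ^ 2 ≤
        C * (energy s g + energy k g) by
    obtain ⟨C, hC, h⟩ := h
    refine ⟨√C.toReal, Real.sqrt_nonneg _, fun u hu => le_ofReal_sqrt_mul hC ?_⟩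
    rw [eLpNorm_two_sq]
    refine (h hu.toSchwartz).trans ?_
    gcongr
    exact energy_add_le_hInterNorm_sq hs0 (Nat.cast_nonneg k) hu.toSchwartz
  rcases lt_or_ge (a : ℝ) s with has | has
  · have ha0 : (0 : ℝ) ≤ a := Nat.cast_nonneg a
    obtain ⟨C, hC, h⟩ := exists_hardy_iteratedFDeriv (n := n) a (t := s - a) (by linarith)
      (by linarith)
    refine ⟨C, hC, fun g => ?_⟩
    rw [max_eq_left (by linarith)]
    calc _ ≤ ∫⁻ x, ENNReal.ofReal (‖x‖ ^ (-(2 * (s - a)))) * ‖iteratedFDeriv ℝ a g x‖ₑ ^ 2 := by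
          refine lintegral_mono_ae ?_
          filter_upwards [ae_ne_zero_of_nontrivial (V := EuclideanSpace ℝ (Fin n))] with x hx
          have hx0 := norm_pos_iff.2 hx
          have hw := weight_pos x
          rw [enorm_mul, enorm_norm, mul_pow]
          gcongr
          rw [← ofReal_norm, Real.norm_of_nonneg (by positivity),
            ← ENNReal.ofReal_pow (by positivity), ← Real.rpow_natCast, ← Real.rpow_mul hw.le]
          refine ENNReal.ofReal_le_ofReal ?_
          have e : -(s - a) * ((2 : ℕ) : ℝ) = -(2 * (s - a)) := by push_cast; ring
          rw [e]
          exact Real.rpow_le_rpow_of_nonpos hx0 (le_max_right _ _) (by linarith)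
      _ ≤ C * energy (s - a + a) g := h g
      _ ≤ _ := by
          rw [sub_add_cancel]
          gcongr
          exact le_self_add
  · obtain ⟨C, hC, h⟩ := exists_lintegral_iteratedFDeriv_le n a
    refine ⟨C, hC, fun g => ?_⟩
    rw [max_eq_right (by linarith)]
    simp only [neg_zero, Real.rpow_zero, one_mul, enorm_norm]
    refine (h g).trans ?_
    gcongr
    exact energy_le_add g hs0 has (by exact_mod_cast hak)

end Decay

/-! ### Even functions: the quotient `F'(x) / x` and composition with a square root -/

section EvenFunctions

/-- Even smooth functions all of whose derivatives are bounded. -/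
structure EvenBounded (F : ℝ → ℂ) : Prop where
  smooth : ContDiff ℝ ∞ F
  even : Function.Even F
  bounded : ∀ l : ℕ, ∃ M : ℝ, ∀ x : ℝ, ‖iteratedDeriv l F x‖ ≤ M

/-- The moment average `∫₀¹ tˡ F(t x) dt`. -/
noncomputable def momentAverage (l : ℕ) (F : ℝ → ℂ) (x : ℝ) : ℂ :=
  ∫ t in (0 : ℝ)..1, ((t : ℂ) ^ l) * F (t * x)

theorem norm_momentAverage_le (l : ℕ) {F : ℝ → ℂ} {M : ℝ} (hM : ∀ x, ‖F x‖ ≤ M) (x : ℝ) :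
    ‖momentAverage l F x‖ ≤ M := by
  have h : ∀ t ∈ Set.uIoc (0 : ℝ) 1, ‖((t : ℂ) ^ l) * F (t * x)‖ ≤ M := by
    intro t ht
    rw [Set.uIoc_of_le zero_le_one] at ht
    rw [norm_mul, norm_pow, Complex.norm_real, Real.norm_of_nonneg ht.1.le]
    calc t ^ l * ‖F (t * x)‖ ≤ 1 * ‖F (t * x)‖ := by
          gcongr; exact pow_le_one₀ ht.1.le ht.2
      _ ≤ M := by rw [one_mul]; exact hM _
  have := intervalIntegral.norm_integral_le_of_norm_le_const h
  simpa [momentAverage] using this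

theorem hasDerivAt_momentAverage (l : ℕ) {F : ℝ → ℂ} (hF : ContDiff ℝ ∞ F) {M : ℝ}
    (hM : ∀ x, ‖deriv F x‖ ≤ M) (x : ℝ) :
    HasDerivAt (momentAverage l F) (momentAverage (l + 1) (deriv F) x) x := by
  have hd : Differentiable ℝ F := hF.differentiable (by simp)
  have hc : Continuous F := hF.continuous
  have hc' : Continuous (deriv F) := hF.continuous_deriv (by simp)
  refine (intervalIntegral.hasDerivAt_integral_of_dominated_loc_of_deriv_le (bound := fun _ => M)
    (F := fun x t => ((t : ℂ) ^ l) * F (t * x))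
    (F' := fun x t => ((t : ℂ) ^ (l + 1)) * deriv F (t * x))
    (Filter.univ_mem (f := nhds x)) ?_ ?_ ?_ ?_ ?_ ?_).2
  · exact Filter.Eventually.of_forall fun y => Continuous.aestronglyMeasurable (by fun_prop)
  · exact Continuous.intervalIntegrable (by fun_prop) _ _
  · exact Continuous.aestronglyMeasurable (by fun_prop)
  · refine ae_of_all _ fun t ht y _ => ?_
    rw [Set.uIoc_of_le zero_le_one] at ht
    rw [norm_mul, norm_pow, Complex.norm_real, Real.norm_of_nonneg ht.1.le]
    calc t ^ (l + 1) * ‖deriv F (t * y)‖ ≤ 1 * ‖deriv F (t * y)‖ := by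
          gcongr; exact pow_le_one₀ ht.1.le ht.2
      _ ≤ M := by rw [one_mul]; exact hM _
  · exact intervalIntegrable_const
  · refine ae_of_all _ fun t _ y _ => ?_
    have h1 : HasDerivAt (fun y : ℝ => t * y) t y := by
      simpa using (hasDerivAt_id y).const_mul t
    have h2 := (hd (t * y)).hasDerivAt.scomp y h1
    have h3 := h2.const_mul ((t : ℂ) ^ l)
    refine h3.congr_deriv ?_
    rw [Complex.real_smul]
    ring

theorem deriv_momentAverage (l : ℕ) {F : ℝ → ℂ} (hF : ContDiff ℝ ∞ F) {M : ℝ}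
    (hM : ∀ x, ‖deriv F x‖ ≤ M) :
    deriv (momentAverage l F) = momentAverage (l + 1) (deriv F) :=
  funext fun x => (hasDerivAt_momentAverage l hF hM x).deriv

theorem contDiff_deriv {F : ℝ → ℂ} (hF : ContDiff ℝ ∞ F) : ContDiff ℝ ∞ (deriv F) :=
  (contDiff_infty_iff_deriv.1 hF).2

theorem contDiff_momentAverage (j : ℕ) : ∀ (l : ℕ) {F : ℝ → ℂ}, ContDiff ℝ ∞ F →
    (∀ l : ℕ, ∃ M : ℝ, ∀ x : ℝ, ‖iteratedDeriv l F x‖ ≤ M) →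
    ContDiff ℝ j (momentAverage l F) := by
  induction j with
  | zero =>
    intro l F hF hb
    obtain ⟨M, hM⟩ := hb 1
    rw [iteratedDeriv_one] at hM
    refine contDiff_zero.2 (continuous_iff_continuousAt.2 fun x => ?_)
    exact (hasDerivAt_momentAverage l hF hM x).continuousAt
  | succ j ih =>
    intro l F hF hb
    obtain ⟨M, hM⟩ := hb 1
    rw [iteratedDeriv_one] at hM
    push_cast
    refine contDiff_succ_iff_deriv.2
      ⟨fun x => (hasDerivAt_momentAverage l hF hM x).differentiableAt, by simp, ?_⟩
    rw [deriv_momentAverage l hF hM]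
    refine ih (l + 1) (contDiff_deriv hF) fun l => ?_
    obtain ⟨M, hM⟩ := hb (l + 1)
    rw [iteratedDeriv_succ'] at hM
    exact ⟨M, hM⟩

/-- Each differentiation of `F(t x)` in `x` releases a factor `t`, so moment averages are closed
under differentiation. As `t ^ l ≤ 1` on the unit interval, bounds on the derivatives of `F` carry
over. -/
theorem iteratedDeriv_momentAverage (j : ℕ) : ∀ (l : ℕ) {F : ℝ → ℂ}, ContDiff ℝ ∞ F →
    (∀ l : ℕ, ∃ M : ℝ, ∀ x : ℝ, ‖iteratedDeriv l F x‖ ≤ M) →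
    iteratedDeriv j (momentAverage l F) = momentAverage (l + j) (iteratedDeriv j F) := by
  induction j with
  | zero => intro l F _ _; simp
  | succ j ih =>
    intro l F hF hb
    obtain ⟨M, hM⟩ := hb 1
    rw [iteratedDeriv_one] at hM
    rw [iteratedDeriv_succ', deriv_momentAverage l hF hM, ih (l + 1) (contDiff_deriv hF),
      iteratedDeriv_succ', add_assoc, add_comm 1 j]
    intro l
    obtain ⟨M, hM⟩ := hb (l + 1)
    rw [iteratedDeriv_succ'] at hM
    exact ⟨M, hM⟩

/-- The even function `F'(x) / x` attached to an even function `F`. -/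
noncomputable def derivQuotient (F : ℝ → ℂ) : ℝ → ℂ := momentAverage 0 (deriv (deriv F))

theorem deriv_neg_of_even {F : ℝ → ℂ} (hF : Function.Even F) (x : ℝ) :
    deriv F (-x) = -deriv F x := by
  have h := deriv_comp_neg F x
  rw [show (fun x => F (-x)) = F from funext hF] at h
  rw [h, neg_neg]

theorem deriv_neg_of_odd {F : ℝ → ℂ} (hF : ∀ x, F (-x) = -F x) : Function.Even (deriv F) := by
  intro x
  have h := deriv_comp_neg F x
  rw [show (fun x => F (-x)) = fun x => -F x from funext hF, deriv.fun_neg] at h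
  exact (neg_injective h).symm

/-- Closure of the class under `F ↦ F'(x) / x`; this is what allows the chain rule for `F ∘ √w` to
be iterated without singular factors. -/
theorem EvenBounded.derivQuotient {F : ℝ → ℂ} (hF : EvenBounded F) :
    EvenBounded (derivQuotient F) := by
  have h2 : ContDiff ℝ ∞ (deriv (deriv F)) := contDiff_deriv (contDiff_deriv hF.smooth)
  have hb : ∀ l : ℕ, ∃ M : ℝ, ∀ x : ℝ, ‖iteratedDeriv l (deriv (deriv F)) x‖ ≤ M := by
    intro l
    obtain ⟨M, hM⟩ := hF.bounded (l + 2)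
    rw [iteratedDeriv_succ', iteratedDeriv_succ'] at hM
    exact ⟨M, hM⟩
  refine ⟨contDiff_infty.2 fun j => contDiff_momentAverage j 0 h2 hb, fun x => ?_, fun l => ?_⟩
  · have he : Function.Even (deriv (deriv F)) := deriv_neg_of_odd (deriv_neg_of_even hF.even)
    unfold RadialSchauder.derivQuotient momentAverage
    refine intervalIntegral.integral_congr fun t _ => ?_
    simp only [mul_neg]
    rw [he]
  · obtain ⟨M, hM⟩ := hb l
    refine ⟨M, fun x => ?_⟩
    unfold RadialSchauder.derivQuotient
    rw [iteratedDeriv_momentAverage l 0 h2 hb]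
    exact norm_momentAverage_le _ hM x

/-- `F'` is odd, so `F'(0) = 0`, and `F'(y)` is the integral over `[0, 1]` of the derivative of `t ↦
F'(t y)`. -/
theorem EvenBounded.deriv_eq {F : ℝ → ℂ} (hF : EvenBounded F) (y : ℝ) :
    deriv F y = y * RadialSchauder.derivQuotient F y := by
  have h0 : deriv F 0 = 0 := by
    have h := deriv_neg_of_even hF.even 0
    rw [neg_zero] at h
    exact CharZero.eq_neg_self_iff.1 h
  have hc : ContDiff ℝ ∞ (deriv F) := contDiff_deriv hF.smooth
  have hd : Differentiable ℝ (deriv F) := hc.differentiable (by simp)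
  have hc2 : Continuous (deriv (deriv F)) := hc.continuous_deriv (by simp)
  have h : ∀ t : ℝ, HasDerivAt (fun t : ℝ => deriv F (t * y))
      ((y : ℂ) * deriv (deriv F) (t * y)) t := by
    intro t
    have h1 : HasDerivAt (fun t : ℝ => t * y) y t := by
      simpa using (hasDerivAt_id t).mul_const y
    have h2 := (hd (t * y)).hasDerivAt.scomp t h1
    rwa [Complex.real_smul] at h2
  have h2 := intervalIntegral.integral_eq_sub_of_hasDerivAt (a := 0) (b := 1) (fun t _ => h t)
    (Continuous.intervalIntegrable (by fun_prop) _ _)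
  rw [intervalIntegral.integral_const_mul] at h2
  simp only [one_mul, zero_mul, h0, sub_zero] at h2
  rw [← h2]
  simp [RadialSchauder.derivQuotient, momentAverage]

theorem EvenBounded.hasDerivWithinAt_comp_sqrt {F : ℝ → ℂ} (hF : EvenBounded F) {t : ℝ}
    (ht : 0 ≤ t) : HasDerivWithinAt (fun t => F (√t))
      (RadialSchauder.derivQuotient F (√t) / 2) (Set.Ici 0) t := by
  have hd : Differentiable ℝ F := hF.smooth.differentiable (by simp)
  have hpos : ∀ t : ℝ, 0 < t → HasDerivAt (fun t => F (√t))
      (RadialSchauder.derivQuotient F (√t) / 2) t := by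
    intro t ht
    have h := (hd (√t)).hasDerivAt.scomp t (Real.hasDerivAt_sqrt ht.ne')
    refine h.congr_deriv ?_
    rw [hF.deriv_eq, Complex.real_smul]
    have : (√t : ℂ) ≠ 0 := by exact_mod_cast (Real.sqrt_pos.2 ht).ne'
    push_cast
    field_simp
  -- At `t = 0` the square root is not differentiable; the one-sided derivative is the limit of the
  -- derivatives from the right, which exists by continuity of the quotient.
  rcases ht.eq_or_lt with rfl | ht
  · have hcq : Continuous (RadialSchauder.derivQuotient F) := hF.derivQuotient.smooth.continuous
    have hcF : Continuous F := hF.smooth.continuous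
    refine hasDerivWithinAt_Ici_of_tendsto_deriv (s := Set.Ioi 0)
      (fun t ht => (hpos t ht).differentiableAt.differentiableWithinAt)
      (Continuous.continuousWithinAt (by fun_prop)) self_mem_nhdsWithin ?_
    have h : Filter.Tendsto (fun t => RadialSchauder.derivQuotient F (√t) / 2)
        (nhdsWithin 0 (Set.Ioi 0)) (nhds (RadialSchauder.derivQuotient F (√0) / 2)) :=
      (Continuous.tendsto (by fun_prop) 0).mono_left nhdsWithin_le_nhds
    refine h.congr' ?_
    filter_upwards [self_mem_nhdsWithin] with t ht
    exact (hpos t ht).deriv.symm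
  · exact (hpos t ht).hasDerivWithinAt

variable {E : Type*} [NormedAddCommGroup E] [NormedSpace ℝ E]

/-- Since `w` takes values in `[0, ∞)`, the one-sided derivative at 0 is enough for a full
derivative of the composition, even where `w` vanishes. -/
theorem EvenBounded.hasFDerivAt_comp_sqrt {F : ℝ → ℂ} (hF : EvenBounded F) {w : E → ℝ}
    (hw : ∀ x, 0 ≤ w x) (hd : Differentiable ℝ w) (x : E) :
    HasFDerivAt (fun x => F (√(w x))) (RadialSchauder.derivQuotient F (√(w x)) •
      fderiv ℝ (fun x => ((w x / 2 : ℝ) : ℂ)) x) x := by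
  have h1 := (hF.hasDerivWithinAt_comp_sqrt (hw x)).hasFDerivWithinAt.comp x
    (hd x).hasFDerivAt.hasFDerivWithinAt (fun y _ => hw y : Set.MapsTo w Set.univ (Set.Ici 0))
  rw [hasFDerivWithinAt_univ] at h1
  refine h1.congr_fderiv ?_
  have h2 : HasFDerivAt (fun x => ((w x / 2 : ℝ) : ℂ))
      (Complex.ofRealCLM.comp ((2 : ℝ)⁻¹ • fderiv ℝ w x)) x := by
    have h3 : HasFDerivAt (fun x => w x / 2) ((2 : ℝ)⁻¹ • fderiv ℝ w x) x := by
      simpa only [div_eq_inv_mul] using (hd x).hasFDerivAt.const_mul (2 : ℝ)⁻¹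
    exact Complex.ofRealCLM.hasFDerivAt.comp x h3
  rw [h2.fderiv]
  ext y
  simp
  ring

theorem EvenBounded.fderiv_comp_sqrt {F : ℝ → ℂ} (hF : EvenBounded F) {w : E → ℝ}
    (hw : ∀ x, 0 ≤ w x) (hd : Differentiable ℝ w) :
    fderiv ℝ (fun x => F (√(w x))) = fun x => RadialSchauder.derivQuotient F (√(w x)) •
      fderiv ℝ (fun x => ((w x / 2 : ℝ) : ℂ)) x :=
  funext fun x => (hF.hasFDerivAt_comp_sqrt hw hd x).fderiv

theorem contDiff_ofReal_div_two {w : E → ℝ} (hs : ContDiff ℝ ∞ w) :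
    ContDiff ℝ ∞ fun x => ((w x / 2 : ℝ) : ℂ) :=
  Complex.ofRealCLM.contDiff.comp (hs.div_const 2)

theorem contDiff_comp_sqrt_nat {w : E → ℝ} (hw : ∀ x, 0 ≤ w x) (hs : ContDiff ℝ ∞ w) (j : ℕ) :
    ∀ {F : ℝ → ℂ}, EvenBounded F → ContDiff ℝ j fun x => F (√(w x)) := by
  have hd : Differentiable ℝ w := hs.differentiable (by simp)
  induction j with
  | zero =>
    intro F hF
    have := hF.smooth.continuous
    have := hs.continuous
    exact contDiff_zero.2 (by fun_prop)
  | succ j ih =>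
    intro F hF
    push_cast
    refine contDiff_succ_iff_fderiv.2
      ⟨fun x => (hF.hasFDerivAt_comp_sqrt hw hd x).differentiableAt, by simp, ?_⟩
    rw [hF.fderiv_comp_sqrt hw hd]
    refine (ih hF.derivQuotient).smul ?_
    exact ((contDiff_ofReal_div_two hs).fderiv_right (m := ∞) (by simp)).of_le (by exact_mod_cast le_top)

theorem EvenBounded.contDiff_comp_sqrt {F : ℝ → ℂ} (hF : EvenBounded F) {w : E → ℝ}
    (hw : ∀ x, 0 ≤ w x) (hs : ContDiff ℝ ∞ w) : ContDiff ℝ ∞ fun x => F (√(w x)) :=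
  contDiff_infty.2 fun j => contDiff_comp_sqrt_nat hw hs j hF

/-- Leibniz's rule applied to the gradient formula. Only derivatives of `w` of order at least 1
occur, so the size of `w` itself never matters. -/
theorem EvenBounded.norm_iteratedFDeriv_succ_le {F : ℝ → ℂ} (hF : EvenBounded F) {w : E → ℝ}
    (hw : ∀ x, 0 ≤ w x) (hs : ContDiff ℝ ∞ w) (b : ℕ) (x : E) :
    ‖iteratedFDeriv ℝ (b + 1) (fun x => F (√(w x))) x‖ ≤ ∑ i ∈ Finset.range (b + 1),
      (b.choose i : ℝ) *
        ‖iteratedFDeriv ℝ i (fun x => RadialSchauder.derivQuotient F (√(w x))) x‖ *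
        ‖iteratedFDeriv ℝ (b - i + 1) (fun x => ((w x / 2 : ℝ) : ℂ)) x‖ := by
  have hd : Differentiable ℝ w := hs.differentiable (by simp)
  rw [← norm_iteratedFDeriv_fderiv, hF.fderiv_comp_sqrt hw hd]
  refine (norm_iteratedFDeriv_smul_le (hF.derivQuotient.contDiff_comp_sqrt hw hs)
    ((contDiff_ofReal_div_two hs).fderiv_right (m := ∞) (by simp)) x
    (by exact_mod_cast le_top)).trans (le_of_eq ?_)
  refine Finset.sum_congr rfl fun i _ => ?_
  rw [norm_iteratedFDeriv_fderiv]

end EvenFunctions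

/-! ### Calculus of derivative bounds: decaying part plus remainder -/

section DerivBounds

/-- Bounds for a sequence `d` of norms of successive derivatives at a point: a decaying bound up to
order `K`, and up to order `k` a decaying bound with remainder `B`. -/
structure DerivBound (k K : ℕ) (Y A B : ℝ) (d : ℕ → ℝ) : Prop where
  low : ∀ a ≤ K, d a ≤ A * Y ^ min a 1
  all : ∀ a ≤ k, d a ≤ A * Y ^ a + B

theorem DerivBound.mono {k K : ℕ} {Y Z A A' B B' : ℝ} {d : ℕ → ℝ} (h : DerivBound k K Y A B d)
    (hY : 0 ≤ Y) (hYZ : Y ≤ Z) (hA : 0 ≤ A) (hAA : A ≤ A') (hBB : B ≤ B') :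
    DerivBound k K Z A' B' d := by
  have hZ : 0 ≤ Z := hY.trans hYZ
  have hA' : 0 ≤ A' := hA.trans hAA
  refine ⟨fun a ha => (h.low a ha).trans ?_, fun a ha => (h.all a ha).trans ?_⟩ <;> gcongr

theorem pow_min_add_le {Y : ℝ} (hY : 0 ≤ Y) (hY1 : Y ≤ 1) (i j : ℕ) :
    Y ^ min i 1 * Y ^ min j 1 ≤ Y ^ min (i + j) 1 := by
  rw [← pow_add]
  exact pow_le_pow_of_le_one hY hY1 (by omega)

/-- In Leibniz's rule two orders with sum at most `k ≤ 2 * K + 1` cannot both exceed `K`. The factor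
of order at most `K` is bounded by its amplitude, so the product of the two remainders never
appears. The constant `2 ^ k` bounds the sum of the binomial coefficients. -/
theorem DerivBound.mul {k K : ℕ} (hk : k ≤ 2 * K + 1) (hK : K ≤ k) {Y A A' B B' : ℝ}
    {d d' e : ℕ → ℝ} (hY : 0 ≤ Y) (hY1 : Y ≤ 1) (hA : 0 ≤ A) (hA' : 0 ≤ A') (hB : 0 ≤ B)
    (hB' : 0 ≤ B') (hd0 : ∀ a, 0 ≤ d a) (hd0' : ∀ a, 0 ≤ d' a)
    (hd : DerivBound k K Y A B d) (hd' : DerivBound k K Y A' B' d')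
    (he : ∀ a ≤ k, e a ≤ ∑ i ∈ Finset.range (a + 1), (a.choose i : ℝ) * d i * d' (a - i)) :
    DerivBound k K Y (2 ^ k * (A * A')) (2 ^ k * (B * A' + A * B')) e := by
  have hsum : ∀ a ≤ k, ∀ T : ℝ, 0 ≤ T → (∀ i ≤ a, d i * d' (a - i) ≤ T) → e a ≤ 2 ^ k * T := by
    intro a ha T hT h
    calc e a ≤ ∑ i ∈ Finset.range (a + 1), (a.choose i : ℝ) * d i * d' (a - i) := he a ha
      _ ≤ ∑ i ∈ Finset.range (a + 1), (a.choose i : ℝ) * T := by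
          refine Finset.sum_le_sum fun i hi => ?_
          rw [mul_assoc]
          gcongr
          exact h i (by simpa [Nat.lt_succ_iff] using hi)
      _ = 2 ^ a * T := by
          rw [← Finset.sum_mul, ← Nat.cast_sum, Nat.sum_range_choose]
          push_cast; rfl
      _ ≤ 2 ^ k * T := by gcongr; norm_num
  have hpow1 : ∀ i : ℕ, Y ^ i ≤ 1 := fun i => pow_le_one₀ hY hY1
  refine ⟨fun a ha => ?_, fun a ha => ?_⟩
  · rw [mul_assoc]
    refine hsum a (ha.trans hK) _ (by positivity) fun i hi => ?_
    calc d i * d' (a - i) ≤ (A * Y ^ min i 1) * (A' * Y ^ min (a - i) 1) := by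
          gcongr
          · exact hd0' _
          · exact hd.low i (hi.trans ha)
          · exact hd'.low (a - i) (by omega)
      _ = A * A' * (Y ^ min i 1 * Y ^ min (a - i) 1) := by ring
      _ ≤ A * A' * Y ^ min a 1 := by
          have := pow_min_add_le hY hY1 i (a - i)
          rw [Nat.add_sub_cancel' hi] at this
          gcongr
  · have key : ∀ i ≤ a, d i * d' (a - i) ≤ A * A' * Y ^ a + (B * A' + A * B') := by
      intro i hi
      set j := a - i with hj
      have hij : Y ^ a = Y ^ i * Y ^ j := by rw [← pow_add, hj, Nat.add_sub_cancel' hi]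
      have h1 := hd.all i (by omega)
      have h2 := hd'.all j (by omega)
      rcases (by omega : i ≤ K ∨ j ≤ K) with h | h
      · have h3 : d i ≤ A := (hd.low i h).trans (mul_le_of_le_one_right hA (hpow1 _))
        calc d i * d' j ≤ d i * (A' * Y ^ j + B') := mul_le_mul_of_nonneg_left h2 (hd0 i)
          _ = d i * (A' * Y ^ j) + d i * B' := by ring
          _ ≤ (A * Y ^ i + B) * (A' * Y ^ j) + A * B' := by gcongr
          _ = A * A' * (Y ^ i * Y ^ j) + (B * A' * Y ^ j + A * B') := by ring
          _ ≤ A * A' * Y ^ a + (B * A' + A * B') := by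
              rw [hij]
              have : B * A' * Y ^ j ≤ B * A' := mul_le_of_le_one_right (by positivity) (hpow1 _)
              linarith
      · have h3 : d' j ≤ A' := (hd'.low j h).trans (mul_le_of_le_one_right hA' (hpow1 _))
        calc d i * d' j ≤ (A * Y ^ i + B) * d' j := mul_le_mul_of_nonneg_right h1 (hd0' j)
          _ = A * Y ^ i * d' j + B * d' j := by ring
          _ ≤ A * Y ^ i * (A' * Y ^ j + B') + B * A' := by gcongr
          _ = A * A' * (Y ^ i * Y ^ j) + (A * B' * Y ^ i + B * A') := by ring
          _ ≤ A * A' * Y ^ a + (B * A' + A * B') := by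
              rw [hij]
              have : A * B' * Y ^ i ≤ A * B' := mul_le_of_le_one_right (by positivity) (hpow1 _)
              linarith
    calc e a ≤ 2 ^ k * (A * A' * Y ^ a + (B * A' + A * B')) :=
          hsum a ha _ (by positivity) key
      _ = _ := by ring

variable {E : Type*} [NormedAddCommGroup E]

/-- The derivatives of the identity have norm at most `X`, at most 1 and then 0. The condition `1 ≤
X * Y` says that a derivative of the coordinate, which gains `1 / X`, gains at least the prescribed
rate `Y`. -/
theorem derivBound_id [NormedSpace ℝ E] (k K : ℕ) {X Y : ℝ} {x : E} (hx : ‖x‖ ≤ X)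
    (hY : 0 ≤ Y) (hXY : 1 ≤ X * Y) :
    DerivBound k K Y X 0 fun a => ‖iteratedFDeriv ℝ a (fun y : E => y) x‖ := by
  have hX : 0 ≤ X := (norm_nonneg x).trans hx
  have h1 : ‖iteratedFDeriv ℝ 1 (fun y : E => y) x‖ ≤ 1 := by
    rw [← norm_iteratedFDeriv_fderiv, norm_iteratedFDeriv_zero]
    simpa using ContinuousLinearMap.norm_id_le (𝕜 := ℝ) (E := E)
  have h2 : ∀ a : ℕ, ‖iteratedFDeriv ℝ (a + 2) (fun y : E => y) x‖ = 0 := by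
    intro a
    rw [← norm_iteratedFDeriv_fderiv]
    have : fderiv ℝ (fun y : E => y) = fun _ => ContinuousLinearMap.id ℝ E :=
      funext fun y => fderiv_fun_id
    rw [this, iteratedFDeriv_const_of_ne (by omega)]
    simp
  refine ⟨fun a _ => ?_, fun a _ => ?_⟩
  · match a with
    | 0 => simpa using hx
    | 1 => simpa using h1.trans hXY
    | a + 2 => rw [h2]; positivity
  · match a with
    | 0 => simpa using hx
    | 1 => simpa using h1.trans hXY
    | a + 2 => rw [h2]; positivity

theorem derivBound_norm_sq [InnerProductSpace ℝ E] {k K : ℕ} (hk : k ≤ 2 * K + 1) (hK : K ≤ k)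
    {X Y : ℝ} {x : E} (hx : ‖x‖ ≤ X) (hY : 0 ≤ Y) (hY1 : Y ≤ 1) (hXY : 1 ≤ X * Y) :
    DerivBound k K Y (2 ^ k * (X * X)) 0
      fun a => ‖iteratedFDeriv ℝ a (fun y : E => ‖y‖ ^ 2 / 2) x‖ := by
  have hX : 0 ≤ X := (norm_nonneg x).trans hx
  have hid := derivBound_id k K hx hY hXY
  have h := hid.mul hk hK hY hY1 hX hX le_rfl le_rfl (fun a => norm_nonneg _)
    (fun a => norm_nonneg _) hid
    (e := fun a => ‖iteratedFDeriv ℝ a (fun y : E => ‖y‖ ^ 2 / 2) x‖) ?_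
  · simpa using h
  · intro a _
    let L : E →L[ℝ] E →L[ℝ] ℝ := (2 : ℝ)⁻¹ • innerSL ℝ
    have hLapp : ∀ y z : E, L y z = (2 : ℝ)⁻¹ * inner ℝ y z := fun y z => rfl
    have hL : ‖L‖ ≤ 1 := by
      refine L.opNorm_le_bound₂ zero_le_one fun y z => ?_
      rw [hLapp, norm_mul, one_mul]
      refine (mul_le_of_le_one_left (norm_nonneg _) (by norm_num)).trans ?_
      exact norm_inner_le_norm y z
    have hfun : (fun y : E => ‖y‖ ^ 2 / 2) = fun y => L y y := by
      ext y
      rw [hLapp, real_inner_self_eq_norm_sq, div_eq_inv_mul]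
    rw [hfun]
    exact L.norm_iteratedFDeriv_le_of_bilinear_of_le_one (N := ∞) contDiff_id contDiff_id x
      (by exact_mod_cast le_top) hL

variable [NormedSpace ℝ E]

/-- Induction on the order, for all admissible `F` at once: one derivative of `F ∘ √w` is
`derivQuotient F ∘ √w` times a derivative of `w / 2`, contributing one factor at most `1 + A`. The
remainder of `w` is normalized as `(1 + A) * β` so that it costs the same factor, and `k ≤ 2 * K +
1` keeps the bound linear in `β`. -/
theorem exists_comp_sqrt_bound {k K : ℕ} (hk : k ≤ 2 * K + 1) (a : ℕ) :
    ∀ {F : ℝ → ℂ}, EvenBounded F → ∃ c : ℝ, 0 ≤ c ∧ ∀ (w : E → ℝ), (∀ y, 0 ≤ w y) →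
      ContDiff ℝ ∞ w → ∀ (x : E) (A Z β : ℝ), 0 ≤ A → 0 ≤ Z → Z ≤ 1 → 0 ≤ β →
      (∀ b, 1 ≤ b → b ≤ K → ‖iteratedFDeriv ℝ b (fun y => ((w y / 2 : ℝ) : ℂ)) x‖ ≤ A * Z) →
      (∀ b, 1 ≤ b → b ≤ k → ‖iteratedFDeriv ℝ b (fun y => ((w y / 2 : ℝ) : ℂ)) x‖ ≤
        A * Z ^ b + (1 + A) * β) →
      ∀ i ≤ a, i ≤ k →
      (i ≤ K → ‖iteratedFDeriv ℝ i (fun y => F (√(w y))) x‖ ≤ c * (1 + A) ^ i * Z ^ min i 1) ∧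
      ‖iteratedFDeriv ℝ i (fun y => F (√(w y))) x‖ ≤ c * (1 + A) ^ i * (Z ^ i + β) := by
  induction a with
  | zero =>
    intro F hF
    obtain ⟨M, hM⟩ := hF.bounded 0
    have hM0 : 0 ≤ M := (norm_nonneg _).trans (hM 0)
    refine ⟨M, hM0, fun w hw hs x A Z β hA hZ hZ1 hβ h1 h2 i hi hik => ?_⟩
    obtain rfl : i = 0 := by omega
    have hMx : ‖F (√(w x))‖ ≤ M := by simpa using hM (√(w x))
    refine ⟨fun _ => by simpa using hMx, ?_⟩
    simp only [norm_iteratedFDeriv_zero, pow_zero, mul_one]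
    exact hMx.trans (le_mul_of_one_le_right hM0 (by linarith))
  | succ b ih =>
    intro F hF
    obtain ⟨c₀, hc₀, h₀⟩ := ih hF
    obtain ⟨c₁, hc₁, h₁⟩ := ih hF.derivQuotient
    -- `c₀` serves the orders below `b + 1`. At order `b + 1`, `2 ^ b` sums the binomial
    -- coefficients, and the 2 absorbs the two first-order occurrences of `β`.
    refine ⟨c₀ + 2 ^ b * (2 * c₁), by positivity,
      fun w hw hs x A Z β hA hZ hZ1 hβ h1 h2 i hi hik => ?_⟩
    have hA1 : 1 ≤ 1 + A := by linarith
    have hpow1 : ∀ i : ℕ, Z ^ i ≤ 1 := fun i => pow_le_one₀ hZ hZ1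
    rcases Nat.lt_or_ge i (b + 1) with hib | hib
    · obtain ⟨g1, g2⟩ := h₀ w hw hs x A Z β hA hZ hZ1 hβ h1 h2 i (by omega) hik
      have hcc : c₀ ≤ c₀ + 2 ^ b * (2 * c₁) := le_add_of_nonneg_right (by positivity)
      refine ⟨fun hiK => (g1 hiK).trans ?_, g2.trans ?_⟩ <;> gcongr
    obtain rfl : i = b + 1 := by omega
    set W : ℕ → ℝ := fun j => ‖iteratedFDeriv ℝ j (fun y => ((w y / 2 : ℝ) : ℂ)) x‖ with hW
    set D : ℕ → ℝ := fun j =>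
      ‖iteratedFDeriv ℝ j (fun y => derivQuotient F (√(w y))) x‖ with hD
    have hD0 : ∀ j, 0 ≤ D j := fun j => norm_nonneg _
    have hW0 : ∀ j, 0 ≤ W j := fun j => norm_nonneg _
    have hg := fun i hi hik => h₁ w hw hs x A Z β hA hZ hZ1 hβ h1 h2 i hi hik
    have hsum : ∀ T : ℝ, 0 ≤ T → (∀ i ≤ b, D i * W (b - i + 1) ≤ 2 * c₁ * T) →
        ‖iteratedFDeriv ℝ (b + 1) (fun y => F (√(w y))) x‖ ≤ (c₀ + 2 ^ b * (2 * c₁)) * T := by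
      intro T hT h
      refine (hF.norm_iteratedFDeriv_succ_le hw hs b x).trans ?_
      calc _ ≤ ∑ i ∈ Finset.range (b + 1), (b.choose i : ℝ) * (2 * c₁ * T) := by
            refine Finset.sum_le_sum fun i hi => ?_
            rw [mul_assoc]
            exact mul_le_mul_of_nonneg_left (h i (by simpa [Nat.lt_succ_iff] using hi))
              (Nat.cast_nonneg _)
        _ = 2 ^ b * (2 * c₁) * T := by
            rw [← Finset.sum_mul, ← Nat.cast_sum, Nat.sum_range_choose]
            push_cast; ring
        _ ≤ _ := by
            gcongr
            exact le_add_of_nonneg_left hc₀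
    have hpowA : ∀ i ≤ b, (1 + A) ^ i * (1 + A) ≤ (1 + A) ^ (b + 1) := by
      intro i hi
      rw [← pow_succ]
      exact pow_le_pow_right₀ hA1 (by omega)
    refine ⟨fun hbK => ?_, ?_⟩
    · rw [mul_assoc]
      refine hsum _ (by positivity) fun i hi => ?_
      have e1 := (hg i hi (by omega)).1 (by omega)
      have e2 := h1 (b - i + 1) (by omega) (by omega)
      have hmin : min (b + 1) 1 = 1 := by omega
      -- The single factor `Z` comes from the derivative of `w`, whose order `b - i + 1` is at least
      -- 1; the decay of the other factor is discarded.
      rw [hmin, pow_one]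
      calc D i * W (b - i + 1) ≤ (c₁ * (1 + A) ^ i * Z ^ min i 1) * (A * Z) := by
            gcongr
        _ ≤ (c₁ * (1 + A) ^ i * 1) * ((1 + A) * Z) := by
            gcongr
            · exact hpow1 _
            · linarith
        _ = c₁ * ((1 + A) ^ i * (1 + A) * Z) := by ring
        _ ≤ c₁ * ((1 + A) ^ (b + 1) * Z) := by
            gcongr
            exact hpowA i hi
        _ ≤ 2 * c₁ * ((1 + A) ^ (b + 1) * Z) := by
            have : 0 ≤ c₁ * ((1 + A) ^ (b + 1) * Z) := by positivity
            linarith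
    · rw [mul_assoc]
      refine hsum _ (by positivity) fun i hi => ?_
      obtain ⟨g1, g2⟩ := hg i hi (by omega)
      set j := b - i + 1 with hj
      have hij : Z ^ (b + 1) = Z ^ i * Z ^ j := by rw [← pow_add]; congr 1; omega
      have hWj := h2 j (by omega) (by omega)
      have hP : 0 ≤ (1 + A) ^ i := by positivity
      have hAle : A ≤ 1 + A := by linarith
      have fin : c₁ * (1 + A) ^ i * (1 + A) * (Z ^ (b + 1) + 2 * β) ≤
          2 * c₁ * ((1 + A) ^ (b + 1) * (Z ^ (b + 1) + β)) := by
        calc c₁ * (1 + A) ^ i * (1 + A) * (Z ^ (b + 1) + 2 * β)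
            = c₁ * ((1 + A) ^ i * (1 + A)) * (Z ^ (b + 1) + 2 * β) := by ring
          _ ≤ c₁ * (1 + A) ^ (b + 1) * (2 * (Z ^ (b + 1) + β)) := by
              have : 0 ≤ Z ^ (b + 1) := by positivity
              gcongr
              · exact hpowA i hi
              · linarith
          _ = _ := by ring
      refine le_trans ?_ fin
      have hZβ : 0 ≤ Z ^ i + β := by positivity
      -- The orders satisfy `i + j = b + 1 ≤ 2 * K + 1`, so one factor is bounded without remainder.
      rcases (by omega : i ≤ K ∨ j ≤ K) with h | h
      · have h3 : D i ≤ c₁ * (1 + A) ^ i :=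
          (g1 h).trans (mul_le_of_le_one_right (by positivity) (hpow1 _))
        calc D i * W j ≤ D i * (A * Z ^ j + (1 + A) * β) := mul_le_mul_of_nonneg_left hWj (hD0 i)
          _ = D i * (A * Z ^ j) + D i * ((1 + A) * β) := by ring
          _ ≤ (c₁ * (1 + A) ^ i * (Z ^ i + β)) * ((1 + A) * Z ^ j) +
              (c₁ * (1 + A) ^ i) * ((1 + A) * β) := by gcongr
          _ = c₁ * (1 + A) ^ i * (1 + A) * (Z ^ i * Z ^ j + (β * Z ^ j + β)) := by ring
          _ ≤ _ := by
              rw [hij]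
              gcongr
              have : β * Z ^ j ≤ β := mul_le_of_le_one_right hβ (hpow1 _)
              linarith
      · have h3 : W j ≤ 1 + A :=
          (h1 j (by omega) h).trans ((mul_le_of_le_one_right hA hZ1).trans hAle)
        calc D i * W j ≤ (c₁ * (1 + A) ^ i * (Z ^ i + β)) * W j :=
              mul_le_mul_of_nonneg_right g2 (hW0 j)
          _ = c₁ * (1 + A) ^ i * Z ^ i * W j + c₁ * (1 + A) ^ i * β * W j := by ring
          _ ≤ c₁ * (1 + A) ^ i * Z ^ i * ((1 + A) * Z ^ j + (1 + A) * β) +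
              c₁ * (1 + A) ^ i * β * (1 + A) := by
              have h4 : W j ≤ (1 + A) * Z ^ j + (1 + A) * β := hWj.trans (by gcongr)
              gcongr
          _ = c₁ * (1 + A) ^ i * (1 + A) * (Z ^ i * Z ^ j + (Z ^ i * β + β)) := by ring
          _ ≤ _ := by
              rw [hij]
              gcongr
              have : Z ^ i * β ≤ β := mul_le_of_le_one_left hβ (hpow1 _)
              linarith

end DerivBounds

/-! ### Pointwise derivative bounds for the nonlinearity -/

section Nonlinearity

variable {E : Type*} [NormedAddCommGroup E]

/-- `|x|` is not smooth at the origin, but `|x|² v²` is; evenness allows passing to its square root.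
-/
theorem apply_norm_mul_eq {F : ℝ → ℂ} (hF : Function.Even F) (v : E → ℝ) (x : E) :
    F (‖x‖ * v x) = F (√(‖x‖ ^ 2 * v x ^ 2)) := by
  rw [← mul_pow, Real.sqrt_sq_eq_abs]
  rcases abs_choice (‖x‖ * v x) with h | h <;> rw [h]
  exact (hF _).symm

variable [InnerProductSpace ℝ E]

theorem contDiff_norm_sq_mul_sq {v : E → ℝ} (hv : ContDiff ℝ ∞ v) :
    ContDiff ℝ ∞ fun x => ‖x‖ ^ 2 * v x ^ 2 :=
  (contDiff_norm_sq ℝ).mul (hv.pow 2)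

theorem EvenBounded.contDiff_apply_norm_mul {F : ℝ → ℂ} (hF : EvenBounded F) {v : E → ℝ}
    (hv : ContDiff ℝ ∞ v) : ContDiff ℝ ∞ fun x => F (‖x‖ * v x) := by
  simp_rw [apply_norm_mul_eq hF.even]
  exact hF.contDiff_comp_sqrt (fun x => by positivity) (contDiff_norm_sq_mul_sq hv)

theorem DerivBound.fun_mul {k K : ℕ} (hk : k ≤ 2 * K + 1) (hK : K ≤ k) {Y A A' B B' : ℝ}
    {f g : E → ℂ} {x : E} (hY : 0 ≤ Y) (hY1 : Y ≤ 1) (hA : 0 ≤ A) (hA' : 0 ≤ A') (hB : 0 ≤ B)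
    (hB' : 0 ≤ B') (hf : ContDiff ℝ ∞ f) (hg : ContDiff ℝ ∞ g)
    (hd : DerivBound k K Y A B fun a => ‖iteratedFDeriv ℝ a f x‖)
    (hd' : DerivBound k K Y A' B' fun a => ‖iteratedFDeriv ℝ a g x‖) :
    DerivBound k K Y (2 ^ k * (A * A')) (2 ^ k * (B * A' + A * B'))
      fun a => ‖iteratedFDeriv ℝ a (fun y => f y * g y) x‖ :=
  hd.mul hk hK hY hY1 hA hA' hB hB' (fun _ => norm_nonneg _) (fun _ => norm_nonneg _) hd'
    fun _ _ => norm_iteratedFDeriv_mul_le hf hg x (by exact_mod_cast le_top)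

/-- The factor `8 ^ k` collects three applications of the product rule: `|x|²` as the inner product
of the identity with itself, `v * v`, and the product of the two. Only `v` carries a remainder, and
it enters twice. -/
theorem derivBound_norm_sq_mul_sq {k K : ℕ} (hk : k ≤ 2 * K + 1) (hK : K ≤ k) {X Y A B : ℝ}
    {v : E → ℝ} {x : E} (hx : ‖x‖ ≤ X) (hY : 0 ≤ Y) (hY1 : Y ≤ 1) (hXY : 1 ≤ X * Y)
    (hA : 0 ≤ A) (hB : 0 ≤ B) (hv : ContDiff ℝ ∞ v)
    (hd : DerivBound k K Y A B fun a => ‖iteratedFDeriv ℝ a (fun y => (v y : ℂ)) x‖) :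
    DerivBound k K Y (8 ^ k * (X ^ 2 * A ^ 2)) (2 * 8 ^ k * (X ^ 2 * (A * B)))
      fun a => ‖iteratedFDeriv ℝ a (fun y => ((‖y‖ ^ 2 * v y ^ 2 / 2 : ℝ) : ℂ)) x‖ := by
  have hvc : ContDiff ℝ ∞ fun y => (v y : ℂ) := Complex.ofRealCLM.contDiff.comp hv
  have hX : 0 ≤ X := (norm_nonneg x).trans hx
  have h1 := derivBound_norm_sq hk hK hx hY hY1 hXY
  have h2 := DerivBound.fun_mul hk hK hY hY1 hA hA hB hB hvc hvc hd hd
  have hfun : (fun y => ((‖y‖ ^ 2 * v y ^ 2 / 2 : ℝ) : ℂ)) =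
      fun y => (‖y‖ ^ 2 / 2) • ((v y : ℂ) * (v y : ℂ)) := by
    ext y
    rw [Complex.real_smul]
    push_cast
    ring
  rw [hfun]
  have h3 := h1.mul hk hK hY hY1 (by positivity) (by positivity) le_rfl (by positivity)
    (fun _ => norm_nonneg _) (fun _ => norm_nonneg _) h2
    (e := fun a => ‖iteratedFDeriv ℝ a
      (fun y => (‖y‖ ^ 2 / 2) • ((v y : ℂ) * (v y : ℂ))) x‖) fun a _ =>
      norm_iteratedFDeriv_smul_le (N := ∞) ((contDiff_norm_sq ℝ).div_const 2) (hvc.mul hvc) x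
        (by exact_mod_cast le_top)
  have e8 : (8 : ℝ) ^ k = 2 ^ k * 2 ^ k * 2 ^ k := by rw [← mul_pow, ← mul_pow]; norm_num
  refine h3.mono hY le_rfl (by positivity) (le_of_eq ?_) (le_of_eq ?_) <;> rw [e8] <;> ring

/-- Pointwise bounds for the derivatives of `u₀ u₁ u₂ F(|x| v)` in terms of such bounds for the
factors. -/
theorem exists_derivBound_nonlinearity {k K : ℕ} (hk : k ≤ 2 * K + 1) (hK : K ≤ k) {F : ℝ → ℂ}
    (hF : EvenBounded F) :
    ∃ C : ℝ, 0 ≤ C ∧ ∀ (u : Fin 3 → E → ℂ) (v : E → ℝ), (∀ i, ContDiff ℝ ∞ (u i)) →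
      ContDiff ℝ ∞ v → ∀ (x : E) (X Y Z A β : ℝ) (a b : Fin 3 → ℝ) (a' b' : ℝ),
      ‖x‖ ≤ X → 0 ≤ Y → Y ≤ Z → Z ≤ 1 → 1 ≤ X * Y → 0 ≤ A → 0 ≤ β → (∀ i, 0 ≤ a i) →
      (∀ i, 0 ≤ b i) → 0 ≤ a' → 0 ≤ b' →
      (∀ i, DerivBound k K Y (a i) (b i) fun j => ‖iteratedFDeriv ℝ j (u i) x‖) →
      (DerivBound k K Y a' b' fun j => ‖iteratedFDeriv ℝ j (fun y => (v y : ℂ)) x‖) →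
      (∀ j, 1 ≤ j → 8 ^ k * (X ^ 2 * a' ^ 2) * Y ^ j ≤ A * Z ^ j) →
      2 * 8 ^ k * (X ^ 2 * (a' * b')) ≤ (1 + A) * β →
      DerivBound k K Z (C * (a 0 * a 1 * a 2 * (1 + A) ^ k))
        (C * ((1 + A) ^ k * (b 0 * a 1 * a 2 + a 0 * b 1 * a 2 + a 0 * a 1 * b 2 +
          a 0 * a 1 * a 2 * β)))
        fun j => ‖iteratedFDeriv ℝ j (fun y => u 0 y * u 1 y * u 2 y * F (‖y‖ * v y)) x‖ := by
  obtain ⟨c, hc, h⟩ := exists_comp_sqrt_bound (E := E) hk k hF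
  refine ⟨8 ^ k * c, by positivity, fun u v hu hv x X Y Z A β a b a' b' hx hY hYZ hZ1 hXY hA hβ
    ha hb ha' hb' hdu hdv hAZ hAβ => ?_⟩
  have hY1 : Y ≤ 1 := hYZ.trans hZ1
  have hZ : 0 ≤ Z := hY.trans hYZ
  have hW := derivBound_norm_sq_mul_sq hk hK hx hY hY1 hXY ha' hb' hv hdv
  have hA1 : 1 ≤ 1 + A := by linarith
  have hΦ : DerivBound k K Z (c * (1 + A) ^ k) (c * (1 + A) ^ k * β)
      fun j => ‖iteratedFDeriv ℝ j (fun y => F (‖y‖ * v y)) x‖ := by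
    simp_rw [apply_norm_mul_eq hF.even]
    have h' := h (fun y => ‖y‖ ^ 2 * v y ^ 2) (fun y => by positivity)
      (contDiff_norm_sq_mul_sq hv) x A Z β hA hZ hZ1 hβ
      (fun j hj1 hjK => by
        have h1 := hW.low j hjK
        rw [min_eq_right hj1] at h1
        simpa using h1.trans (hAZ 1 le_rfl))
      (fun j hj1 hjk => (hW.all j hjk).trans (add_le_add (hAZ j hj1) hAβ))
    refine ⟨fun j hj => ?_, fun j hj => ?_⟩
    · refine ((h' j (hj.trans hK) (hj.trans hK)).1 hj).trans ?_
      gcongr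
      exact hj.trans hK
    · refine ((h' j hj hj).2).trans ?_
      rw [← mul_add]
      gcongr
  have hu' : ∀ i, DerivBound k K Z (a i) (b i) fun j => ‖iteratedFDeriv ℝ j (u i) x‖ := fun i =>
    (hdu i).mono hY hYZ (ha i) le_rfl le_rfl
  have ha0 := ha 0
  have ha1 := ha 1
  have ha2 := ha 2
  have hb0 := hb 0
  have hb1 := hb 1
  have hb2 := hb 2
  have h01 := DerivBound.fun_mul hk hK hZ hZ1 ha0 ha1 hb0 hb1 (hu 0) (hu 1) (hu' 0) (hu' 1)
  have h012 := DerivBound.fun_mul hk hK hZ hZ1 (by positivity) ha2 (by positivity) hb2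
    ((hu 0).mul (hu 1)) (hu 2) h01 (hu' 2)
  have hall := DerivBound.fun_mul hk hK hZ hZ1 (by positivity) (by positivity) (by positivity)
    (by positivity) (((hu 0).mul (hu 1)).mul (hu 2)) (hF.contDiff_apply_norm_mul hv) h012 hΦ
  have e8 : (8 : ℝ) ^ k = 2 ^ k * 2 ^ k * 2 ^ k := by rw [← mul_pow, ← mul_pow]; norm_num
  refine hall.mono hZ le_rfl (by positivity) (le_of_eq ?_) (le_of_eq ?_) <;> rw [e8] <;> ring

end Nonlinearity

/-! ### Arithmetic of L² majorants -/

section SquareIntegrability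

/-- A real function whose `L²` norm is at most `L`. -/
structure L2Bound {α : Type*} [MeasurableSpace α] (μ : Measure α) (f : α → ℝ) (L : ℝ) : Prop where
  meas : AEStronglyMeasurable f μ
  nonneg : 0 ≤ L
  le : eLpNorm f 2 μ ≤ ENNReal.ofReal L

variable {α : Type*} [MeasurableSpace α] {μ : Measure α}

theorem L2Bound.add {f g : α → ℝ} {L M : ℝ} (hf : L2Bound μ f L) (hg : L2Bound μ g M) :
    L2Bound μ (fun x => f x + g x) (L + M) := by
  refine ⟨hf.meas.add hg.meas, add_nonneg hf.nonneg hg.nonneg, ?_⟩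
  rw [ENNReal.ofReal_add hf.nonneg hg.nonneg]
  exact (eLpNorm_add_le hf.meas hg.meas (by norm_num)).trans (add_le_add hf.le hg.le)

theorem L2Bound.const_mul {f : α → ℝ} {L : ℝ} (hf : L2Bound μ f L) {c : ℝ} (hc : 0 ≤ c) :
    L2Bound μ (fun x => c * f x) (c * L) := by
  refine ⟨hf.meas.const_mul c, mul_nonneg hc hf.nonneg, ?_⟩
  have h : eLpNorm (fun x => c * f x) 2 μ = ‖c‖ₑ * eLpNorm f 2 μ := by
    exact eLpNorm_const_smul c f 2 μ
  rw [h, ENNReal.ofReal_mul hc, ← ofReal_norm, Real.norm_of_nonneg hc]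
  gcongr
  exact hf.le

theorem L2Bound.sum {ι : Type*} (S : Finset ι) {f : ι → α → ℝ} {L : ι → ℝ}
    (h : ∀ i ∈ S, L2Bound μ (f i) (L i)) :
    L2Bound μ (fun x => ∑ i ∈ S, f i x) (∑ i ∈ S, L i) := by
  classical
  induction S using Finset.induction_on with
  | empty =>
    refine ⟨by simpa using aestronglyMeasurable_const, by simp, ?_⟩
    simp
  | insert i S hi ih =>
    simp only [Finset.sum_insert hi]
    exact (h i (Finset.mem_insert_self i S)).add
      (ih fun j hj => h j (Finset.mem_insert_of_mem hj))

theorem L2Bound.lintegral_le {f : α → ℝ} {L : ℝ} (hf : L2Bound μ f L) {F : Type*}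
    [NormedAddCommGroup F] {g : α → F} (hg : ∀ x, ‖g x‖ ≤ f x) :
    ∫⁻ x, ‖g x‖ₑ ^ 2 ∂μ ≤ ENNReal.ofReal L ^ 2 := by
  rw [← eLpNorm_two_sq]
  refine pow_le_pow_left' (le_trans ?_ hf.le) 2
  exact eLpNorm_mono fun x => (hg x).trans (le_abs_self _)

end SquareIntegrability

/-! ### The linear estimates for test functions, with constants uniform in the order -/

section TestFunctions

variable {n : ℕ}

theorem continuous_norm_iteratedFDeriv {u : EuclideanSpace ℝ (Fin n) → ℂ} (hu : IsRadialTest u)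
    (a : ℕ) : Continuous fun x => ‖iteratedFDeriv ℝ a u x‖ :=
  ((hu.smooth.of_le (by exact_mod_cast le_top)).continuous_iteratedFDeriv' (m := a)).norm

theorem IsRadialTest.hInterNorm_ne_top {u : EuclideanSpace ℝ (Fin n) → ℂ} (hu : IsRadialTest u)
    {a b : ℝ} (ha : 0 ≤ a) (hb : 0 ≤ b) : hInterNorm a b u ≠ ⊤ :=
  RadialSchauder.hInterNorm_ne_top ha hb hu.toSchwartz

/-- The sum of the norms of the derivatives of orders between `l` and `k`. -/
noncomputable def highDerivSum (l k : ℕ) (u : EuclideanSpace ℝ (Fin n) → ℂ)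
    (x : EuclideanSpace ℝ (Fin n)) : ℝ := ∑ a ∈ Finset.Icc l k, ‖iteratedFDeriv ℝ a u x‖

/-- The weighted sum of the norms of the derivatives of order at most `m`, where the derivative of
order `a` is divided by the power `s - a` of the weight. -/
noncomputable def lowDerivSum (s : ℝ) (m : ℕ) (u : EuclideanSpace ℝ (Fin n) → ℂ)
    (x : EuclideanSpace ℝ (Fin n)) : ℝ :=
  ∑ a ∈ Finset.range (m + 1), weight x ^ (-(s - a)) * ‖iteratedFDeriv ℝ a u x‖

variable [NeZero n]

theorem exists_l2Bound_weight {s : ℝ} {k : ℕ} (hs : 2 * s < n) (hs0 : 0 ≤ s) {S : Finset ℕ}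
    (hS : ∀ a ∈ S, a ≤ k) :
    ∃ c : ℝ, 0 ≤ c ∧ ∀ u : EuclideanSpace ℝ (Fin n) → ℂ, IsRadialTest u →
      L2Bound volume (fun x => ∑ a ∈ S, weight x ^ (-max (s - a) 0) * ‖iteratedFDeriv ℝ a u x‖)
        (c * (hInterNorm s k u).toReal) := by
  have h : ∀ a, ∃ c : ℝ, 0 ≤ c ∧ (a ∈ S → ∀ u : EuclideanSpace ℝ (Fin n) → ℂ, IsRadialTest u →
      eLpNorm (fun x => weight x ^ (-max (s - a) 0) * ‖iteratedFDeriv ℝ a u x‖) 2 volume ≤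
        ENNReal.ofReal c * hInterNorm s k u) := by
    intro a
    by_cases ha : a ∈ S
    · obtain ⟨c, hc, h⟩ := exists_eLpNorm_weight_iteratedFDeriv_le (n := n) hs hs0 (hS a ha)
      exact ⟨c, hc, fun _ => h⟩
    · exact ⟨0, le_rfl, fun h => absurd h ha⟩
  choose c hc h using h
  refine ⟨∑ a ∈ S, c a, Finset.sum_nonneg fun a _ => hc a, fun u hu => ?_⟩
  rw [Finset.sum_mul]
  refine L2Bound.sum S fun a ha => ⟨?_, mul_nonneg (hc a) ENNReal.toReal_nonneg, ?_⟩
  · exact ((continuous_weight_rpow _).mul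
      (continuous_norm_iteratedFDeriv hu a)).aestronglyMeasurable
  · rw [ENNReal.ofReal_mul (hc a),
      ENNReal.ofReal_toReal (hu.hInterNorm_ne_top hs0 (Nat.cast_nonneg k))]
    exact h a ha u hu

/-- For orders at least `l ≥ s` the Hardy weight is trivial, so the derivatives themselves are in
L². -/
theorem exists_l2Bound_highDerivSum {s : ℝ} {l k : ℕ} (hs : 2 * s < n) (hs0 : 0 ≤ s)
    (hl : s ≤ l) :
    ∃ c : ℝ, 0 ≤ c ∧ ∀ u : EuclideanSpace ℝ (Fin n) → ℂ, IsRadialTest u →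
      L2Bound volume (highDerivSum l k u) (c * (hInterNorm s k u).toReal) := by
  obtain ⟨c, hc, h⟩ := exists_l2Bound_weight (n := n) (k := k) hs hs0 (S := Finset.Icc l k)
    fun a ha => (Finset.mem_Icc.1 ha).2
  refine ⟨c, hc, fun u hu => ?_⟩
  convert h u hu using 1
  ext x
  refine Finset.sum_congr rfl fun a ha => ?_
  have : (l : ℝ) ≤ a := by exact_mod_cast (Finset.mem_Icc.1 ha).1
  rw [max_eq_right (by linarith), neg_zero, Real.rpow_zero, one_mul]

theorem exists_l2Bound_lowDerivSum {s : ℝ} {m k : ℕ} (hs : 2 * s < n) (hs0 : 0 ≤ s)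
    (hm : m ≤ s) (hmk : m ≤ k) :
    ∃ c : ℝ, 0 ≤ c ∧ ∀ u : EuclideanSpace ℝ (Fin n) → ℂ, IsRadialTest u →
      L2Bound volume (lowDerivSum s m u) (c * (hInterNorm s k u).toReal) := by
  obtain ⟨c, hc, h⟩ := exists_l2Bound_weight (n := n) (k := k) hs hs0 (S := Finset.range (m + 1))
    fun a ha => (Nat.lt_succ_iff.1 (Finset.mem_range.1 ha)).trans hmk
  refine ⟨c, hc, fun u hu => ?_⟩
  convert h u hu using 1
  ext x
  refine Finset.sum_congr rfl fun a ha => ?_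
  have : (a : ℝ) ≤ m := by exact_mod_cast Nat.lt_succ_iff.1 (Finset.mem_range.1 ha)
  rw [max_eq_left (by linarith)]

/-- For `a ≤ k / 2` the hypothesis `n < k` yields `n + 2a < 2k`, the condition for the Sobolev
embedding at order `a`. Taking `c ≥ 1` makes its powers monotone later on. -/
theorem exists_forall_norm_iteratedFDeriv_le {s : ℝ} {k : ℕ} (hs : 2 * s < n) (hs0 : 0 ≤ s)
    (hk : n < k) :
    ∃ c : ℝ, 1 ≤ c ∧ ∀ u : EuclideanSpace ℝ (Fin n) → ℂ, IsRadialTest u → ∀ x, ∀ a ≤ k / 2,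
      ‖iteratedFDeriv ℝ a u x‖ ≤
        c * ((hInterNorm s k u).toReal * weight x ^ (1 - (n : ℝ) / 2 + max (s - a - 1) 0)) := by
  have hn := NeZero.pos n
  have h : ∀ a, ∃ c : ℝ, 0 ≤ c ∧ (a ≤ k / 2 → ∀ u : EuclideanSpace ℝ (Fin n) → ℂ,
      IsRadialTest u → ∀ x, ‖iteratedFDeriv ℝ a u x‖ ≤
        c * ((hInterNorm s k u).toReal * weight x ^ (1 - (n : ℝ) / 2 + max (s - a - 1) 0))) := by
    intro a
    by_cases ha : a ≤ k / 2
    · obtain ⟨c, hc, h⟩ := exists_norm_iteratedFDeriv_le (n := n) (k := k) (a := a) hs hs0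
        (by omega) (by omega)
      exact ⟨c, hc, fun _ => h⟩
    · exact ⟨0, le_rfl, fun h => absurd h ha⟩
  choose c hc h using h
  refine ⟨1 + ∑ a ∈ Finset.range (k / 2 + 1), c a,
    le_add_of_nonneg_right (Finset.sum_nonneg fun a _ => hc a), fun u hu x a ha => ?_⟩
  refine (h a ha u hu x).trans ?_
  have hw := weight_pos x
  gcongr
  have := Finset.single_le_sum (f := c) (fun a _ => hc a)
    (Finset.mem_range.2 (Nat.lt_succ_iff.2 ha))
  linarith

end TestFunctions

/-! ### Exponent bookkeeping for the decay rates -/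

section PointwiseDecay

theorem mul_rpow_le_mul_rpow_mul_pow {X e r t y : ℝ} {j : ℕ} (hX : 1 ≤ X) (hy : 0 ≤ y) (h : e ≤ r + t * j) :
    y * X ^ e ≤ y * X ^ r * (X ^ t) ^ j := by
  have hX0 : 0 < X := by linarith
  rw [← Real.rpow_mul_natCast hX0.le, mul_assoc, ← Real.rpow_add hX0]
  gcongr

theorem cast_eq_or_cast_eq_of_five_le {n m : ℕ} (hn : 5 ≤ n) (hm : m = n / 2 - 2) :
    (n : ℝ) = 2 * m + 4 ∧ 1 ≤ m ∨ (n : ℝ) = 2 * m + 5 := by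
  have : n = 2 * m + 4 ∧ 1 ≤ m ∨ n = 2 * m + 5 := by omega
  rcases this with h | h
  · exact Or.inl ⟨by exact_mod_cast h.1, h.2⟩
  · exact Or.inr (by exact_mod_cast h)

theorem excess_bounds {n : ℕ} {s : ℝ} (hn : 5 ≤ n) (hs₁ : (n : ℝ) / 2 - 1 < s)
    (hs₂ : s ≤ (n : ℝ) / 2 - 1 + 1 / (2 * ((n : ℝ) - 2))) :
    0 < 1 + s - n / 2 ∧ 1 + s - n / 2 ≤ 1 / 6 ∧ (1 + s - n / 2) * (n - 2) ≤ 1 / 2 := by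
  have hn' : (5 : ℝ) ≤ n := by exact_mod_cast hn
  have h : 1 + s - n / 2 ≤ 1 / (2 * ((n : ℝ) - 2)) := by linarith
  rw [le_div_iff₀ (by linarith)] at h
  refine ⟨by linarith, ?_, by linarith⟩
  nlinarith

variable {n k m : ℕ} {s X c N : ℝ} {d : ℕ → ℝ}

/-- The rate 1/2 per derivative is one that survives up to order `m + 1`: once the decay saturates
at `X ^ (1 - n/2)`, it requires `a / 2 ≤ s - 1`. For orders up to `k / 2` a single factor `X ^
(-1/2)` is claimed, which needs `s ≥ 3/2` and hence uses `n ≥ 5`. Orders from `m + 2` on are put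
into the remainder. -/
theorem derivBound_of_decay (hn : 5 ≤ n) (hm : m = n / 2 - 2) (hk : n < k)
    (hs₁ : (n : ℝ) / 2 - 1 < s) (hX : 1 ≤ X) (hc : 0 ≤ c) (hN : 0 ≤ N)
    (hd0 : ∀ a, 0 ≤ d a)
    (hd : ∀ a ≤ k / 2, d a ≤ c * (N * X ^ (1 - (n : ℝ) / 2 + max (s - a - 1) 0))) :
    DerivBound k (k / 2) (X ^ (-(1 / 2) : ℝ)) (c * N * X ^ (s - n / 2))
      (∑ a ∈ Finset.Icc (m + 2) k, d a) d := by
  have hn' : (5 : ℝ) ≤ n := by exact_mod_cast hn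
  have hX0 : 0 < X := by linarith
  have hcN : 0 ≤ c * N := by positivity
  refine ⟨fun a ha => (hd a ha).trans ?_, fun a ha => ?_⟩
  · rw [← mul_assoc]
    refine mul_rpow_le_mul_rpow_mul_pow hX hcN ?_
    rcases Nat.eq_zero_or_pos a with rfl | h
    · rw [max_eq_left (by push_cast; linarith)]
      simp
    · have h1 : (1 : ℝ) ≤ a := by exact_mod_cast h
      rw [min_eq_right h]
      rcases max_choice (s - a - 1) 0 with h2 | h2 <;> rw [h2] <;> push_cast <;> linarith
  · rcases Nat.lt_or_ge a (m + 2) with h | h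
    · refine le_add_of_le_of_nonneg ((hd a (by omega)).trans ?_)
        (Finset.sum_nonneg fun a _ => hd0 a)
      rw [← mul_assoc]
      refine mul_rpow_le_mul_rpow_mul_pow hX hcN ?_
      have h1 : (a : ℝ) ≤ m + 1 := by exact_mod_cast Nat.lt_succ_iff.1 h
      have h0 : (0 : ℝ) ≤ a := Nat.cast_nonneg a
      rcases max_choice (s - a - 1) 0 with h2 | h2 <;> rw [h2]
      · linarith
      -- With `a ≤ m + 1` the claim follows from `(m + 1) / 2 ≤ s - 1`. For even `n` one has `s - 1
      -- > m` and needs `m ≥ 1`, that is `n ≥ 6`; for odd `n` one has `s - 1 > m + 1/2`.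
      · rcases cast_eq_or_cast_eq_of_five_le hn hm with ⟨h3, h4⟩ | h3
        · have : (1 : ℝ) ≤ m := by exact_mod_cast h4
          linarith
        · have : (0 : ℝ) ≤ m := Nat.cast_nonneg m
          linarith
    · exact le_add_of_nonneg_of_le (by positivity)
        (Finset.single_le_sum (fun a _ => hd0 a) (Finset.mem_Icc.2 ⟨h, ha⟩))

/-- Up to order `m ≤ s - 1` the decay has not saturated, so every derivative gains a full factor `1
/ X` and no remainder is needed. -/
theorem derivBound_low_of_decay (hn : 5 ≤ n) (hm : m = n / 2 - 2) (hk : n < k)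
    (hs₁ : (n : ℝ) / 2 - 1 < s) (hX : 1 ≤ X) (hc : 0 ≤ c) (hN : 0 ≤ N)
    (hd : ∀ a ≤ k / 2, d a ≤ c * (N * X ^ (1 - (n : ℝ) / 2 + max (s - a - 1) 0))) :
    DerivBound m m (X ^ (-1 : ℝ)) (c * N * X ^ (s - n / 2)) 0 d := by
  have hcN : 0 ≤ c * N := by positivity
  have key : ∀ a ≤ m, ∀ j ≤ a, d a ≤ c * N * X ^ (s - n / 2) * (X ^ (-1 : ℝ)) ^ j := by
    intro a ha j hj
    refine (hd a (by omega)).trans ?_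
    rw [← mul_assoc]
    refine mul_rpow_le_mul_rpow_mul_pow hX hcN ?_
    have h1 : (a : ℝ) ≤ m := by exact_mod_cast ha
    have h2 : (j : ℝ) ≤ a := by exact_mod_cast hj
    rw [max_eq_left]
    · linarith
    · rcases cast_eq_or_cast_eq_of_five_le hn hm with ⟨h3, -⟩ | h3 <;> linarith
  exact ⟨fun a ha => key a ha _ (min_le_left _ _),
    fun a ha => (key a ha a le_rfl).trans_eq (add_zero _).symm⟩

/-- The L² counterpart of the decay bound: the weighted sum plays the role of the amplitude, at the
cost of `X ^ s`, and keeps the full gain `1 / X` per derivative. -/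
theorem derivBound_of_weighted_sum (hX : 1 ≤ X) (hd0 : ∀ a, 0 ≤ d a) :
    DerivBound m m (X ^ (-1 : ℝ))
      ((∑ a ∈ Finset.range (m + 1), X ^ (-(s - a)) * d a) * X ^ s) 0 d := by
  have hX0 : 0 < X := by linarith
  have h0 : ∀ a : ℕ, 0 ≤ X ^ (-(s - a)) * d a := fun a => mul_nonneg (by positivity) (hd0 a)
  have key : ∀ a ≤ m, ∀ j ≤ a, d a ≤
      (∑ a ∈ Finset.range (m + 1), X ^ (-(s - a)) * d a) * X ^ s * (X ^ (-1 : ℝ)) ^ j := by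
    intro a ha j hj
    have h2 : (j : ℝ) ≤ a := by exact_mod_cast hj
    calc d a = X ^ (-(s - a)) * d a * X ^ (s - a) := by
          rw [mul_right_comm, ← Real.rpow_add hX0, neg_add_cancel, Real.rpow_zero, one_mul]
      _ ≤ (∑ a ∈ Finset.range (m + 1), X ^ (-(s - a)) * d a) * X ^ (s - a) := by
          gcongr
          exact Finset.single_le_sum (fun a _ => h0 a)
            (Finset.mem_range.2 (Nat.lt_succ_iff.2 ha))
      _ ≤ _ := mul_rpow_le_mul_rpow_mul_pow hX (Finset.sum_nonneg fun a _ => h0 a) (by linarith)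
  exact ⟨fun a ha => key a ha _ (min_le_left _ _),
    fun a ha => (key a ha a le_rfl).trans_eq (add_zero _).symm⟩

/-- The decay of the argument of the nonlinearity. -/
theorem weight_sq_mul_decay_le {M t δ : ℝ} {l : ℕ} (hl : l ≤ k) (hδ : δ = 1 + s - n / 2)
    (hδ0 : 0 ≤ δ) (hX : 1 ≤ X) {j : ℕ} (hj : 1 ≤ j) :
    8 ^ l * (X ^ 2 * (c * M * X ^ (s - n / 2)) ^ 2) * (X ^ t) ^ j ≤
      8 ^ k * c ^ 2 * M ^ 2 * (X ^ (t + 2 * δ)) ^ j := by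
  have hX0 : 0 < X := by linarith
  have hj' : (1 : ℝ) ≤ j := by exact_mod_cast hj
  -- Since `s - n / 2 = δ - 1`, the function `|x|² v²` has size `X ^ (2δ)`. As `j ≥ 1`, this loss
  -- fits into `j` copies of `X ^ (2δ)`, whence the weakened rate `t + 2δ`.
  have e : X ^ 2 * (X ^ (s - n / 2)) ^ 2 * (X ^ t) ^ j = X ^ (2 * δ + t * j) := by
    rw [← Real.rpow_mul_natCast hX0.le, ← Real.rpow_mul_natCast hX0.le,
      ← Real.rpow_natCast X 2, ← Real.rpow_add hX0, ← Real.rpow_add hX0, hδ]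
    congr 1
    push_cast
    ring
  calc 8 ^ l * (X ^ 2 * (c * M * X ^ (s - n / 2)) ^ 2) * (X ^ t) ^ j
      = 8 ^ l * (c ^ 2 * M ^ 2) * X ^ (2 * δ + t * j) := by rw [← e]; ring
    _ ≤ 8 ^ k * (c ^ 2 * M ^ 2) * X ^ ((t + 2 * δ) * j) := by
        gcongr
        · norm_num
        · nlinarith
    _ = _ := by rw [Real.rpow_mul_natCast hX0.le]; ring

end PointwiseDecay

/-! ### L² majorants for the derivatives of orders `n / 2 - 2` and `k` -/

section SquareIntegrableMajorants

theorem L2Bound.mono {α : Type*} [MeasurableSpace α] {μ : Measure α} {f : α → ℝ} {L L' : ℝ}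
    (hf : L2Bound μ f L) (h : L ≤ L') : L2Bound μ f L' :=
  ⟨hf.meas, hf.nonneg.trans h, hf.le.trans (ENNReal.ofReal_le_ofReal h)⟩

theorem l2Bound_weight_rpow {n : ℕ} {p : ℝ} (hp : (n : ℝ) < 2 * p) :
    L2Bound volume (fun x : EuclideanSpace ℝ (Fin n) => weight x ^ (-p))
      (eLpNorm (fun x : EuclideanSpace ℝ (Fin n) => weight x ^ (-p)) 2 volume).toReal :=
  ⟨(continuous_weight_rpow _).aestronglyMeasurable, ENNReal.toReal_nonneg,
    (ENNReal.ofReal_toReal (eLpNorm_weight_rpow_lt_top hp).ne).ge⟩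

theorem norm_le_weight {n : ℕ} (x : EuclideanSpace ℝ (Fin n)) : ‖x‖ ≤ weight x := le_max_right _ _

theorem IsRadialTest.ofReal {n : ℕ} {v : EuclideanSpace ℝ (Fin n) → ℝ} (hv : IsRadialTest v) :
    IsRadialTest fun x => (v x : ℂ) :=
  ⟨Complex.ofRealCLM.contDiff.comp hv.smooth,
    hv.compactSupport.comp_left (g := ((↑) : ℝ → ℂ)) Complex.ofReal_zero,
    fun x y h => congrArg _ (hv.radial x y h)⟩

theorem one_add_mul_sq_pow_le {b M : ℝ} (hb : 1 ≤ b) (k : ℕ) :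
    (1 + b * M ^ 2) ^ k ≤ b ^ k * (1 + M ^ 2) ^ k := by
  rw [← mul_pow]
  gcongr
  nlinarith

variable {n : ℕ} {s : ℝ} {k : ℕ} {F : ℝ → ℂ}

theorem exists_l2Bound_low (hn : 5 ≤ n) (hF : EvenBounded F) (hs₁ : (n : ℝ) / 2 - 1 < s)
    (hs₂ : s ≤ (n : ℝ) / 2 - 1 + 1 / (2 * ((n : ℝ) - 2))) (hk : n < k) :
    ∃ C : ℝ, 0 ≤ C ∧ ∀ (u : Fin 3 → EuclideanSpace ℝ (Fin n) → ℂ)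
      (v : EuclideanSpace ℝ (Fin n) → ℝ), (∀ i, IsRadialTest (u i)) → IsRadialTest v →
      ∃ g, L2Bound volume g (C * ((∏ i, (hInterNorm s k (u i)).toReal) *
        (1 + (hInterNorm s k fun x => (v x : ℂ)).toReal ^ 2) ^ k)) ∧ ∀ x,
        ‖iteratedFDeriv ℝ (n / 2 - 2) (fun y => u 0 y * u 1 y * u 2 y * F (‖y‖ * v y)) x‖ ≤
          g x := by
  have : NeZero n := ⟨by omega⟩
  obtain ⟨m, hm⟩ : ∃ m, m = n / 2 - 2 := ⟨_, rfl⟩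
  obtain ⟨δ, hδ⟩ : ∃ δ, δ = 1 + s - n / 2 := ⟨_, rfl⟩
  obtain ⟨hδ0, hδ1, hδ2⟩ := excess_bounds hn hs₁ hs₂
  rw [← hδ] at hδ0 hδ1 hδ2
  have hn' : (5 : ℝ) ≤ n := by exact_mod_cast hn
  have hs0 : 0 ≤ s := by linarith
  have hs : 2 * s < n := by linarith
  have hms : (m : ℝ) ≤ s := by
    rcases cast_eq_or_cast_eq_of_five_le hn hm with ⟨h, -⟩ | h <;> linarith
  obtain ⟨c, hc1, hc⟩ := exists_forall_norm_iteratedFDeriv_le (n := n) hs hs0 hk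
  obtain ⟨D, hD0, hD⟩ := exists_l2Bound_lowDerivSum (n := n) (k := k) hs hs0 hms (by omega)
  -- All orders up to `m` count as low, so every remainder is 0.
  obtain ⟨B, hB0, hB⟩ := exists_derivBound_nonlinearity (E := EuclideanSpace ℝ (Fin n))
    (k := m) (K := m) (by omega) le_rfl hF
  rw [← hm]
  refine ⟨B * c ^ 2 * (8 ^ k * c ^ 2) ^ k * D, by positivity, fun u v hu hv => ?_⟩
  obtain ⟨N, hN⟩ : ∃ N : Fin 3 → ℝ, N = fun i => (hInterNorm s k (u i)).toReal := ⟨_, rfl⟩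
  obtain ⟨M, hM⟩ : ∃ M : ℝ, M = (hInterNorm s k fun x => (v x : ℂ)).toReal := ⟨_, rfl⟩
  have hN0 : ∀ i, 0 ≤ N i := fun i => by rw [hN]; exact ENNReal.toReal_nonneg
  have hM0 : 0 ≤ M := by rw [hM]; exact ENNReal.toReal_nonneg
  have hN0' := hN0 0
  have hN1' := hN0 1
  have hN2' := hN0 2
  have hA := one_add_mul_sq_pow_le (M := M) (one_le_mul_of_one_le_of_one_le
    (one_le_pow₀ (by norm_num : (1 : ℝ) ≤ 8) (n := k)) (one_le_pow₀ hc1 (n := 2))) k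
  have hL := (hD (u 0) (hu 0)).const_mul
    (c := B * c ^ 2 * (N 1 * N 2) * (1 + 8 ^ k * c ^ 2 * M ^ 2) ^ k) (by positivity)
  refine ⟨_, hL.mono ?_, fun x => ?_⟩
  · rw [← hM, Fin.prod_univ_three]
    rw [← congrFun hN 0, ← congrFun hN 1, ← congrFun hN 2]
    calc _ ≤ B * c ^ 2 * (N 1 * N 2) * ((8 ^ k * c ^ 2) ^ k * (1 + M ^ 2) ^ k) * (D * N 0) := by
          gcongr
      _ = _ := by ring
  · have hX := one_le_weight x
    have hX0 := weight_pos x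
    have hw : 0 ≤ lowDerivSum s m (u 0) x := Finset.sum_nonneg fun a _ => by positivity
    have hu' : ∀ i, DerivBound m m (weight x ^ (-1 : ℝ)) (c * N i * weight x ^ (s - n / 2)) 0
        fun j => ‖iteratedFDeriv ℝ j (u i) x‖ := fun i =>
      derivBound_low_of_decay hn hm hk hs₁ hX (by linarith) (hN0 i) (by
        rw [hN]; exact hc (u i) (hu i) x)
    have h0 : DerivBound m m (weight x ^ (-1 : ℝ)) (lowDerivSum s m (u 0) x * weight x ^ s) 0
        fun j => ‖iteratedFDeriv ℝ j (u 0) x‖ :=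
      derivBound_of_weighted_sum hX fun _ => norm_nonneg _
    have hv' : DerivBound m m (weight x ^ (-1 : ℝ)) (c * M * weight x ^ (s - n / 2)) 0
        fun j => ‖iteratedFDeriv ℝ j (fun y => (v y : ℂ)) x‖ :=
      derivBound_low_of_decay hn hm hk hs₁ hX (by linarith) hM0 (by
        rw [hM]; exact hc _ hv.ofReal x)
    -- The amplitude of `u 0` is its weighted L² sum; those of `u 1`, `u 2` and `v` are pointwise
    -- decay bounds. The rate drops from `-1` to `-1 + 2δ` because of the argument of `F`.
    have h := (hB u v (fun i => (hu i).smooth) hv.smooth x (weight x) (weight x ^ (-1 : ℝ))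
      (weight x ^ (-1 + 2 * δ)) (8 ^ k * c ^ 2 * M ^ 2) 0
      ![lowDerivSum s m (u 0) x * weight x ^ s, c * N 1 * weight x ^ (s - n / 2),
        c * N 2 * weight x ^ (s - n / 2)] 0 (c * M * weight x ^ (s - n / 2)) 0
      (norm_le_weight x) (by positivity)
      (Real.rpow_le_rpow_of_exponent_le hX (by linarith))
      (Real.rpow_le_one_of_one_le_of_nonpos hX (by linarith))
      (by rw [Real.rpow_neg_one, mul_inv_cancel₀ hX0.ne'])
      (by positivity) le_rfl
      (by
        intro i
        fin_cases i
        · exact mul_nonneg hw (by positivity)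
        · change 0 ≤ c * N 1 * weight x ^ (s - n / 2); positivity
        · change 0 ≤ c * N 2 * weight x ^ (s - n / 2); positivity)
      (fun _ => le_rfl) (by positivity) le_rfl
      (by
        intro i
        fin_cases i
        · exact h0
        · exact hu' 1
        · exact hu' 2)
      hv' (fun j hj => weight_sq_mul_decay_le (by omega) hδ hδ0.le hX hj)
      (by simp)).all m le_rfl
    refine h.trans ?_
    simp only [Matrix.cons_val, Pi.zero_apply, zero_mul, mul_zero, add_zero]
    -- The total exponent is `-1 + (n - 1) δ` for even `n` and `-1/2 + (n - 2) δ` for odd `n`. In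
    -- the odd case it vanishes at the largest admissible `s`.
    have he : weight x ^ s * weight x ^ (s - n / 2) * weight x ^ (s - n / 2) *
        (weight x ^ (-1 + 2 * δ)) ^ m ≤ 1 := by
      rw [← Real.rpow_mul_natCast hX0.le, ← Real.rpow_add hX0, ← Real.rpow_add hX0,
        ← Real.rpow_add hX0]
      refine Real.rpow_le_one_of_one_le_of_nonpos hX ?_
      have hs' : s = δ - 1 + n / 2 := by linarith
      rw [hs']
      rcases cast_eq_or_cast_eq_of_five_le hn hm with ⟨h, -⟩ | h <;> rw [h] at hδ2 ⊢ <;> nlinarith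
    calc _ = B * c ^ 2 * (N 1 * N 2) * (1 + 8 ^ k * c ^ 2 * M ^ 2) ^ m *
          (lowDerivSum s m (u 0) x * (weight x ^ s * weight x ^ (s - n / 2) *
            weight x ^ (s - n / 2) * (weight x ^ (-1 + 2 * δ)) ^ m)) := by ring
      _ ≤ B * c ^ 2 * (N 1 * N 2) * (1 + 8 ^ k * c ^ 2 * M ^ 2) ^ k *
          (lowDerivSum s m (u 0) x * 1) := by
          gcongr
          · exact le_add_of_nonneg_right (by positivity)
          · omega
      _ = _ := by rw [mul_one]

theorem exists_l2Bound_high (hn : 5 ≤ n) (hF : EvenBounded F) (hs₁ : (n : ℝ) / 2 - 1 < s)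
    (hs₂ : s ≤ (n : ℝ) / 2 - 1 + 1 / (2 * ((n : ℝ) - 2))) (hk : n < k) :
    ∃ C : ℝ, 0 ≤ C ∧ ∀ (u : Fin 3 → EuclideanSpace ℝ (Fin n) → ℂ)
      (v : EuclideanSpace ℝ (Fin n) → ℝ), (∀ i, IsRadialTest (u i)) → IsRadialTest v →
      ∃ g, L2Bound volume g (C * ((∏ i, (hInterNorm s k (u i)).toReal) *
        (1 + (hInterNorm s k fun x => (v x : ℂ)).toReal ^ 2) ^ k)) ∧ ∀ x,
        ‖iteratedFDeriv ℝ k (fun y => u 0 y * u 1 y * u 2 y * F (‖y‖ * v y)) x‖ ≤ g x := by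
  have : NeZero n := ⟨by omega⟩
  obtain ⟨m, hm⟩ : ∃ m, m = n / 2 - 2 := ⟨_, rfl⟩
  obtain ⟨δ, hδ⟩ : ∃ δ, δ = 1 + s - n / 2 := ⟨_, rfl⟩
  obtain ⟨hδ0, hδ1, hδ2⟩ := excess_bounds hn hs₁ hs₂
  rw [← hδ] at hδ0 hδ1 hδ2
  have hn' : (5 : ℝ) ≤ n := by exact_mod_cast hn
  have hs0 : 0 ≤ s := by linarith
  have hs : 2 * s < n := by linarith
  have hms : s ≤ (m + 2 : ℕ) := by
    push_cast
    rcases cast_eq_or_cast_eq_of_five_le hn hm with ⟨h, -⟩ | h <;> linarith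
  obtain ⟨c, hc1, hc⟩ := exists_forall_norm_iteratedFDeriv_le (n := n) hs hs0 hk
  obtain ⟨D, hD0, hD⟩ := exists_l2Bound_highDerivSum (n := n) (k := k) hs hs0 hms
  obtain ⟨B, hB0, hB⟩ := exists_derivBound_nonlinearity (E := EuclideanSpace ℝ (Fin n))
    (k := k) (K := k / 2) (by omega) (by omega) hF
  -- The decay of the remainder-free term: three amplitudes `X ^ (δ - 1)` and `k` derivatives at
  -- rate `-1/2 + 2δ`. It is square integrable because `k ≥ n + 1`, `n δ ≤ 1/2 + 2δ` and `δ ≤ 1/6`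
  -- give `2p > n`.
  obtain ⟨p, hp⟩ : ∃ p : ℝ, p = 3 * (1 - δ) + (1 / 2 - 2 * δ) * k := ⟨_, rfl⟩
  have hpn : (n : ℝ) < 2 * p := by
    have hk' : (n : ℝ) + 1 ≤ k := by exact_mod_cast hk
    rw [hp]
    nlinarith
  have hW := l2Bound_weight_rpow (n := n) hpn
  obtain ⟨W, hWdef⟩ : ∃ W : ℝ, W =
    (eLpNorm (fun x : EuclideanSpace ℝ (Fin n) => weight x ^ (-p)) 2 volume).toReal := ⟨_, rfl⟩
  rw [← hWdef] at hW
  have hW0 := hW.nonneg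
  refine ⟨B * (8 ^ k * c ^ 2) ^ k * (c ^ 3 * W + 3 * c ^ 2 * D + 2 * 8 ^ k * c ^ 4 * D),
    by positivity, fun u v hu hv => ?_⟩
  obtain ⟨N, hN⟩ : ∃ N : Fin 3 → ℝ, N = fun i => (hInterNorm s k (u i)).toReal := ⟨_, rfl⟩
  obtain ⟨M, hM⟩ : ∃ M : ℝ, M = (hInterNorm s k fun x => (v x : ℂ)).toReal := ⟨_, rfl⟩
  have hN0 : ∀ i, 0 ≤ N i := fun i => by rw [hN]; exact ENNReal.toReal_nonneg
  have hM0 : 0 ≤ M := by rw [hM]; exact ENNReal.toReal_nonneg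
  have hN0' := hN0 0
  have hN1' := hN0 1
  have hN2' := hN0 2
  have hb : 1 ≤ 8 ^ k * c ^ 2 := one_le_mul_of_one_le_of_one_le
    (one_le_pow₀ (by norm_num : (1 : ℝ) ≤ 8) (n := k)) (one_le_pow₀ hc1 (n := 2))
  have hA := one_add_mul_sq_pow_le (M := M) hb k
  obtain ⟨A, hAdef⟩ : ∃ A : ℝ, A = 8 ^ k * c ^ 2 * M ^ 2 := ⟨_, rfl⟩
  rw [← hAdef] at hA
  have hA0 : 0 ≤ A := by rw [hAdef]; positivity
  have hMA : M ^ 2 ≤ 1 + A := by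
    rw [hAdef]
    nlinarith [sq_nonneg M]
  have hDu : ∀ i, L2Bound volume (highDerivSum (m + 2) k (u i)) (D * N i) := fun i => by
    rw [hN]; exact hD (u i) (hu i)
  have hDv : L2Bound volume (highDerivSum (m + 2) k fun x => (v x : ℂ)) (D * M) := by
    rw [hM]; exact hD _ hv.ofReal
  -- The majorant sums the remainder-free term, one term per `u i` carrying its remainder, and one
  -- carrying the remainder of `v`. In the last, `M / (1 + A)` compensates the additional `M` from
  -- the L² norm of the remainder, since `M² ≤ 1 + A`; thus the power `k` of `1 + M²` is not
  -- exceeded.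
  have hL := ((((hW.const_mul (c := c ^ 3 * (N 0 * N 1 * N 2)) (by positivity)).add
    ((((hDu 0).const_mul (c := N 1 * N 2) (by positivity)).add
      ((hDu 1).const_mul (c := N 0 * N 2) (by positivity))).add
      ((hDu 2).const_mul (c := N 0 * N 1) (by positivity)) |>.const_mul (c := c ^ 2)
        (by positivity))).add
    (hDv.const_mul (c := 2 * 8 ^ k * c ^ 4 * (N 0 * N 1 * N 2) * (M / (1 + A)))
      (by positivity)))).const_mul (c := B * (1 + A) ^ k) (by positivity)
  refine ⟨_, hL.mono ?_, fun x => ?_⟩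
  · rw [← hM, Fin.prod_univ_three, ← congrFun hN 0, ← congrFun hN 1, ← congrFun hN 2]
    have hq : M / (1 + A) * M ≤ 1 := by
      rw [div_mul_eq_mul_div, div_le_one (by positivity)]
      linarith
    calc _ = B * (1 + A) ^ k * ((N 0 * N 1 * N 2) * (c ^ 3 * W + 3 * c ^ 2 * D +
          2 * 8 ^ k * c ^ 4 * D * (M / (1 + A) * M))) := by ring
      _ ≤ B * ((8 ^ k * c ^ 2) ^ k * (1 + M ^ 2) ^ k) * ((N 0 * N 1 * N 2) *
          (c ^ 3 * W + 3 * c ^ 2 * D + 2 * 8 ^ k * c ^ 4 * D * 1)) := by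
          gcongr
      _ = _ := by ring
  · have hX := one_le_weight x
    have hX0 := weight_pos x
    have hE : ∀ w : EuclideanSpace ℝ (Fin n) → ℂ, 0 ≤ highDerivSum (m + 2) k w x :=
      fun w => Finset.sum_nonneg fun a _ => norm_nonneg _
    have hE0 := hE (u 0)
    have hE1 := hE (u 1)
    have hE2 := hE (u 2)
    have hEv := hE fun y => (v y : ℂ)
    have hu' : ∀ i, DerivBound k (k / 2) (weight x ^ (-(1 / 2) : ℝ))
        (c * N i * weight x ^ (s - n / 2)) (highDerivSum (m + 2) k (u i) x)
        fun j => ‖iteratedFDeriv ℝ j (u i) x‖ := fun i =>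
      derivBound_of_decay hn hm hk hs₁ hX (by linarith) (hN0 i) (fun _ => norm_nonneg _) (by
        rw [hN]; exact hc (u i) (hu i) x)
    have hv' : DerivBound k (k / 2) (weight x ^ (-(1 / 2) : ℝ)) (c * M * weight x ^ (s - n / 2))
        (highDerivSum (m + 2) k (fun y => (v y : ℂ)) x)
        fun j => ‖iteratedFDeriv ℝ j (fun y => (v y : ℂ)) x‖ :=
      derivBound_of_decay hn hm hk hs₁ hX (by linarith) hM0 (fun _ => norm_nonneg _) (by
        rw [hM]; exact hc _ hv.ofReal x)
    -- `β` is the remainder of `|x|² v²` divided by `1 + A`, so that the hypothesis on `(1 + A) * β`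
    -- holds with equality.
    have h := (hB u v (fun i => (hu i).smooth) hv.smooth x (weight x) (weight x ^ (-(1 / 2) : ℝ))
      (weight x ^ (-(1 / 2) + 2 * δ)) A
      (2 * 8 ^ k * (weight x ^ 2 * (c * M * weight x ^ (s - n / 2) *
        highDerivSum (m + 2) k (fun y => (v y : ℂ)) x)) / (1 + A))
      (fun i => c * N i * weight x ^ (s - n / 2)) (fun i => highDerivSum (m + 2) k (u i) x)
      (c * M * weight x ^ (s - n / 2)) (highDerivSum (m + 2) k (fun y => (v y : ℂ)) x)
      (norm_le_weight x) (by positivity)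
      (Real.rpow_le_rpow_of_exponent_le hX (by linarith))
      (Real.rpow_le_one_of_one_le_of_nonpos hX (by linarith))
      (by
        nth_rewrite 1 [← Real.rpow_one (weight x)]
        rw [← Real.rpow_add hX0]
        exact Real.one_le_rpow hX (by norm_num))
      hA0 (by positivity) (fun i => by have := hN0 i; positivity) (fun i => hE (u i))
      (by positivity) hEv hu' hv'
      (fun j hj => by rw [hAdef]; exact weight_sq_mul_decay_le le_rfl hδ hδ0.le hX hj)
      (by rw [mul_div_cancel₀ _ (by positivity)])).all k le_rfl
    refine h.trans ?_
    obtain ⟨r, hr⟩ : ∃ r, r = weight x ^ (s - n / 2) := ⟨_, rfl⟩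
    have hr0 : 0 ≤ r := by rw [hr]; positivity
    have hr1 : r ^ 2 ≤ 1 := by
      rw [hr]
      exact pow_le_one₀ (by positivity) (Real.rpow_le_one_of_one_le_of_nonpos hX (by linarith))
    -- Four amplitudes, of the three `u i` and of one `v`, against the factor `|x|²`: the exponent
    -- is `4δ - 2 < 0`.
    have hr4 : weight x ^ 2 * r ^ 4 ≤ 1 := by
      rw [hr, ← Real.rpow_mul_natCast hX0.le, ← Real.rpow_natCast (weight x) 2,
        ← Real.rpow_add hX0]
      refine Real.rpow_le_one_of_one_le_of_nonpos hX ?_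
      push_cast
      linarith
    have hrp : r ^ 3 * (weight x ^ (-(1 / 2) + 2 * δ)) ^ k = weight x ^ (-p) := by
      rw [hr, ← Real.rpow_mul_natCast hX0.le, ← Real.rpow_mul_natCast hX0.le,
        ← Real.rpow_add hX0, hp, hδ]
      congr 1
      push_cast
      ring
    rw [← hr, ← hrp]
    have h1A : 1 + A ≠ 0 := by positivity
    calc _ = B * (1 + A) ^ k * (c ^ 3 * (N 0 * N 1 * N 2) *
          (r ^ 3 * (weight x ^ (-(1 / 2) + 2 * δ)) ^ k) +
          c ^ 2 * (N 1 * N 2 * highDerivSum (m + 2) k (u 0) x +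
            N 0 * N 2 * highDerivSum (m + 2) k (u 1) x +
            N 0 * N 1 * highDerivSum (m + 2) k (u 2) x) * r ^ 2 +
          2 * 8 ^ k * c ^ 4 * (N 0 * N 1 * N 2) * (M / (1 + A)) *
            highDerivSum (m + 2) k (fun y => (v y : ℂ)) x * (weight x ^ 2 * r ^ 4)) := by
          ring
      _ ≤ B * (1 + A) ^ k * (c ^ 3 * (N 0 * N 1 * N 2) *
          (r ^ 3 * (weight x ^ (-(1 / 2) + 2 * δ)) ^ k) +
          c ^ 2 * (N 1 * N 2 * highDerivSum (m + 2) k (u 0) x +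
            N 0 * N 2 * highDerivSum (m + 2) k (u 1) x +
            N 0 * N 1 * highDerivSum (m + 2) k (u 2) x) * 1 +
          2 * 8 ^ k * c ^ 4 * (N 0 * N 1 * N 2) * (M / (1 + A)) *
            highDerivSum (m + 2) k (fun y => (v y : ℂ)) x * 1) := by
          gcongr
      _ = _ := by ring

end SquareIntegrableMajorants

/-! ### Assembly: membership in the test class and passage back to Sobolev norms -/

variable {n : ℕ}

theorem isRadialTest_nonlinearity {F : ℝ → ℂ} (hF : EvenBounded F)
    {u : Fin 3 → EuclideanSpace ℝ (Fin n) → ℂ} {v : EuclideanSpace ℝ (Fin n) → ℝ}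
    (hu : ∀ i, IsRadialTest (u i)) (hv : IsRadialTest v) :
    IsRadialTest fun x => u 0 x * u 1 x * u 2 x * F (‖x‖ * v x) where
  smooth := ((((hu 0).smooth.mul (hu 1).smooth).mul (hu 2).smooth).mul
    (hF.contDiff_apply_norm_mul hv.smooth))
  compactSupport := (((hu 0).compactSupport.mul_right (f' := u 1)).mul_right (f' := u 2)).mul_right
    (f' := fun x => F (‖x‖ * v x))
  radial x y h := by
    rw [(hu 0).radial x y h, (hu 1).radial x y h, (hu 2).radial x y h, hv.radial x y h, h]

/-- An intersection norm is controlled by the `L²` norms of the derivatives of two integer orders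
that enclose the orders of the norm. -/
theorem exists_hInterNorm_le [NeZero n] {m k : ℕ} {t : ℝ} (hmt : m ≤ t) (htk : t ≤ k) :
    ∃ C : ℝ, 0 ≤ C ∧ ∀ f : EuclideanSpace ℝ (Fin n) → ℂ, IsRadialTest f → ∀ b : ℝ≥0∞,
      ∫⁻ x, ‖iteratedFDeriv ℝ m f x‖ₑ ^ 2 ≤ b ^ 2 →
      ∫⁻ x, ‖iteratedFDeriv ℝ k f x‖ₑ ^ 2 ≤ b ^ 2 →
      hInterNorm t k f ≤ ENNReal.ofReal C * b := by
  obtain ⟨C₁, hC₁, h₁⟩ := exists_energy_le_lintegral_iteratedFDeriv n m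
  obtain ⟨C₂, hC₂, h₂⟩ := exists_energy_le_lintegral_iteratedFDeriv n k
  have hC : ENNReal.ofReal ((2 * Real.pi) ^ (2 * t)) * (C₁ + C₂) +
      ENNReal.ofReal ((2 * Real.pi) ^ (2 * (k : ℝ))) * C₂ ≠ ⊤ := by finiteness
  refine ⟨_, Real.sqrt_nonneg _, fun f hf b hm hk => le_ofReal_sqrt_mul hC ?_⟩
  have e₁ := (h₁ hf.toSchwartz).trans (mul_le_mul_right hm C₁)
  have e₂ := (h₂ hf.toSchwartz).trans (mul_le_mul_right hk C₂)
  have e₃ := energy_le_add hf.toSchwartz (Nat.cast_nonneg m) hmt htk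
  rw [hInterNorm_sq, ← hf.coe_toSchwartz, hNorm_sq, hNorm_sq]
  calc _ ≤ ENNReal.ofReal ((2 * Real.pi) ^ (2 * t)) * (C₁ * b ^ 2 + C₂ * b ^ 2) +
        ENNReal.ofReal ((2 * Real.pi) ^ (2 * (k : ℝ))) * (C₂ * b ^ 2) := by
        gcongr
        exact e₃.trans (add_le_add e₁ e₂)
    _ = _ := by ring

theorem one_add_pow_le_sum {M : ℝ} (k : ℕ) :
    (1 + M ^ 2) ^ k ≤ 2 ^ k * ∑ j ∈ Finset.range (k + 1), M ^ (2 * j) := by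
  rw [add_comm, add_pow, Finset.mul_sum]
  refine Finset.sum_le_sum fun j _ => ?_
  rw [one_pow, mul_one, ← pow_mul, mul_comm]
  have : (k.choose j : ℝ) ≤ 2 ^ k := by exact_mod_cast Nat.choose_le_two_pow k j
  have h : 0 ≤ M ^ (2 * j) := (even_two_mul j).pow_nonneg M
  gcongr

end RadialSchauder

open RadialSchauder

theorem propositionA1 (n : ℕ) (hn : 5 ≤ n)
    (F : ℝ → ℂ) (hF : ContDiff ℝ ∞ F) (hFeven : Function.Even F)
    (hFbdd : ∀ l : ℕ, ∃ M : ℝ, ∀ x : ℝ, ‖iteratedDeriv l F x‖ ≤ M)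
    (s : ℝ) (hs₁ : (n : ℝ) / 2 - 1 < s)
    (hs₂ : s ≤ (n : ℝ) / 2 - 1 + 1 / (2 * ((n : ℝ) - 2)))
    (k : ℕ) (hk : n < k) :
    ∃ C : ℝ, 0 < C ∧
      ∀ (u : Fin 3 → EuclideanSpace ℝ (Fin n) → ℂ) (v : EuclideanSpace ℝ (Fin n) → ℝ),
        (∀ i, RadialSchauder.IsRadialTest (u i)) → RadialSchauder.IsRadialTest v →
        RadialSchauder.IsRadialTest (fun x => u 0 x * u 1 x * u 2 x * F (‖x‖ * v x)) ∧
        RadialSchauder.hInterNorm (s - 1) k (fun x => u 0 x * u 1 x * u 2 x * F (‖x‖ * v x)) ≤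
          ENNReal.ofReal C * (∏ i, RadialSchauder.hInterNorm s k (u i)) *
            ∑ j ∈ Finset.range (k + 1),
              RadialSchauder.hInterNorm s k (fun x => (v x : ℂ)) ^ (2 * j) := by
  have : NeZero n := ⟨by omega⟩
  have hE : EvenBounded F := ⟨hF, hFeven, hFbdd⟩
  have hn' : (5 : ℝ) ≤ n := by exact_mod_cast hn
  have hk' : (n : ℝ) < k := by exact_mod_cast hk
  obtain ⟨hδ0, hδ1, -⟩ := excess_bounds hn hs₁ hs₂
  have hs0 : 0 ≤ s := by linarith
  have hms : ((n / 2 - 2 : ℕ) : ℝ) ≤ s - 1 := by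
    rcases cast_eq_or_cast_eq_of_five_le hn rfl with ⟨h, -⟩ | h <;> linarith
  obtain ⟨C₁, hC₁, h₁⟩ := exists_l2Bound_low hn hE hs₁ hs₂ hk
  obtain ⟨C₂, hC₂, h₂⟩ := exists_l2Bound_high hn hE hs₁ hs₂ hk
  obtain ⟨C₃, hC₃, h₃⟩ := exists_hInterNorm_le (n := n) hms (by linarith : s - 1 ≤ k)
  -- `2 ^ k` bounds the binomial coefficients when `(1 + M²) ^ k` is expanded; the summand 1 only
  -- ensures strict positivity.
  refine ⟨C₃ * (C₁ + C₂) * 2 ^ k + 1, by positivity, fun u v hu hv =>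
    ⟨isRadialTest_nonlinearity hE hu hv, ?_⟩⟩
  obtain ⟨g₁, hg₁, hfg₁⟩ := h₁ u v hu hv
  obtain ⟨g₂, hg₂, hfg₂⟩ := h₂ u v hu hv
  have hNu : ∀ i, hInterNorm s k (u i) = ENNReal.ofReal (hInterNorm s k (u i)).toReal :=
    fun i => (ENNReal.ofReal_toReal ((hu i).hInterNorm_ne_top hs0 (Nat.cast_nonneg k))).symm
  have hMv : hInterNorm s k (fun x => (v x : ℂ)) =
      ENNReal.ofReal (hInterNorm s k fun x => (v x : ℂ)).toReal :=
    (ENNReal.ofReal_toReal (hv.ofReal.hInterNorm_ne_top hs0 (Nat.cast_nonneg k))).symm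
  have hP : 0 ≤ ∏ i, (hInterNorm s k (u i)).toReal :=
    Finset.prod_nonneg fun i _ => ENNReal.toReal_nonneg
  obtain ⟨P, hPdef⟩ : ∃ P : ℝ, P = ∏ i, (hInterNorm s k (u i)).toReal := ⟨_, rfl⟩
  obtain ⟨M, hM⟩ : ∃ M : ℝ, M = (hInterNorm s k fun x => (v x : ℂ)).toReal := ⟨_, rfl⟩
  have hM0 : 0 ≤ M := by rw [hM]; exact ENNReal.toReal_nonneg
  have hPu : ∏ i, hInterNorm s k (u i) = ENNReal.ofReal P := by
    rw [hPdef, ENNReal.ofReal_prod_of_nonneg fun i _ => ENNReal.toReal_nonneg]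
    exact Finset.prod_congr rfl fun i _ => hNu i
  rw [← hPdef] at hP hg₁ hg₂
  rw [← hM] at hMv hg₁ hg₂
  have hS : ∑ j ∈ Finset.range (k + 1), hInterNorm s k (fun x => (v x : ℂ)) ^ (2 * j) =
      ENNReal.ofReal (∑ j ∈ Finset.range (k + 1), M ^ (2 * j)) := by
    rw [hMv, ENNReal.ofReal_sum_of_nonneg fun j _ => by positivity]
    exact Finset.sum_congr rfl fun j _ => (ENNReal.ofReal_pow hM0 _).symm
  have hb : 0 ≤ P * (1 + M ^ 2) ^ k := by positivity
  have h := h₃ _ (isRadialTest_nonlinearity hE hu hv)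
    (ENNReal.ofReal ((C₁ + C₂) * (P * (1 + M ^ 2) ^ k)))
    ((hg₁.mono (by gcongr; linarith)).lintegral_le hfg₁)
    ((hg₂.mono (by gcongr; linarith)).lintegral_le hfg₂)
  refine h.trans ?_
  rw [hPu, hS, ← ENNReal.ofReal_mul hC₃, ← ENNReal.ofReal_mul (by positivity),
    ← ENNReal.ofReal_mul (by positivity)]
  refine ENNReal.ofReal_le_ofReal ?_
  have hsum : 0 ≤ ∑ j ∈ Finset.range (k + 1), M ^ (2 * j) :=
    Finset.sum_nonneg fun j _ => by positivity
  calc C₃ * ((C₁ + C₂) * (P * (1 + M ^ 2) ^ k))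
      ≤ C₃ * ((C₁ + C₂) * (P * (2 ^ k * ∑ j ∈ Finset.range (k + 1), M ^ (2 * j)))) := by
        gcongr
        exact one_add_pow_le_sum k
    _ = C₃ * (C₁ + C₂) * 2 ^ k * P * ∑ j ∈ Finset.range (k + 1), M ^ (2 * j) := by ring
    _ ≤ _ := by
        gcongr
        linarith
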